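/- **Setting.** Let $2\le M<N$. A base station with $N$ antennas serves $K$ users with $M$ antennas each. The channel of user $\ell$ is $\mathbf H_\ell=\mathbf R_\ell^{1/2}\widetilde{\mathbf H}_\ell\in\mathbb C^{M\times N}$, where $\mathbf R_\ell$ is Hermitian positive definite and $\widetilde{\mathbf H}_\ell$ has i.i.d. $\mathcal{CN}(0,1)$ entries. User $\ell$ has a random codebook $\mathcal C_\ell$ of $2^B$ codewords that are uniformly distributed on the unit sphere of $\mathbb C^N$ (RVQ). All channel entries and codewords of all users are independent. A random set $S$ of $N$ users is selected independently of the channels and codebooks (for example uniformly). Write $\delta(\mathbf h,\mathbf u)=\sqrt{1-|\mathbf h^H\mathbf u|^2/\|\mathbf h\|^2}$ for $\|\mathbf u\|=1$. Each selected user applies quantization-based combining: $(\mathbf c_\ell,\bar{\mathbf h}_\ell)$ minimizes $\delta(\mathbf H_\ell^H\mathbf c,\mathbf u)$ over $\|\mathbf c\|=1$, $\mathbf u\in\mathcal C_\ell$; put $\mathbf h_\ell=\mathbf H_\ell^H\mathbf c_\ell$. For $\ell\in S$ let $\mathbf w_\ell$ (resp. $\bar{\mathbf w}_\ell$) be a unit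 vector orthogonal to $\mathbf h_j$ (resp. $\bar{\mathbf h}_j$) for all $j\in S\setminus\{\ell\}$. With total power $P\ge0$ divided equally, the rates of user $k\in S$ with perfect and with quantized channel information are $$g_k=\log_2\Big(1+\tfrac PN|\mathbf h_k^H\mathbf w_k|^2\Big),\qquad g_k^{Q}=\log_2\Big(1+\frac{\frac PN|\mathbf h_k^H\bar{\mathbf w}_k|^2}{1+\sum_{\ell\in S\setminus\{k\}}\frac PN|\mathbf h_k^H\bar{\mathbf w}_\ell|^2}\Big).$$ **Theorem.** Let $k$ be a user that is selected with positive probability, suppose that $\mathbf R_k$ has eigenvalues $\lambda_M>\dots>\lambda_1>0$, and let $\mathbb E$ denote the expectation conditioned on $k\in S$. Then $\delta^2(\mathbf h_k,\bar{\mathbf h}_k)$, $\|\mathbf h_k\|^2$, $g_k$ and $g_k^Q$ are integrable, the average quantization distortion $D^{QBC}_B=\mathbb E\{\delta^2(\mathbf h_k,\bar{\mathbf h}_k)\}$ depends only on $N,M,B$, and the average rate loss satisfies $$\mathbb E\{g_k-g_k^{Q}\}\le\log_2\Big(1+\frac PN D^{QBC}_B\,G_k\Big).$$ Here $G_k=\mathbb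 E\{\|\mathbf h_k\|^2\}$ is the average effective-channel gain, which with $\mu_n=1/\lambda_n$ equals $$G_k=\sum_{m=1}^{M-1}\sum_{n=1}^{m}\sum_{t=m+1}^{M}\frac{(N-M+1)A_{m,n,t}}{(\mu_n-\mu_t)\prod_{i=1,i\ne n}^{m}(\mu_n-\mu_i)\prod_{j=m+1,j\neq t}^{M}(\mu_j-\mu_t)},$$ $$\begin{aligned}A_{m,n,t}={}&\log_e\Big(\frac{\mu_{m+1}}{\mu_m}\Big)\frac{\mu_n^{m-1}}{(-\mu_t)^{2+m-M}}\big(m\mu_t+\mu_n(M-m-1)\big)\\&+\sum_{\substack{0\le s\le m,\ 0\le r\le M-m-1\\ s+r\ge1}}\binom ms\binom{M-m-1}r\frac{\mu_n^{m-s}(-\mu_t)^{M-m-1-r}}{(-1)^s(s+r)}\Big(\frac{m-s}{\mu_n}+\frac{M-m-1-r}{\mu_t}\Big)\big(\mu_m^{r+s}-\mu_{m+1}^{r+s}\big).\end{aligned}$$ Moreover, $D^{QBC}_B\approx 2^{-B/(N-M)}\binom{N-1}{M-1}^{-1/(N-M)}$ in the following sense: for fixed $N$ and $M$, as $B\to\infty$,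 $$\frac{D^{QBC}_B}{2^{-B/(N-M)}\binom{N-1}{M-1}^{-1/(N-M)}}\longrightarrow\Gamma\Big(1+\frac1{N-M}\Big).$$ -/

import Mathlib

open MeasureTheory ProbabilityTheory Filter Topology
open scoped Matrix MatrixOrder ComplexOrder

noncomputable section

namespace ZFC

/-- The standard circularly symmetric complex Gaussian law `CN(0,1)`: independent real and
imaginary parts, each `N(0, 1/2)`. -/
def stdComplexGaussian : Measure ℂ :=
  ((gaussianReal 0 (1 / 2)).prod (gaussianReal 0 (1 / 2))).map
    (fun p : ℝ × ℝ => (p.1 : ℂ) + (p.2 : ℂ) * Complex.I)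

/-- The isotropic (uniform) law on the unit sphere of `ℂ^N`: a probability measure carried by the
unit sphere and invariant under all unitary maps. -/
structure IsIsotropic {N : ℕ} (ν : Measure (EuclideanSpace ℂ (Fin N))) : Prop where
  isProbabilityMeasure : IsProbabilityMeasure ν
  ae_norm_eq_one : ∀ᵐ u ∂ν, ‖u‖ = 1
  map_unitary : ∀ U : EuclideanSpace ℂ (Fin N) ≃ₗᵢ[ℂ] EuclideanSpace ℂ (Fin N), ν.map U = ν

/-- The channel matrix `H = R^{1/2} H̃` with receive correlation `R`
(positive semidefinite square root). -/
def channel {M N : ℕ} (R : Matrix (Fin M) (Fin M) ℂ) (X : Fin M → Fin N → ℂ) :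
    Matrix (Fin M) (Fin N) ℂ :=
  CFC.sqrt R * Matrix.of X

/-- The effective channel `h = Hᴴ c` obtained with the receive combiner `c`. -/
def effChannel {M N : ℕ} (H : Matrix (Fin M) (Fin N) ℂ) (c : EuclideanSpace ℂ (Fin M)) :
    EuclideanSpace ℂ (Fin N) :=
  WithLp.toLp 2 (Hᴴ *ᵥ c.ofLp)

/-- Squared chordal distance between the line spanned by `h` and the one spanned by the unit
vector `u`: `δ²(h, u) = 1 - |hᴴ u|² / ‖h‖²`. -/
def chordalSq {N : ℕ} (h u : EuclideanSpace ℂ (Fin N)) : ℝ :=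
  1 - ‖inner ℂ h u‖ ^ 2 / ‖h‖ ^ 2

/-- Chordal distance `δ(h, u)`. -/
def chordal {N : ℕ} (h u : EuclideanSpace ℂ (Fin N)) : ℝ :=
  √(chordalSq h u)

/-- Quantization-based combining: the unit-norm combiner `c` and the codeword `hbar` jointly
minimize the chordal distance `δ(Hᴴ c, u)` over unit-norm combiners and codewords `u`. -/
structure IsQBC {M N L : ℕ} (H : Matrix (Fin M) (Fin N) ℂ)
    (codebook : Fin L → EuclideanSpace ℂ (Fin N))
    (c : EuclideanSpace ℂ (Fin M)) (hbar : EuclideanSpace ℂ (Fin N)) : Prop where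
  norm_combiner : ‖c‖ = 1
  mem_codebook : ∃ i, hbar = codebook i
  minimal : ∀ c' : EuclideanSpace ℂ (Fin M), ‖c'‖ = 1 → ∀ i,
    chordal (effChannel H c) hbar ≤ chordal (effChannel H c') (codebook i)

/-- Zero-forcing beamformers for the scheduling set `S` and the channel vectors `v`: unit-norm
vectors, each orthogonal to the channel vectors of all other scheduled users. -/
def IsZeroForcing {N K : ℕ} (S : Finset (Fin K)) (v w : Fin K → EuclideanSpace ℂ (Fin N)) : Prop :=
  ∀ k ∈ S, ‖w k‖ = 1 ∧ ∀ l ∈ S, l ≠ k → inner ℂ (v l) (w k) = 0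

/-- A downlink with `N` transmit antennas, `K` users having `M` receive antennas each, random
selection of `N` users, and `B` bits of feedback per user under random vector quantization (each
user has its own random codebook) with quantization-based combining. -/
structure System (N M B K : ℕ) {Ω : Type*} [MeasurableSpace Ω] (μ : Measure Ω) where
  /-- receive correlation matrices -/
  R : Fin K → Matrix (Fin M) (Fin M) ℂ
  R_posDef : ∀ l, (R l).PosDef
  /-- the random scheduling set -/
  S : Ω → Finset (Fin K)
  S_measurable : Measurable fun ω (l : Fin K) => l ∈ S ω
  S_card : ∀ᵐ ω ∂μ, (S ω).card = N
  /-- the matrices with independent `CN(0,1)` entries, one for each user -/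
  Htilde : Ω → Fin K → Fin M → Fin N → ℂ
  /-- the random codebooks, `2 ^ B` codewords for each user -/
  codebook : Ω → Fin K → Fin (2 ^ B) → EuclideanSpace ℂ (Fin N)
  /-- the law of each codeword -/
  ν : Measure (EuclideanSpace ℂ (Fin N))
  ν_isotropic : IsIsotropic ν
  /-- all entries of `Htilde` and all codewords are independent, with laws `CN(0,1)` and `ν` -/
  law : HasLaw (fun ω => (Htilde ω, codebook ω))
    ((Measure.pi fun _ : Fin K => Measure.pi fun _ : Fin M => Measure.pi fun _ : Fin N =>
        stdComplexGaussian).prod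
      (Measure.pi fun _ : Fin K => Measure.pi fun _ : Fin (2 ^ B) => ν)) μ
  /-- the user selection is independent of the channels and of the codebooks -/
  S_indep : IndepFun (fun ω (l : Fin K) => l ∈ S ω) (fun ω => (Htilde ω, codebook ω)) μ
  /-- receive combiners -/
  c : Ω → Fin K → EuclideanSpace ℂ (Fin M)
  c_aemeasurable : AEMeasurable c μ
  /-- quantized effective channels -/
  hbar : Ω → Fin K → EuclideanSpace ℂ (Fin N)
  hbar_aemeasurable : AEMeasurable hbar μ
  qbc : ∀ᵐ ω ∂μ, ∀ l ∈ S ω,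
    IsQBC (channel (R l) (Htilde ω l)) (codebook ω l) (c ω l) (hbar ω l)
  /-- beamformers under perfect CSI -/
  w : Ω → Fin K → EuclideanSpace ℂ (Fin N)
  w_aemeasurable : AEMeasurable w μ
  w_zeroForcing : ∀ᵐ ω ∂μ,
    IsZeroForcing (S ω) (fun l => effChannel (channel (R l) (Htilde ω l)) (c ω l)) (w ω)
  /-- beamformers under quantized CSI -/
  wbar : Ω → Fin K → EuclideanSpace ℂ (Fin N)
  wbar_aemeasurable : AEMeasurable wbar μ
  wbar_zeroForcing : ∀ᵐ ω ∂μ, IsZeroForcing (S ω) (hbar ω) (wbar ω)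

namespace System

variable {N M B K : ℕ} {Ω : Type*} [MeasurableSpace Ω] {μ : Measure Ω}

/-- The effective channel `h_k = H_kᴴ c_k` of user `k`. -/
def h (sys : System N M B K μ) (k : Fin K) (ω : Ω) : EuclideanSpace ℂ (Fin N) :=
  effChannel (channel (sys.R k) (sys.Htilde ω k)) (sys.c ω k)

/-- Information rate of user `k` with perfect CSI and equal power allocation. -/
def rate (sys : System N M B K μ) (P : ℝ) (k : Fin K) (ω : Ω) : ℝ :=
  Real.logb 2 (1 + P / N * ‖inner ℂ (sys.h k ω) (sys.w ω k)‖ ^ 2)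

/-- Information rate of user `k` with quantized CSI and equal power allocation. -/
def rateQ (sys : System N M B K μ) (P : ℝ) (k : Fin K) (ω : Ω) : ℝ :=
  Real.logb 2 (1 + P / N * ‖inner ℂ (sys.h k ω) (sys.wbar ω k)‖ ^ 2 /
    (1 + ∑ l ∈ (sys.S ω).erase k, P / N * ‖inner ℂ (sys.h k ω) (sys.wbar ω l)‖ ^ 2))

/-- Squared quantization error `δ²(h_k, hbar_k)` of user `k`. -/
def distortion (sys : System N M B K μ) (k : Fin K) (ω : Ω) : ℝ :=
  chordal (sys.h k ω) (sys.hbar ω k) ^ 2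

/-- The event that user `k` is selected. -/
def selected (sys : System N M B K μ) (k : Fin K) : Set Ω :=
  {ω | k ∈ sys.S ω}

end System

/-- The coefficient `A_{m,n,t}` of the closed-form gain, in terms of `x n = 1 / λ_n`. -/
def coeffA (M : ℕ) (x : ℕ → ℝ) (m n t : ℕ) : ℝ :=
  Real.log (x (m + 1) / x m) * x n ^ (m - 1) / (-x t) ^ ((2 : ℤ) + m - M) *
      (m * x t + x n * ((M : ℝ) - m - 1)) +
    ∑ s ∈ Finset.range (m + 1), ∑ r ∈ Finset.range (M - m),
      if s + r = 0 then 0 else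
        (m.choose s : ℝ) * ((M - m - 1).choose r : ℝ) *
          (x n ^ (m - s) * (-x t) ^ (M - m - 1 - r) / ((-1) ^ s * ((s : ℝ) + r))) *
          (((m : ℝ) - s) / x n + ((M : ℝ) - m - 1 - r) / x t) *
          (x m ^ (r + s) - x (m + 1) ^ (r + s))

/-- The closed-form average effective-channel gain, in terms of `x n = 1 / λ_n`, `1 ≤ n ≤ M`. -/
def gain (N M : ℕ) (x : ℕ → ℝ) : ℝ :=
  ∑ m ∈ Finset.Icc 1 (M - 1), ∑ n ∈ Finset.Icc 1 m, ∑ t ∈ Finset.Icc (m + 1) M,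
    ((N : ℝ) - M + 1) * coeffA M x m n t /
      ((x n - x t) * (∏ i ∈ (Finset.Icc 1 m).erase n, (x n - x i)) *
        ∏ j ∈ (Finset.Icc (m + 1) M).erase t, (x j - x t))

/-- The approximation `2^{-B/(N-M)} binom(N-1,M-1)^{-1/(N-M)}` of the average distortion. -/
def approxDistortion (N M B : ℕ) : ℝ :=
  (2 : ℝ) ^ (-(B : ℝ) / ((N : ℝ) - M)) *
    ((N - 1).choose (M - 1) : ℝ) ^ (-(1 : ℝ) / ((N : ℝ) - M))

end ZFC

end

/-! Unitary invariance carries the whole argument. Write `X` for the white channel matrix of the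
user and `P` for the orthogonal projection of `ℂ^N` onto the range of `Xᴴ`, the row space. Almost
surely `X` has full rank, so the vectors `Hᴴc` fill every direction of this space. By Cauchy–Schwarz
the best combiner for a codeword `u` aligns the channel with `Pu`. Hence QBC picks the codeword with
the longest projection, ties having probability zero. The distortion is `1 - ‖Pu‖²`, and up to a
phase `h = Pu / ‖R^{-1/2} (XXᴴ)⁻¹ X u‖` (`IsQBC.eq_best`).

Distortion. For isotropic `u`, the law of `1 - ‖Pu‖²` is a Beta law that does not depend on `X`
(`map_adjoint_eq_betaLaw`). So `D` is the mean of the minimum of `2^B` independent Beta variables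
(`lintegral_one_sub_proj_best`). Their distribution function behaves like `binom(N-1, M-1) t^(N-M)`
at the origin. Rescaling `t` by `2^{-B/(N-M)}` and dominated convergence produce the Gamma constant
(`tendsto_minBetaMean`).

Gain. `‖h‖²` depends on `u` only through the direction of `Pu` inside the row space, and that
direction is uniform and independent of `‖Pu‖`. Hence selecting the best codeword does not bias the
gain, and `E[δ²‖h‖²] = D·G` (`lintegral_best`, `lintegral_chordalSq_mul`). Left rotations of `X`
separate the correlation: `G = (N-M+1) · E[1 / bᴴR⁻¹b]` with `b` uniform on the sphere of `ℂ^M`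
(`lintegral_meanGain`). The first factor is the mean squared distance of a Gaussian row to the span
of the other rows. The second is `(M-1) ∫₀^∞ ∏ (1 + sμ_i)⁻¹ ds` (`lintegral_sphereLaw_inv`). That
the stated triple sum has the same value is a Lagrange interpolation identity (`gain_eq`).

Rates. Zero forcing turns each `|hᴴw|` into the distance of `h` to the span of `N-1` vectors. For
the wanted signal these vectors belong to the other users, so they are independent of the isotropic
vector `h_k`. The signal term therefore has the same law with exact and with quantized information
(`lintegral_spanDist`). The loss is thus at most `E log₂(1 + I)`, and by Jensen at most `log₂(1 + E
I)`. The beamformer of another user is isotropic in the orthogonal complement of `hbar_k`, so each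
of the `N-1` interferers has mean power `(P/N) E[δ²‖h‖²]/(N-1)` (`lintegral_interference`), and `E I
= (P/N) D G`. Independence of the scheduling reduces conditional means to means over a fixed set of
users (`System.lintegral_selection`). -/

noncomputable section
open scoped ENNReal
-- Gaussian laws and their invariance under linear isometries.
namespace ZFC

/-- The densities vanish nowhere and are finite, so the identity may be inverted: weighting the
product of the probability measures by the inverse densities gives back `Measure.pi μ` on boxes,
since coordinates are independent under a product of probability measures. -/
theorem pi_withDensity {ι : Type*} [Fintype ι] {α : ι → Type*} [∀ i, MeasurableSpace (α i)]
    (μ : ∀ i, Measure (α i)) [∀ i, SigmaFinite (μ i)] (f : ∀ i, α i → ℝ≥0∞)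
    (hf : ∀ i, Measurable (f i)) (h0 : ∀ i x, f i x ≠ 0) (htop : ∀ i x, f i x ≠ ∞)
    [∀ i, IsProbabilityMeasure ((μ i).withDensity (f i))] :
    Measure.pi (fun i => (μ i).withDensity (f i)) =
      (Measure.pi μ).withDensity (fun x => ∏ i, f i (x i)) := by
  have hprod : Measurable (fun x : ∀ i, α i => ∏ i, f i (x i)) :=
    Finset.measurable_prod _ fun i _ => (hf i).comp (measurable_pi_apply i)
  have key : Measure.pi μ = (Measure.pi (fun i => (μ i).withDensity (f i))).withDensity
      (fun x => ∏ i, (f i (x i))⁻¹) := by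
    refine Measure.pi_eq fun s hs => ?_
    rw [withDensity_apply _ (MeasurableSet.univ_pi hs), ← lintegral_indicator (MeasurableSet.univ_pi hs)]
    have : ∀ x : ∀ i, α i, (Set.pi Set.univ s).indicator (fun x => ∏ i, (f i (x i))⁻¹) x =
        ∏ i, (s i).indicator (fun y => (f i y)⁻¹) (x i) := by
      intro x
      by_cases hx : x ∈ Set.pi Set.univ s
      · rw [Set.indicator_of_mem hx]
        exact Finset.prod_congr rfl fun i _ =>
          (Set.indicator_of_mem (hx i trivial) (fun y => (f i y)⁻¹)).symm
      · rw [Set.indicator_of_notMem hx]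
        simp only [Set.mem_pi, Set.mem_univ, true_imp_iff, not_forall] at hx
        obtain ⟨i, hi⟩ := hx
        exact (Finset.prod_eq_zero (Finset.mem_univ i) (Set.indicator_of_notMem hi _)).symm
    simp_rw [this]
    have hind : iIndepFun (fun i (ω : ∀ i, α i) => (s i).indicator (fun y => (f i y)⁻¹) (ω i))
        (Measure.pi (fun i => (μ i).withDensity (f i))) :=
      iIndepFun_pi (X := fun i => (s i).indicator (fun y => (f i y)⁻¹))
        fun i => ((hf i).inv.indicator (hs i)).aemeasurable
    rw [lintegral_prod_eq_prod_lintegral_of_indepFun _ _ hind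
      fun i => ((hf i).inv.indicator (hs i)).comp (measurable_pi_apply i)]
    refine Finset.prod_congr rfl fun i _ => ?_
    have hmp := measurePreserving_eval (fun i => (μ i).withDensity (f i)) i
    have := hmp.lintegral_comp ((hf i).inv.indicator (hs i))
    simp only [Function.eval] at this
    rw [show (∫⁻ ω : ∀ i, α i, (s i).indicator (fun y => (f i y)⁻¹) (ω i)
      ∂(Measure.pi (fun i => (μ i).withDensity (f i)))) = _ from this]
    rw [lintegral_withDensity_eq_lintegral_mul _ (hf i) ((hf i).inv.indicator (hs i))]
    have h1 : (f i * (s i).indicator (f i)⁻¹) = (s i).indicator (fun _ => 1) := by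
      funext y
      by_cases hy : y ∈ s i
      · simp [hy, ENNReal.mul_inv_cancel (h0 i y) (htop i y)]
      · simp [hy]
    rw [h1, lintegral_indicator (hs i)]
    simp
  have h2 : ∀ x : ∀ i, α i, ∏ i, (f i (x i))⁻¹ = (∏ i, f i (x i))⁻¹ := by
    intro x
    rw [ENNReal.prod_inv_distrib]
    intro i _ j _ _
    exact Or.inl (h0 i _)
  simp_rw [h2] at key
  have h3 := withDensity_inv_same₀ (μ := Measure.pi (fun i => (μ i).withDensity (f i)))
    (f := fun x => (∏ i, f i (x i))⁻¹) hprod.inv.aemeasurable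
    (Eventually.of_forall fun x => ENNReal.inv_ne_zero.2 <|
      ENNReal.prod_ne_top fun i _ => htop i _)
    (Eventually.of_forall fun x => ENNReal.inv_ne_top.2 <|
      Finset.prod_ne_zero_iff.2 fun i _ => h0 i _)
  rw [← key] at h3
  simp only [inv_inv] at h3
  exact h3.symm

/-- A linear automorphism multiplies Haar measure by a constant and leaves the density alone, so it
multiplies the weighted measure by a constant. Total mass one forces this constant to be 1, and the
determinant need not be computed. -/
theorem map_withDensity_of_invariant {V : Type*} [NormedAddCommGroup V] [NormedSpace ℝ V]
    [FiniteDimensional ℝ V] [MeasurableSpace V] [BorelSpace V] (μ : Measure V)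
    [μ.IsAddHaarMeasure] (f : V → ℝ≥0∞) (hf : Measurable f)
    [IsProbabilityMeasure (μ.withDensity f)] (T : V ≃ₗ[ℝ] V) (hT : ∀ x, f (T x) = f x) :
    (μ.withDensity f).map T = μ.withDensity f := by
  have hTm : Measurable T := (LinearMap.continuous_of_finiteDimensional (T : V →ₗ[ℝ] V)).measurable
  have hdet : LinearMap.det (T : V →ₗ[ℝ] V) ≠ 0 := (LinearEquiv.isUnit_det' T).ne_zero
  have h1 := Measure.map_linearMap_addHaar_eq_smul_addHaar μ hdet
  set c : ℝ≥0∞ := ENNReal.ofReal |(LinearMap.det (T : V →ₗ[ℝ] V))⁻¹|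
  have h1' : μ.map T = c • μ := h1
  have key : (μ.withDensity f).map T = c • μ.withDensity f := by
    ext s hs
    rw [Measure.map_apply hTm hs, withDensity_apply _ (hTm hs), Measure.smul_apply,
      withDensity_apply _ hs, smul_eq_mul]
    have e : ∫⁻ a in s, f a ∂(μ.map T) = c * ∫⁻ a in s, f a ∂μ := by
      rw [h1', Measure.restrict_smul, lintegral_smul_measure, smul_eq_mul]
    rw [← e, setLIntegral_map hs hf hTm]
    simp_rw [hT]
  have hc : c = 1 := by
    have hp : IsProbabilityMeasure ((μ.withDensity f).map T) :=
      Measure.isProbabilityMeasure_map hTm.aemeasurable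
    have := measure_univ (μ := (μ.withDensity f).map T)
    rw [key, Measure.smul_apply, measure_univ, smul_eq_mul, mul_one] at this
    exact this
  rw [key, hc, one_smul]

instance : IsProbabilityMeasure stdComplexGaussian := by
  unfold stdComplexGaussian
  exact Measure.isProbabilityMeasure_map (by fun_prop)

/-- The density of the standard complex Gaussian law. -/
def cgDensity (z : ℂ) : ℝ≥0∞ := ENNReal.ofReal (Real.pi⁻¹ * Real.exp (-‖z‖ ^ 2))

theorem measurable_cgDensity : Measurable cgDensity := by unfold cgDensity; fun_prop

theorem cgDensity_ne_zero (z : ℂ) : cgDensity z ≠ 0 := by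
  unfold cgDensity
  rw [Ne, ENNReal.ofReal_eq_zero, not_le]
  positivity

theorem stdComplexGaussian_eq : stdComplexGaussian = volume.withDensity cgDensity := by
  have hv : (1 / 2 : NNReal) ≠ 0 := by norm_num
  have h1 : gaussianReal 0 (1 / 2) = volume.withDensity (gaussianPDF 0 (1 / 2)) :=
    gaussianReal_of_var_ne_zero 0 hv
  have h2 : (fun p : ℝ × ℝ => (p.1 : ℂ) + (p.2 : ℂ) * Complex.I) =
      Complex.measurableEquivRealProd.symm := by
    funext p
    exact (Complex.mk_eq_add_mul_I _ _).symm
  have h3 : (gaussianReal 0 (1 / 2)).prod (gaussianReal 0 (1 / 2)) =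
      (volume : Measure (ℝ × ℝ)).withDensity
        (fun p => cgDensity (Complex.measurableEquivRealProd.symm p)) := by
    rw [h1, prod_withDensity (measurable_gaussianPDF _ _) (measurable_gaussianPDF _ _)]
    congr 1
    funext p
    rw [gaussianPDF, gaussianPDF, ← ENNReal.ofReal_mul (gaussianPDFReal_nonneg _ _ _), cgDensity]
    congr 1
    rw [gaussianPDFReal, gaussianPDFReal, ← Complex.normSq_eq_norm_sq, Complex.normSq_apply]
    have : (2 * Real.pi * ((1 / 2 : NNReal) : ℝ)) = Real.pi := by push_cast; ring
    rw [this]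
    simp only [Complex.measurableEquivRealProd_symm_apply]
    have h4 : (√Real.pi)⁻¹ * (√Real.pi)⁻¹ = Real.pi⁻¹ := by
      rw [← mul_inv, Real.mul_self_sqrt Real.pi_pos.le]
    rw [mul_mul_mul_comm, h4, ← Real.exp_add]
    congr 2
    push_cast
    ring
  have h5 := Complex.volume_preserving_equiv_real_prod.symm.map_eq
  unfold stdComplexGaussian
  rw [h2, h3]
  ext s hs
  rw [Measure.map_apply Complex.measurableEquivRealProd.symm.measurable hs,
    withDensity_apply _ (Complex.measurableEquivRealProd.symm.measurable hs),
    withDensity_apply _ hs]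
  conv_rhs => rw [← h5]
  rw [setLIntegral_map hs measurable_cgDensity Complex.measurableEquivRealProd.symm.measurable]

theorem prod_cgDensity {ι : Type*} [Fintype ι] (x : ι → ℂ) :
    ∏ i, cgDensity (x i) =
      ENNReal.ofReal ((Real.pi⁻¹) ^ Fintype.card ι * Real.exp (-∑ i, ‖x i‖ ^ 2)) := by
  unfold cgDensity
  rw [← ENNReal.ofReal_prod_of_nonneg fun i _ => by positivity, Finset.prod_mul_distrib,
    Finset.prod_const, Finset.card_univ, ← Real.exp_sum, Finset.sum_neg_distrib]

theorem pi_stdComplexGaussian_eq (ι : Type*) [Fintype ι] :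
    Measure.pi (fun _ : ι => stdComplexGaussian) =
      (volume : Measure (ι → ℂ)).withDensity (fun x => ∏ i, cgDensity (x i)) := by
  have hp : IsProbabilityMeasure ((volume : Measure ℂ).withDensity cgDensity) := by
    rw [← stdComplexGaussian_eq]; infer_instance
  rw [stdComplexGaussian_eq]
  exact pi_withDensity (fun _ : ι => (volume : Measure ℂ)) (fun _ => cgDensity)
    (fun _ => measurable_cgDensity) (fun _ => cgDensity_ne_zero) fun _ _ => ENNReal.ofReal_ne_top

theorem prod_cgDensity_ne_top {ι : Type*} [Fintype ι] (x : ι → ℂ) :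
    ∏ i, cgDensity (x i) ≠ ∞ := by rw [prod_cgDensity]; exact ENNReal.ofReal_ne_top

/-- The law of a matrix with independent `CN(0,1)` entries. -/
abbrev gaussMatrix (M N : ℕ) : Measure (Fin M → Fin N → ℂ) :=
  Measure.pi fun _ : Fin M => Measure.pi fun _ : Fin N => stdComplexGaussian

theorem measurable_prod_cgDensity (ι : Type*) [Fintype ι] :
    Measurable (fun x : ι → ℂ => ∏ i, cgDensity (x i)) :=
  Finset.measurable_prod _ fun i _ => measurable_cgDensity.comp (measurable_pi_apply i)

theorem gaussMatrix_eq (M N : ℕ) :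
    gaussMatrix M N = (volume : Measure (Fin M → Fin N → ℂ)).withDensity
      (fun x => ∏ i, ∏ j, cgDensity (x i j)) := by
  have hp : IsProbabilityMeasure ((volume : Measure (Fin N → ℂ)).withDensity
      (fun x => ∏ i, cgDensity (x i))) := by
    rw [← pi_stdComplexGaussian_eq]; infer_instance
  unfold gaussMatrix
  rw [pi_stdComplexGaussian_eq]
  exact pi_withDensity (fun _ : Fin M => (volume : Measure (Fin N → ℂ)))
    (fun _ x => ∏ i, cgDensity (x i))
    (fun _ => measurable_prod_cgDensity _)
    (fun _ _ => Finset.prod_ne_zero_iff.2 fun i _ => cgDensity_ne_zero _)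
    fun _ _ => prod_cgDensity_ne_top _

theorem prod_prod_cgDensity {M N : ℕ} (x : Fin M → Fin N → ℂ) :
    ∏ i, ∏ j, cgDensity (x i j) =
      ENNReal.ofReal ((Real.pi⁻¹) ^ (M * N) * Real.exp (-∑ i, ∑ j, ‖x i j‖ ^ 2)) := by
  simp_rw [prod_cgDensity]
  rw [← ENNReal.ofReal_prod_of_nonneg fun i _ => by positivity, Finset.prod_mul_distrib,
    Finset.prod_const, Finset.card_univ, ← Real.exp_sum, Finset.sum_neg_distrib, ← pow_mul]
  simp [mul_comm]

/-- A linear map as a real linear automorphism, when it preserves a definite function. -/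
theorem exists_real_linearEquiv {V : Type*} [AddCommGroup V] [Module ℂ V] [Module.Finite ℂ V]
    (T : V →ₗ[ℂ] V) (hT : ∀ x, T x = 0 → x = 0) :
    ∃ T' : V ≃ₗ[ℂ] V, ∀ x, T' x = T x := by
  have hinj : Function.Injective T := by
    rw [← LinearMap.ker_eq_bot, LinearMap.ker_eq_bot']
    exact hT
  exact ⟨LinearEquiv.ofInjectiveEndo T hinj, fun x => rfl⟩

/-- The joint density is a function of the sum of squared moduli. Both rotation invariances of the
channel, `gaussMatrix_rotR` and `gaussMatrix_rotL`, come from here. -/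
theorem gaussMatrix_map {M N : ℕ} (T : (Fin M → Fin N → ℂ) →ₗ[ℂ] (Fin M → Fin N → ℂ))
    (hT : ∀ x, ∑ i, ∑ j, ‖T x i j‖ ^ 2 = ∑ i, ∑ j, ‖x i j‖ ^ 2) :
    (gaussMatrix M N).map T = gaussMatrix M N := by
  obtain ⟨T', hT'⟩ := exists_real_linearEquiv T (by
    intro x hx
    have h := hT x
    rw [hx] at h
    simp only [Pi.zero_apply, norm_zero, ne_eq, OfNat.ofNat_ne_zero, not_false_eq_true, zero_pow,
      Finset.sum_const_zero] at h
    have h1 := (Finset.sum_eq_zero_iff_of_nonneg fun i _ => by positivity).1 h.symm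
    funext i j
    have h2 := (Finset.sum_eq_zero_iff_of_nonneg fun j _ => by positivity).1
      (h1 i (Finset.mem_univ _)) j (Finset.mem_univ _)
    simpa using h2)
  have hfun : (T : (Fin M → Fin N → ℂ) → (Fin M → Fin N → ℂ)) = T'.restrictScalars ℝ := by
    funext x; exact (hT' x).symm
  have hp : IsProbabilityMeasure ((volume : Measure (Fin M → Fin N → ℂ)).withDensity
      (fun x => ∏ i, ∏ j, cgDensity (x i j))) := by
    rw [← gaussMatrix_eq]; infer_instance
  have hv : (volume : Measure (Fin N → ℂ)).IsAddHaarMeasure := inferInstance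
  have hH : (volume : Measure (Fin M → Fin N → ℂ)).IsAddHaarMeasure :=
    Measure.pi.isAddHaarMeasure fun _ => (volume : Measure (Fin N → ℂ))
  rw [hfun, gaussMatrix_eq]
  refine map_withDensity_of_invariant volume _ ?_ _ ?_
  · exact Finset.measurable_prod _ fun i _ =>
      (measurable_prod_cgDensity _).comp (measurable_pi_apply i)
  · intro x
    rw [prod_prod_cgDensity, prod_prod_cgDensity]
    have : (T'.restrictScalars ℝ) x = T x := hT' x
    rw [this, hT]

/-- The standard complex Gaussian law on `ℂ^n`. -/
def gaussVec (n : ℕ) : Measure (EuclideanSpace ℂ (Fin n)) :=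
  (Measure.pi fun _ : Fin n => stdComplexGaussian).map (WithLp.toLp 2)

instance (n : ℕ) : IsProbabilityMeasure (gaussVec n) :=
  Measure.isProbabilityMeasure_map (by fun_prop)

theorem gaussVec_map {n : ℕ} (U : EuclideanSpace ℂ (Fin n) ≃ₗᵢ[ℂ] EuclideanSpace ℂ (Fin n)) :
    (gaussVec n).map U = gaussVec n := by
  let T : (Fin n → ℂ) ≃ₗ[ℂ] (Fin n → ℂ) :=
    ((WithLp.linearEquiv 2 ℂ (Fin n → ℂ)).symm.trans U.toLinearEquiv).trans
      (WithLp.linearEquiv 2 ℂ (Fin n → ℂ))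
  have hT : ∀ x, WithLp.toLp 2 (T x) = U (WithLp.toLp 2 x) := fun x => rfl
  have hp : IsProbabilityMeasure ((volume : Measure (Fin n → ℂ)).withDensity
      (fun x => ∏ i, cgDensity (x i))) := by
    rw [← pi_stdComplexGaussian_eq]; infer_instance
  have h := map_withDensity_of_invariant (volume : Measure (Fin n → ℂ))
    (fun x => ∏ i, cgDensity (x i)) (measurable_prod_cgDensity _) (T.restrictScalars ℝ) (by
      intro x
      rw [prod_cgDensity, prod_cgDensity]
      congr 4
      have h1 := EuclideanSpace.norm_sq_eq (WithLp.toLp 2 (T x))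
      have h2 := EuclideanSpace.norm_sq_eq (WithLp.toLp 2 x)
      rw [hT, U.norm_map] at h1
      exact h1.symm.trans h2)
  rw [← pi_stdComplexGaussian_eq] at h
  unfold gaussVec
  have hTm : Measurable T :=
    (LinearMap.continuous_of_finiteDimensional (T : (Fin n → ℂ) →ₗ[ℂ] (Fin n → ℂ))).measurable
  conv_rhs => rw [← h]
  rw [Measure.map_map U.continuous.measurable (by fun_prop),
    Measure.map_map (f := T.restrictScalars ℝ) (by fun_prop) hTm]
  rfl

/-- The uniform law on the unit sphere of `ℂ^n`. -/
def sphereLaw (n : ℕ) : Measure (EuclideanSpace ℂ (Fin n)) :=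
  (gaussVec n).map fun g => (‖g‖⁻¹ : ℂ) • g

/-- Proper subspaces are null for the Gaussian law. -/
theorem gaussVec_submodule {n : ℕ} (W : Submodule ℂ (EuclideanSpace ℂ (Fin n))) (hW : W ≠ ⊤) :
    gaussVec n W = 0 := by
  unfold gaussVec
  have hWm : MeasurableSet (W : Set (EuclideanSpace ℂ (Fin n))) :=
    (Submodule.closed_of_finiteDimensional W).measurableSet
  rw [Measure.map_apply (by fun_prop) hWm, pi_stdComplexGaussian_eq]
  refine withDensity_absolutelyContinuous _ _ ?_
  let W' : Submodule ℂ (Fin n → ℂ) := W.comap (WithLp.linearEquiv 2 ℂ (Fin n → ℂ)).symm.toLinearMap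
  have := Measure.addHaar_submodule (volume : Measure (Fin n → ℂ)) (W'.restrictScalars ℝ) (by
    intro h
    apply hW
    rw [eq_top_iff]
    intro x _
    have hx : WithLp.ofLp x ∈ W'.restrictScalars ℝ := by rw [h]; trivial
    exact hx)
  exact this

end ZFC
end

/-! ### Transitivity of the unitary group and uniqueness of the uniform law on the sphere. -/

noncomputable section
open scoped ENNReal
namespace ZFC

/-- Two linear isometric embeddings into the same space differ by a unitary map. -/
theorem exists_unitary_comp {F : Type*} [NormedAddCommGroup F] [InnerProductSpace ℂ F]
    [FiniteDimensional ℂ F] {n : ℕ} (f g : F →ₗᵢ[ℂ] EuclideanSpace ℂ (Fin n)) :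
    ∃ U : EuclideanSpace ℂ (Fin n) ≃ₗᵢ[ℂ] EuclideanSpace ℂ (Fin n), ∀ x, U (f x) = g x := by
  let e : F ≃ₗᵢ[ℂ] LinearMap.range f.toLinearMap := f.equivRange
  let L : LinearMap.range f.toLinearMap →ₗᵢ[ℂ] EuclideanSpace ℂ (Fin n) :=
    g.comp e.symm.toLinearIsometry
  refine ⟨L.extend.toLinearIsometryEquiv rfl, fun x => ?_⟩
  have h := L.extend_apply (e x)
  have h1 : ((e x : LinearMap.range f.toLinearMap) : EuclideanSpace ℂ (Fin n)) = f x := rfl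
  rw [h1] at h
  rw [LinearIsometry.toLinearIsometryEquiv_apply, h]
  simp [L]

/-- Each family is the image of the standard basis under an isometric embedding, and two such
embeddings differ by a unitary map. -/
theorem exists_unitary_of_orthonormal {ι : Type*} [Fintype ι] {n : ℕ}
    {v w : ι → EuclideanSpace ℂ (Fin n)} (hv : Orthonormal ℂ v) (hw : Orthonormal ℂ w) :
    ∃ U : EuclideanSpace ℂ (Fin n) ≃ₗᵢ[ℂ] EuclideanSpace ℂ (Fin n), ∀ i, U (v i) = w i := by
  classical
  have key : ∀ {v : ι → EuclideanSpace ℂ (Fin n)}, Orthonormal ℂ v →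
      ∃ f : EuclideanSpace ℂ ι →ₗᵢ[ℂ] EuclideanSpace ℂ (Fin n),
        ∀ i, f (EuclideanSpace.single i 1) = v i := by
    intro v hv
    let b := EuclideanSpace.basisFun ι ℂ
    let f : EuclideanSpace ℂ ι →ₗ[ℂ] EuclideanSpace ℂ (Fin n) := b.toBasis.constr ℂ v
    have hf : ∀ i, f (b.toBasis i) = v i := fun i => b.toBasis.constr_basis ℂ v i
    have hf' : f ∘ b.toBasis = v := by funext i; exact hf i
    refine ⟨f.isometryOfOrthonormal (v := b.toBasis) (by simp)
      (by rw [hf']; exact hv), fun i => ?_⟩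
    have := hf i
    rw [← this]
    change f _ = f _
    simp [b]
  obtain ⟨f, hf⟩ := key hv
  obtain ⟨g, hg⟩ := key hw
  obtain ⟨U, hU⟩ := exists_unitary_comp f g
  exact ⟨U, fun i => by rw [← hf, hU, hg]⟩

theorem exists_unitary_of_norm_eq {n : ℕ} {x y : EuclideanSpace ℂ (Fin n)} (h : ‖x‖ = ‖y‖) :
    ∃ U : EuclideanSpace ℂ (Fin n) ≃ₗᵢ[ℂ] EuclideanSpace ℂ (Fin n), U x = y := by
  by_cases hx : x = 0
  · refine ⟨LinearIsometryEquiv.refl ℂ _, ?_⟩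
    have : y = 0 := by rw [← norm_eq_zero, ← h, hx, norm_zero]
    simp [hx, this]
  have hx0 : (‖x‖ : ℂ) ≠ 0 := by simpa using hx
  have hy : y ≠ 0 := by
    intro h'; apply hx; rw [← norm_eq_zero, h, h', norm_zero]
  have ho : ∀ {z : EuclideanSpace ℂ (Fin n)}, z ≠ 0 →
      Orthonormal ℂ (fun _ : Unit => ((‖z‖ : ℂ)⁻¹) • z) := by
    intro z hz
    have hz' : ‖z‖ ≠ 0 := by simpa using hz
    refine ⟨fun _ => ?_, fun i j hij => (hij rfl).elim⟩
    rw [norm_smul]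
    simp [hz']
  obtain ⟨U, hU⟩ := exists_unitary_of_orthonormal (ho hx) (ho hy)
  refine ⟨U, ?_⟩
  have := hU ()
  rw [map_smul, ← h] at this
  exact smul_right_injective _ (inv_ne_zero hx0) this

/-- A finite measure on `ℂ^n` is determined by its characteristic function. -/
theorem ext_of_integral_exp_re_inner {n : ℕ} {P P' : Measure (EuclideanSpace ℂ (Fin n))}
    [IsFiniteMeasure P] [IsFiniteMeasure P']
    (h : ∀ w, ∫ v, Complex.exp ((inner ℂ v w).re * Complex.I) ∂P =
      ∫ v, Complex.exp ((inner ℂ v w).re * Complex.I) ∂P') : P = P' := by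
  let L : EuclideanSpace ℂ (Fin n) →ₗ[ℝ] EuclideanSpace ℂ (Fin n) →ₗ[ℝ] ℝ :=
    LinearMap.mk₂ ℝ (fun v w => (inner ℂ v w).re)
      (fun a b c => by simp) (fun r a b => by
        rw [← Complex.coe_smul, inner_smul_left]; simp)
      (fun a b c => by simp) (fun r a b => by
        rw [← Complex.coe_smul, inner_smul_right]; simp)
  refine ext_of_integral_char_eq Real.continuous_probChar
    Real.probChar_ne_one (L := L) ?_ ?_ ?_
  · intro v hv h0
    have : L v v = 0 := by rw [h0]; rfl
    have h1 : (inner ℂ v v).re = 0 := this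
    have h2 : (inner ℂ v v).re = ‖v‖ ^ 2 := inner_self_eq_norm_sq (𝕜 := ℂ) v
    rw [h1] at h2
    exact hv (norm_eq_zero.1 (pow_eq_zero_iff two_ne_zero |>.1 h2.symm))
  · change Continuous fun p : EuclideanSpace ℂ (Fin n) × EuclideanSpace ℂ (Fin n) =>
      (inner ℂ p.1 p.2).re
    fun_prop
  · intro w
    exact h w

theorem continuous_exp_re_inner {n : ℕ} :
    Continuous fun p : EuclideanSpace ℂ (Fin n) × EuclideanSpace ℂ (Fin n) =>
      Complex.exp ((inner ℂ p.1 p.2).re * Complex.I) := by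
  fun_prop

/-- By invariance each characteristic function at `w` depends only on `‖w‖`, so `w` may be averaged
over the sphere of radius `‖w‖`. The kernel involves only the real part of the inner product and is
symmetric in the two sphere variables. Fubini thus converts the characteristic function of `P` into
that of `σ`, times the mass of `P`. The measure `P` is merely finite so that restrictions to events
are covered, as `map_dir_eq_prod` requires. -/
theorem isotropic_unique {n : ℕ} {P σ : Measure (EuclideanSpace ℂ (Fin n))}
    [IsFiniteMeasure P] [IsProbabilityMeasure σ]
    (hP : ∀ U : EuclideanSpace ℂ (Fin n) ≃ₗᵢ[ℂ] EuclideanSpace ℂ (Fin n), P.map U = P)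
    (hσ : ∀ U : EuclideanSpace ℂ (Fin n) ≃ₗᵢ[ℂ] EuclideanSpace ℂ (Fin n), σ.map U = σ)
    (hP1 : ∀ᵐ v ∂P, ‖v‖ = 1) (hσ1 : ∀ᵐ v ∂σ, ‖v‖ = 1) :
    P = P Set.univ • σ := by
  have hfin : IsFiniteMeasure (P Set.univ • σ) := by
    constructor
    rw [Measure.smul_apply, measure_univ (μ := σ), smul_eq_mul, mul_one]
    exact measure_lt_top _ _
  refine ext_of_integral_exp_re_inner fun w => ?_
  rw [integral_smul_measure]
  obtain ⟨e, he⟩ : ∃ e : EuclideanSpace ℂ (Fin n) → EuclideanSpace ℂ (Fin n) → ℂ,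
      e = fun v w => Complex.exp ((inner ℂ v w).re * Complex.I) := ⟨_, rfl⟩
  have hce : Continuous fun p : EuclideanSpace ℂ (Fin n) × EuclideanSpace ℂ (Fin n) =>
      e p.1 p.2 := by rw [he]; exact continuous_exp_re_inner
  have hinv : ∀ {Q : Measure (EuclideanSpace ℂ (Fin n))},
      (∀ U : EuclideanSpace ℂ (Fin n) ≃ₗᵢ[ℂ] EuclideanSpace ℂ (Fin n), Q.map U = Q) →
      ∀ {x y}, ‖x‖ = ‖y‖ → ∫ v, e v x ∂Q = ∫ v, e v y ∂Q := by
    intro Q hQ x y hxy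
    obtain ⟨U, rfl⟩ := exists_unitary_of_norm_eq hxy
    have hc : Continuous fun v => e v (U x) :=
      hce.comp (Continuous.prodMk continuous_id continuous_const)
    have hU : AEMeasurable U Q := U.continuous.measurable.aemeasurable
    have hs : AEStronglyMeasurable (fun v => e v (U x)) (Q.map U) := hc.aestronglyMeasurable
    have h1 : ∫ v, e v (U x) ∂(Q.map U) = ∫ v, e (U v) (U x) ∂Q := integral_map hU hs
    rw [hQ U] at h1
    rw [h1]
    refine integral_congr_ae (Eventually.of_forall fun v => ?_)
    simp only [he]
    rw [U.inner_map_map]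
  have hsymm : ∀ v v', e v ((‖w‖ : ℂ) • v') = e v' ((‖w‖ : ℂ) • v) := by
    intro v v'
    simp only [he, inner_smul_right]
    congr 2
    rw [Complex.re_ofReal_mul, Complex.re_ofReal_mul, ← inner_conj_symm v v', Complex.conj_re]
  have hnorm : ∀ v v', ‖e v v'‖ = 1 := fun v v' => by
    rw [he]; exact Complex.norm_exp_ofReal_mul_I _
  have h1 : ∫ v', ∫ v, e v ((‖w‖ : ℂ) • v') ∂P ∂σ = ∫ v, e v w ∂P := by
    have : ∀ᵐ v' ∂σ, ∫ v, e v ((‖w‖ : ℂ) • v') ∂P = ∫ v, e v w ∂P := by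
      filter_upwards [hσ1] with v' hv'
      exact hinv hP (by rw [norm_smul, hv']; simp)
    rw [integral_congr_ae this]
    simp
  have h2 : ∫ v, ∫ v', e v' ((‖w‖ : ℂ) • v) ∂σ ∂P = P.real Set.univ • ∫ v, e v w ∂σ := by
    have : ∀ᵐ v ∂P, ∫ v', e v' ((‖w‖ : ℂ) • v) ∂σ = ∫ v, e v w ∂σ := by
      filter_upwards [hP1] with v' hv'
      exact hinv hσ (by rw [norm_smul, hv']; simp)
    rw [integral_congr_ae this]
    simp
  have h3 : ∀ Q : Measure (EuclideanSpace ℂ (Fin n)),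
      ∫ v, Complex.exp ((inner ℂ v w).re * Complex.I) ∂Q = ∫ v, e v w ∂Q := by rw [he]; intro Q; rfl
  rw [h3, h3, ← h1, integral_integral_swap]
  · simp_rw [hsymm]
    exact h2
  · have hc : Continuous (Function.uncurry fun v' v => e v ((‖w‖ : ℂ) • v')) :=
      hce.comp (f := fun p : EuclideanSpace ℂ (Fin n) × EuclideanSpace ℂ (Fin n) =>
        (p.2, (‖w‖ : ℂ) • p.1)) (by fun_prop)
    refine Integrable.of_bound hc.aestronglyMeasurable 1 (Eventually.of_forall fun p => ?_)
    exact (hnorm _ _).le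

theorem gaussVec_zero {n : ℕ} (hn : n ≠ 0) : gaussVec n {0} = 0 := by
  have : Nonempty (Fin n) := ⟨⟨0, Nat.pos_of_ne_zero hn⟩⟩
  have := gaussVec_submodule (n := n) ⊥ bot_ne_top
  simpa using this

/-- The direction `y / ‖y‖` of a vector. -/
def dir {n : ℕ} (y : EuclideanSpace ℂ (Fin n)) : EuclideanSpace ℂ (Fin n) := (‖y‖⁻¹ : ℂ) • y

theorem measurable_dir {n : ℕ} : Measurable (dir (n := n)) := by
  unfold dir
  have : Measurable fun y : EuclideanSpace ℂ (Fin n) => ((‖y‖⁻¹ : ℝ) : ℂ) :=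
    Complex.measurable_ofReal.comp measurable_norm.inv
  simp only [← Complex.ofReal_inv]
  exact this.smul measurable_id

theorem norm_dir {n : ℕ} {y : EuclideanSpace ℂ (Fin n)} (hy : y ≠ 0) : ‖dir y‖ = 1 := by
  have : ‖y‖ ≠ 0 := norm_ne_zero_iff.2 hy
  simp [dir, norm_smul, this]

theorem dir_map {m n : ℕ} (U : EuclideanSpace ℂ (Fin m) →ₗᵢ[ℂ] EuclideanSpace ℂ (Fin n))
    (y : EuclideanSpace ℂ (Fin m)) : dir (U y) = U (dir y) := by
  simp [dir]

theorem norm_smul_dir {n : ℕ} (y : EuclideanSpace ℂ (Fin n)) : (‖y‖ : ℂ) • dir y = y := by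
  by_cases hy : y = 0
  · simp [hy, dir]
  have : (‖y‖ : ℂ) ≠ 0 := by simpa using hy
  rw [dir, smul_smul, mul_inv_cancel₀ this, one_smul]

theorem sphereLaw_eq (n : ℕ) : sphereLaw n = (gaussVec n).map dir := rfl

instance (n : ℕ) : IsProbabilityMeasure (sphereLaw n) :=
  Measure.isProbabilityMeasure_map measurable_dir.aemeasurable

theorem sphereLaw_map {n : ℕ} (U : EuclideanSpace ℂ (Fin n) ≃ₗᵢ[ℂ] EuclideanSpace ℂ (Fin n)) :
    (sphereLaw n).map U = sphereLaw n := by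
  rw [sphereLaw_eq, Measure.map_map U.continuous.measurable measurable_dir]
  have : U ∘ dir = dir ∘ U := by funext y; exact (dir_map U.toLinearIsometry y).symm
  rw [this, ← Measure.map_map measurable_dir U.continuous.measurable, gaussVec_map]

theorem measurableSet_norm_eq_one {n : ℕ} :
    MeasurableSet {v : EuclideanSpace ℂ (Fin n) | ‖v‖ = 1} :=
  measurable_norm (measurableSet_singleton 1)

theorem sphereLaw_norm {n : ℕ} (hn : n ≠ 0) : ∀ᵐ v ∂sphereLaw n, ‖v‖ = 1 := by
  rw [sphereLaw_eq, ae_map_iff measurable_dir.aemeasurable measurableSet_norm_eq_one]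
  have h : ∀ᵐ v ∂gaussVec n, v ≠ 0 := by
    rw [ae_iff]
    simpa using gaussVec_zero hn
  filter_upwards [h] with v hv using norm_dir hv

/-- Replaces the abstract codeword law by the law of a normalized Gaussian vector, which can be
computed with. -/
theorem IsIsotropic.eq_sphereLaw {n : ℕ} (hn : n ≠ 0) {ν : Measure (EuclideanSpace ℂ (Fin n))}
    (h : IsIsotropic ν) : ν = sphereLaw n := by
  have := h.isProbabilityMeasure
  have h1 := isotropic_unique h.map_unitary sphereLaw_map h.ae_norm_eq_one (sphereLaw_norm hn)
  rw [h1, measure_univ, one_smul]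

/-- If the law of `(t, y)` is invariant under unitary maps of `y`, then the direction of `y` is
uniform and independent of `t`. -/
theorem map_dir_eq_prod {T : Type*} [MeasurableSpace T] {n : ℕ} (hn : n ≠ 0)
    (κ : Measure (T × EuclideanSpace ℂ (Fin n))) [IsFiniteMeasure κ]
    (hκ : ∀ U : EuclideanSpace ℂ (Fin n) ≃ₗᵢ[ℂ] EuclideanSpace ℂ (Fin n),
      κ.map (Prod.map id U) = κ)
    (h0 : ∀ᵐ p ∂κ, p.2 ≠ 0) :
    κ.map (Prod.map id dir) = (κ.map Prod.fst).prod (sphereLaw n) := by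
  have : IsFiniteMeasure (κ.map Prod.fst) := inferInstance
  symm
  refine Measure.prod_eq fun s t hs ht => ?_
  have hd : Measurable (fun p : T × EuclideanSpace ℂ (Fin n) => dir p.2) :=
    measurable_dir.comp measurable_snd
  have hs' : MeasurableSet (Prod.fst ⁻¹' s : Set (T × EuclideanSpace ℂ (Fin n))) :=
    measurable_fst hs
  -- Restriction to an event in the first variable keeps the invariance in the second. On each such
  -- event the direction therefore has a multiple of the uniform law, which is the product formula
  -- on rectangles.
  set P := (κ.restrict (Prod.fst ⁻¹' s)).map (fun p => dir p.2) with hPdef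
  have hPinv : ∀ U : EuclideanSpace ℂ (Fin n) ≃ₗᵢ[ℂ] EuclideanSpace ℂ (Fin n), P.map U = P := by
    intro U
    have hU : Measurable (Prod.map id U : T × EuclideanSpace ℂ (Fin n) → _) :=
      measurable_id.prodMap U.continuous.measurable
    have h1 : (κ.restrict (Prod.fst ⁻¹' s)).map (Prod.map id U) =
        κ.restrict (Prod.fst ⁻¹' s) := by
      conv_rhs => rw [← hκ U]
      rw [Measure.restrict_map hU hs']
      rfl
    rw [hPdef, Measure.map_map U.continuous.measurable hd]
    conv_rhs => rw [← h1]
    rw [Measure.map_map hd hU]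
    congr 1
    funext p
    exact (dir_map U.toLinearIsometry p.2).symm
  have hP1 : ∀ᵐ v ∂P, ‖v‖ = 1 := by
    rw [hPdef, ae_map_iff hd.aemeasurable measurableSet_norm_eq_one]
    filter_upwards [ae_restrict_of_ae h0] with p hp using norm_dir hp
  have h2 := isotropic_unique hPinv sphereLaw_map hP1 (sphereLaw_norm hn)
  have h3 : P t = P Set.univ * sphereLaw n t := by
    conv_lhs => rw [h2]
    rw [Measure.smul_apply, smul_eq_mul]
  rw [Measure.map_apply (measurable_id.prodMap measurable_dir) (hs.prod ht),
    Measure.map_apply measurable_fst hs]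
  rw [hPdef, Measure.map_apply hd ht, Measure.map_apply hd MeasurableSet.univ,
    Measure.restrict_apply (hd ht), Measure.restrict_apply (hd MeasurableSet.univ)] at h3
  simp only [Set.preimage_univ, Set.univ_inter] at h3
  rw [← h3]
  congr 1
  ext p
  simp [and_comm]

/-- The direction of a unitarily invariant random vector is uniform. -/
theorem map_dir_eq_sphereLaw {n : ℕ} (hn : n ≠ 0) (τ : Measure (EuclideanSpace ℂ (Fin n)))
    [IsProbabilityMeasure τ]
    (hτ : ∀ U : EuclideanSpace ℂ (Fin n) ≃ₗᵢ[ℂ] EuclideanSpace ℂ (Fin n), τ.map U = τ)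
    (h0 : ∀ᵐ y ∂τ, y ≠ 0) : τ.map dir = sphereLaw n := by
  have hm : IsProbabilityMeasure (τ.map dir) :=
    Measure.isProbabilityMeasure_map measurable_dir.aemeasurable
  refine IsIsotropic.eq_sphereLaw hn ⟨hm, ?_, ?_⟩
  · rw [ae_map_iff measurable_dir.aemeasurable measurableSet_norm_eq_one]
    filter_upwards [h0] with p hp using norm_dir hp
  · intro U
    rw [Measure.map_map U.continuous.measurable measurable_dir]
    have : U ∘ dir = dir ∘ U := by funext y; exact (dir_map U.toLinearIsometry y).symm
    rw [this, ← Measure.map_map measurable_dir U.continuous.measurable, hτ]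

theorem dir_mem_iff {n : ℕ} (W : Submodule ℂ (EuclideanSpace ℂ (Fin n)))
    (y : EuclideanSpace ℂ (Fin n)) : dir y ∈ W ↔ y ∈ W := by
  constructor
  · intro h
    rw [← norm_smul_dir y]
    exact W.smul_mem _ h
  · exact fun h => W.smul_mem _ h

theorem sphereLaw_submodule {n : ℕ} (W : Submodule ℂ (EuclideanSpace ℂ (Fin n))) (hW : W ≠ ⊤) :
    sphereLaw n W = 0 := by
  have hWm : MeasurableSet (W : Set (EuclideanSpace ℂ (Fin n))) :=
    (Submodule.closed_of_finiteDimensional W).measurableSet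
  rw [sphereLaw_eq, Measure.map_apply measurable_dir hWm]
  have : dir ⁻¹' (W : Set (EuclideanSpace ℂ (Fin n))) = W := by
    ext y; exact dir_mem_iff W y
  rw [this, gaussVec_submodule W hW]

/-- Proper subspaces are null for unitarily invariant laws without atom at the origin. -/
theorem submodule_null_of_invariant {n : ℕ} (hn : n ≠ 0)
    (τ : Measure (EuclideanSpace ℂ (Fin n))) [IsProbabilityMeasure τ]
    (hτ : ∀ U : EuclideanSpace ℂ (Fin n) ≃ₗᵢ[ℂ] EuclideanSpace ℂ (Fin n), τ.map U = τ)
    (h0 : ∀ᵐ y ∂τ, y ≠ 0) (W : Submodule ℂ (EuclideanSpace ℂ (Fin n))) (hW : W ≠ ⊤) :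
    τ W = 0 := by
  have hWm : MeasurableSet (W : Set (EuclideanSpace ℂ (Fin n))) :=
    (Submodule.closed_of_finiteDimensional W).measurableSet
  have h := sphereLaw_submodule W hW
  rw [← map_dir_eq_sphereLaw hn τ hτ h0, Measure.map_apply measurable_dir hWm] at h
  have : dir ⁻¹' (W : Set (EuclideanSpace ℂ (Fin n))) = W := by
    ext y; exact dir_mem_iff W y
  rwa [this] at h

end ZFC
end

/-! ### Resampling, general position, and distances to spans. -/

noncomputable section
open scoped ENNReal
namespace ZFC

/-- Resampling one coordinate preserves a product of probability measures. -/
theorem measurePreserving_update {ι : Type*} [Fintype ι] [DecidableEq ι] {α : ι → Type*}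
    [∀ i, MeasurableSpace (α i)] (μ : ∀ i, Measure (α i)) [∀ i, IsProbabilityMeasure (μ i)]
    (k : ι) :
    MeasurePreserving (fun p : (∀ i, α i) × α k => Function.update p.1 k p.2)
      ((Measure.pi μ).prod (μ k)) (Measure.pi μ) := by
  have hm : Measurable (fun p : (∀ i, α i) × α k => Function.update p.1 k p.2) := by
    refine measurable_pi_iff.2 fun i => ?_
    by_cases h : i = k
    · subst h
      simpa using measurable_snd
    · simp only [Function.update_of_ne h]
      exact (measurable_pi_apply i).comp measurable_fst
  refine ⟨hm, ?_⟩
  symm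
  refine Measure.pi_eq fun s hs => ?_
  rw [Measure.map_apply hm (MeasurableSet.univ_pi hs)]
  have : (fun p : (∀ i, α i) × α k => Function.update p.1 k p.2) ⁻¹' (Set.pi Set.univ s) =
      (Set.pi Set.univ (Function.update s k Set.univ)) ×ˢ (s k) := by
    ext p
    simp only [Set.mem_preimage, Set.mem_pi, Set.mem_univ, true_imp_iff, Set.mem_prod]
    constructor
    · intro h
      refine ⟨fun i => ?_, by simpa using h k⟩
      by_cases hi : i = k
      · subst hi; simp
      · simpa [Function.update_of_ne hi] using h i
    · rintro ⟨h1, h2⟩ i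
      by_cases hi : i = k
      · subst hi; simpa using h2
      · simpa [Function.update_of_ne hi] using h1 i
  rw [this, Measure.prod_prod, Measure.pi_pi]
  rw [← Finset.mul_prod_erase Finset.univ _ (Finset.mem_univ k),
    ← Finset.mul_prod_erase Finset.univ (fun i => μ i (s i)) (Finset.mem_univ k)]
  rw [mul_comm]
  have h : ∏ x ∈ Finset.univ.erase k, μ x (Function.update s k Set.univ x) =
      ∏ x ∈ Finset.univ.erase k, μ x (s x) :=
    Finset.prod_congr rfl fun i hi => by rw [Function.update_of_ne (Finset.ne_of_mem_erase hi)]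
  rw [h]
  simp

/-- Resampling coordinate `k` does not change the law, so a property need only be checked for almost
every new value of that coordinate with the others frozen. -/
theorem ae_pi_of_ae_update {ι : Type*} [Fintype ι] [DecidableEq ι] {α : ι → Type*}
    [∀ i, MeasurableSpace (α i)] (μ : ∀ i, Measure (α i)) [∀ i, IsProbabilityMeasure (μ i)]
    (k : ι) {p : (∀ i, α i) → Prop} (hp : MeasurableSet {x | p x})
    (h : ∀ᵐ x ∂Measure.pi μ, ∀ᵐ y ∂μ k, p (Function.update x k y)) :
    ∀ᵐ x ∂Measure.pi μ, p x := by
  have hmp := measurePreserving_update μ k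
  rw [← hmp.map_eq, ae_map_iff hmp.measurable.aemeasurable hp,
    Measure.ae_prod_iff_ae_ae (p := fun q => p (Function.update q.1 k q.2)) (hmp.measurable hp)]
  exact h

theorem measurableSet_linearIndepOn {ι : Type*} [Finite ι] {n : ℕ} (s : Set ι) :
    MeasurableSet {z : ι → EuclideanSpace ℂ (Fin n) | LinearIndepOn ℂ z s} := by
  have h : IsOpen {f : s → EuclideanSpace ℂ (Fin n) | LinearIndependent ℂ f} :=
    isOpen_setOfPred_linearIndependent
  exact h.measurableSet.preimage (f := fun (z : ι → EuclideanSpace ℂ (Fin n)) (i : s) => z i)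
    (by fun_prop)

/-- Independent random vectors whose laws do not charge proper subspaces are almost surely
linearly independent, as long as there are at most as many as the dimension. -/
theorem ae_linearIndepOn {ι : Type*} [Fintype ι] [DecidableEq ι] {n : ℕ}
    (μ : ι → Measure (EuclideanSpace ℂ (Fin n))) [∀ i, IsProbabilityMeasure (μ i)]
    (hμ : ∀ i, ∀ W : Submodule ℂ (EuclideanSpace ℂ (Fin n)), W ≠ ⊤ → μ i W = 0)
    (s : Finset ι) (hs : s.card ≤ n) :
    ∀ᵐ z ∂Measure.pi μ, LinearIndepOn ℂ z (s : Set ι) := by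
  induction s using Finset.induction_on with
  | empty => simp
  | insert a s ha ih =>
    -- Resample vector `a`: the remaining ones are fewer than `n`, so they span a proper subspace,
    -- which the law of the new vector does not charge.
    rw [Finset.card_insert_of_notMem ha] at hs
    refine ae_pi_of_ae_update μ a (measurableSet_linearIndepOn _) ?_
    filter_upwards [ih (by omega)] with x hx
    have hW : Submodule.span ℂ (x '' (s : Set ι)) ≠ ⊤ := by
      intro h
      have h1 := congrArg (fun W : Submodule ℂ (EuclideanSpace ℂ (Fin n)) => Module.finrank ℂ W) h
      simp only [finrank_top, finrank_euclideanSpace, Fintype.card_fin] at h1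
      have h2 := finrank_span_finset_le_card (R := ℂ) (s.image x)
      rw [Finset.coe_image] at h2
      have h3 := Finset.card_image_le (s := s) (f := x)
      have h4 : (x '' (s : Set ι)).finrank ℂ = n := h1
      omega
    have h0 : ∀ᵐ y ∂μ a, y ∉ Submodule.span ℂ (x '' (s : Set ι)) := by
      rw [ae_iff]
      simpa using hμ a _ hW
    filter_upwards [h0] with y hy
    rw [Finset.coe_insert, linearIndepOn_insert (by simpa using ha)]
    have heq : Set.EqOn (Function.update x a y) x (s : Set ι) := by
      intro i hi
      have : i ≠ a := by rintro rfl; exact ha hi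
      rw [Function.update_of_ne this]
    refine ⟨hx.congr heq.symm, ?_⟩
    rw [heq.image_eq]
    simpa using hy

/-- Distance from `x` to the span of the vectors `z j`, `j ∈ t`. -/
def spanDist {ι : Type*} {n : ℕ} (t : Finset ι) (z : ι → EuclideanSpace ℂ (Fin n))
    (x : EuclideanSpace ℂ (Fin n)) : ℝ :=
  ⨅ q : ι → ℂ, ‖x - ∑ j ∈ t, q j • z j‖

/-- An infimum of continuous functions is upper semicontinuous, hence measurable even over an
uncountable family. Rates written through this distance are measurable functions of the channels
without reference to the chosen beamformers. -/
theorem measurable_spanDist {ι : Type*} [Fintype ι] {n : ℕ} (t : Finset ι) :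
    Measurable fun p : (ι → EuclideanSpace ℂ (Fin n)) × EuclideanSpace ℂ (Fin n) =>
      spanDist t p.1 p.2 := by
  unfold spanDist
  refine UpperSemicontinuous.measurable ?_
  refine upperSemicontinuous_ciInf (fun p => ⟨0, ?_⟩) fun q => ?_
  · rintro _ ⟨q, rfl⟩
    exact norm_nonneg _
  · exact Continuous.upperSemicontinuous (by fun_prop)

theorem spanDist_nonneg {ι : Type*} {n : ℕ} (t : Finset ι) (z : ι → EuclideanSpace ℂ (Fin n))
    (x : EuclideanSpace ℂ (Fin n)) : 0 ≤ spanDist t z x :=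
  Real.iInf_nonneg fun _ => norm_nonneg _

theorem spanDist_le {ι : Type*} {n : ℕ} (t : Finset ι) (z : ι → EuclideanSpace ℂ (Fin n))
    (x : EuclideanSpace ℂ (Fin n)) : spanDist t z x ≤ ‖x‖ := by
  have := ciInf_le (f := fun q : ι → ℂ => ‖x - ∑ j ∈ t, q j • z j‖)
    ⟨0, by rintro _ ⟨q, rfl⟩; exact norm_nonneg _⟩ 0
  simpa [spanDist] using this

/-- Dimension count: `n - 1` independent vectors orthogonal to `w` span the whole hyperplane
orthogonal to `w`. -/
theorem mem_span_of_inner_eq_zero {ι : Type*} {n : ℕ} {t : Finset ι}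
    {z : ι → EuclideanSpace ℂ (Fin n)} (ht : t.card + 1 = n)
    (hz : LinearIndepOn ℂ z (t : Set ι)) {w : EuclideanSpace ℂ (Fin n)} (hw : w ≠ 0)
    (horth : ∀ j ∈ t, inner ℂ (z j) w = 0) {y : EuclideanSpace ℂ (Fin n)}
    (hy : inner ℂ w y = 0) : y ∈ Submodule.span ℂ (z '' (t : Set ι)) := by
  have h1 : Submodule.span ℂ (z '' (t : Set ι)) ≤ (Submodule.span ℂ {w})ᗮ := by
    rw [Submodule.span_le]
    rintro _ ⟨j, hj, rfl⟩
    rw [SetLike.mem_coe, Submodule.mem_orthogonal_singleton_iff_inner_left]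
    exact horth j hj
  have h2 : Module.finrank ℂ (Submodule.span ℂ (z '' (t : Set ι))) = t.card := by
    have := finrank_span_eq_card (R := ℂ) (b := fun i : (t : Set ι) => z i) hz
    rw [← Set.image_eq_range] at this
    simpa using this
  have h3 := Submodule.finrank_add_finrank_orthogonal (Submodule.span ℂ {w})
  rw [finrank_span_singleton hw, finrank_euclideanSpace, Fintype.card_fin] at h3
  have h4 : Submodule.span ℂ (z '' (t : Set ι)) = (Submodule.span ℂ {w})ᗮ :=
    Submodule.eq_of_le_of_finrank_eq h1 (by omega)
  rw [h4, Submodule.mem_orthogonal_singleton_iff_inner_right]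
  exact hy

/-- For `n - 1` linearly independent vectors, the distance to their span is the modulus of the
inner product with a unit normal. -/
theorem spanDist_eq {ι : Type*} {n : ℕ} {t : Finset ι}
    {z : ι → EuclideanSpace ℂ (Fin n)} (ht : t.card + 1 = n)
    (hz : LinearIndepOn ℂ z (t : Set ι)) {w : EuclideanSpace ℂ (Fin n)} (hw : ‖w‖ = 1)
    (horth : ∀ j ∈ t, inner ℂ (z j) w = 0) (x : EuclideanSpace ℂ (Fin n)) :
    spanDist t z x = ‖inner ℂ x w‖ := by
  have hw0 : w ≠ 0 := by rintro rfl; simp at hw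
  have hww : inner ℂ w w = 1 := by rw [inner_self_eq_norm_sq_to_K, hw]; simp
  refine le_antisymm ?_ ?_
  · have hy : inner ℂ w (x - (inner ℂ w x) • w) = 0 := by
      rw [inner_sub_right, inner_smul_right, hww]; simp
    have hmem := mem_span_of_inner_eq_zero ht hz hw0 horth hy
    obtain ⟨q, hq⟩ := (Submodule.mem_span_image_finset_iff_exists_fun' ℂ).1 hmem
    have := ciInf_le (f := fun q : ι → ℂ => ‖x - ∑ j ∈ t, q j • z j‖)
      ⟨0, by rintro _ ⟨q, rfl⟩; exact norm_nonneg _⟩ q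
    refine this.trans ?_
    simp only [hq]
    rw [sub_sub_cancel, norm_smul, hw, mul_one, ← norm_inner_symm]
  · refine le_ciInf fun q => ?_
    have : inner ℂ x w = inner ℂ (x - ∑ j ∈ t, q j • z j) w := by
      rw [inner_sub_left, sum_inner, Finset.sum_eq_zero, sub_zero]
      intro j hj
      rw [inner_smul_left, horth j hj, mul_zero]
    rw [this]
    refine (norm_inner_le_norm _ _).trans ?_
    rw [hw, mul_one]

theorem exists_unit_orthogonal {ι : Type*} {n : ℕ} {t : Finset ι}
    (z : ι → EuclideanSpace ℂ (Fin n)) (ht : t.card < n) :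
    ∃ w : EuclideanSpace ℂ (Fin n), ‖w‖ = 1 ∧ ∀ j ∈ t, inner ℂ (z j) w = 0 := by
  classical
  have h2 := finrank_span_finset_le_card (R := ℂ) (t.image z)
  have h2' : Module.finrank ℂ (Submodule.span ℂ (t.image z : Set (EuclideanSpace ℂ (Fin n)))) ≤
    (t.image z).card := h2
  have h3 := Finset.card_image_le (s := t) (f := z)
  have h4 := Submodule.finrank_add_finrank_orthogonal
    (Submodule.span ℂ (t.image z : Set (EuclideanSpace ℂ (Fin n))))
  rw [finrank_euclideanSpace, Fintype.card_fin] at h4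
  have h5 : (Submodule.span ℂ (t.image z : Set (EuclideanSpace ℂ (Fin n))))ᗮ ≠ ⊥ := by
    intro h
    rw [h, finrank_bot] at h4
    omega
  obtain ⟨w, hw, hw0⟩ := Submodule.exists_mem_ne_zero_of_ne_bot h5
  refine ⟨dir w, norm_dir hw0, fun j hj => ?_⟩
  rw [dir, inner_smul_right, (Submodule.mem_orthogonal _ _).1 hw (z j), mul_zero]
  exact Submodule.subset_span (by simpa using ⟨j, hj, rfl⟩)

end ZFC
end

/-! ### Moments and small-ball probabilities of complex Gaussian vectors. -/

noncomputable section
open scoped ENNReal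
namespace ZFC

/-- Squared Euclidean norm of a complex vector. -/
def nsq {ι : Type*} [Fintype ι] (x : ι → ℂ) : ℝ := ∑ i, ‖x i‖ ^ 2

theorem nsq_nonneg {ι : Type*} [Fintype ι] (x : ι → ℂ) : 0 ≤ nsq x :=
  Finset.sum_nonneg fun _ _ => by positivity

theorem continuous_nsq {ι : Type*} [Fintype ι] : Continuous (nsq (ι := ι)) := by
  unfold nsq; fun_prop

theorem measurable_nsq {ι : Type*} [Fintype ι] : Measurable (nsq (ι := ι)) :=
  continuous_nsq.measurable

theorem norm_sq_toLp {k : ℕ} (x : Fin k → ℂ) : ‖WithLp.toLp 2 x‖ ^ 2 = nsq x := by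
  rw [EuclideanSpace.norm_sq_eq]; rfl

/-- The law of `k` independent `CN(0,1)` variables. -/
abbrev cgPi (k : ℕ) : Measure (Fin k → ℂ) := Measure.pi fun _ : Fin k => stdComplexGaussian

theorem cgPi_eq (k : ℕ) : cgPi k = (volume : Measure (Fin k → ℂ)).withDensity
    (fun x => ENNReal.ofReal ((Real.pi⁻¹) ^ k * Real.exp (-nsq x))) := by
  rw [cgPi, pi_stdComplexGaussian_eq]
  congr 1
  funext x
  rw [prod_cgDensity, Fintype.card_fin]; rfl

theorem integral_cgPi {k : ℕ} (f : (Fin k → ℂ) → ℝ) :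
    ∫ x, f x ∂cgPi k = ∫ x, ((Real.pi⁻¹) ^ k * Real.exp (-nsq x)) * f x := by
  rw [cgPi_eq, integral_withDensity_eq_integral_toReal_smul]
  · refine integral_congr_ae (Eventually.of_forall fun x => ?_)
    simp only [smul_eq_mul]
    rw [ENNReal.toReal_ofReal (by positivity)]
  · exact ((continuous_const.mul (Real.continuous_exp.comp continuous_nsq.neg)).measurable).ennreal_ofReal
  · exact Eventually.of_forall fun x => ENNReal.ofReal_lt_top

/-- Lebesgue measure on the Euclidean space `ℂ^k`. -/
def volE (k : ℕ) : Measure (EuclideanSpace ℂ (Fin k)) :=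
  (volume : Measure (Fin k → ℂ)).map (WithLp.linearEquiv 2 ℝ (Fin k → ℂ)).symm

instance (k : ℕ) : (volE k).IsAddHaarMeasure := by unfold volE; infer_instance

theorem integral_volE {k : ℕ} (f : EuclideanSpace ℂ (Fin k) → ℝ) :
    ∫ x, f x ∂volE k = ∫ x : Fin k → ℂ, f (WithLp.toLp 2 x) :=
  integral_map_equiv (MeasurableEquiv.toLp 2 (Fin k → ℂ)) f

theorem volume_nsq_le {k : ℕ} (hk : k ≠ 0) {x : ℝ} (hx : 0 ≤ x) :
    (volume : Measure (Fin k → ℂ)) {b | nsq b ≤ x} =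
      ENNReal.ofReal (Real.pi ^ k * (x ^ k / (k.factorial : ℝ))) := by
  have : Nonempty (Fin k) := ⟨⟨0, Nat.pos_of_ne_zero hk⟩⟩
  have h := Complex.volume_sum_rpow_le (Fin k) (p := 2) (by norm_num) (√x)
  have hset : {b : Fin k → ℂ | (∑ i, ‖b i‖ ^ (2 : ℝ)) ^ (1 / (2 : ℝ)) ≤ √x} = {b | nsq b ≤ x} := by
    ext b
    simp only [Set.mem_ofPred_eq, Real.rpow_two]
    rw [← Real.sqrt_eq_rpow, Real.sqrt_le_sqrt_iff hx]
    rfl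
  rw [hset] at h
  rw [h, ← ENNReal.ofReal_pow (Real.sqrt_nonneg _), ← ENNReal.ofReal_mul (by positivity),
    pow_mul, Real.sq_sqrt hx, Fintype.card_fin]
  congr 1
  have h1 : Real.Gamma (2 / 2 + 1) = 1 := by
    have : (2 / 2 + 1 : ℝ) = 2 := by norm_num
    rw [this, Real.Gamma_two]
  have h2 : Real.Gamma (2 * (k : ℝ) / 2 + 1) = k.factorial := by
    have : 2 * (k : ℝ) / 2 + 1 = k + 1 := by ring
    rw [this, Real.Gamma_nat_eq_factorial]
  rw [h1, h2, mul_one]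
  ring

theorem volE_ball {k : ℕ} (hk : k ≠ 0) :
    (volE k).real (Metric.ball 0 1) = Real.pi ^ k / (k.factorial : ℝ) := by
  have : Nonempty (Fin k) := ⟨⟨0, Nat.pos_of_ne_zero hk⟩⟩
  rw [Measure.real, ← Measure.addHaar_closedBall_eq_addHaar_ball]
  unfold volE
  have hm : Measurable (WithLp.linearEquiv 2 ℝ (Fin k → ℂ)).symm :=
    (MeasurableEquiv.toLp 2 (Fin k → ℂ)).measurable
  rw [Measure.map_apply hm Metric.isClosed_closedBall.measurableSet]
  have : (WithLp.linearEquiv 2 ℝ (Fin k → ℂ)).symm ⁻¹' Metric.closedBall 0 1 =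
      {b | nsq b ≤ 1} := by
    ext b
    simp only [Set.mem_preimage, mem_closedBall_zero_iff, Set.mem_ofPred_eq]
    change ‖WithLp.toLp 2 b‖ ≤ 1 ↔ _
    rw [← norm_sq_toLp, sq_le_one_iff₀ (norm_nonneg _)]
  rw [this, volume_nsq_le hk zero_le_one, ENNReal.toReal_ofReal (by positivity)]
  simp [div_eq_mul_inv]

theorem finrank_real_euclidean (k : ℕ) : Module.finrank ℝ (EuclideanSpace ℂ (Fin k)) = 2 * k := by
  rw [finrank_real_of_complex, finrank_euclideanSpace, Fintype.card_fin]

/-- Moments of `‖g‖²` for a standard complex Gaussian vector. -/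
theorem integral_nsq_rpow {k : ℕ} (hk : k ≠ 0) {s : ℝ} (hs : -(k : ℝ) < s) :
    ∫ x, nsq x ^ s ∂cgPi k = Real.Gamma (k + s) / Real.Gamma k := by
  have : Nonempty (Fin k) := ⟨⟨0, Nat.pos_of_ne_zero hk⟩⟩
  have hk' : (0 : ℝ) < k := by exact_mod_cast Nat.pos_of_ne_zero hk
  have h := integral_fun_norm_addHaar (volE k)
    (fun r => ((Real.pi⁻¹) ^ k * Real.exp (-r ^ 2)) * (r ^ 2) ^ s)
  rw [integral_volE, finrank_real_euclidean, volE_ball hk] at h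
  simp only [norm_sq_toLp] at h
  rw [integral_cgPi, h]
  have h1 : ∀ y ∈ Set.Ioi (0 : ℝ), y ^ (2 * k - 1) •
      (Real.pi⁻¹ ^ k * Real.exp (-y ^ 2) * (y ^ 2) ^ s) =
      Real.pi⁻¹ ^ k * (y ^ (2 * (k : ℝ) - 1 + 2 * s) * Real.exp (-y ^ (2 : ℝ))) := by
    intro y hy
    have hy : 0 < y := hy
    rw [Real.rpow_add hy, Real.rpow_two, smul_eq_mul, Real.rpow_mul hy.le, Real.rpow_two]
    have : y ^ (2 * k - 1) = y ^ (2 * (k : ℝ) - 1) := by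
      rw [← Real.rpow_natCast]
      congr 1
      rw [Nat.cast_sub (by omega)]
      push_cast; ring
    rw [this]; ring
  rw [setIntegral_congr_fun measurableSet_Ioi h1, integral_const_mul,
    integral_rpow_mul_exp_neg_rpow (by norm_num) (by linarith)]
  have h2 : (2 * (k : ℝ) - 1 + 2 * s + 1) / 2 = k + s := by ring
  rw [h2]
  have h3 : Real.Gamma k ≠ 0 := (Real.Gamma_pos_of_pos hk').ne'
  have h4 : (k.factorial : ℝ) = k * Real.Gamma k := by
    rw [← Real.Gamma_nat_eq_factorial, Real.Gamma_add_one hk'.ne']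
  rw [h4]
  have hpi : Real.pi ≠ 0 := Real.pi_ne_zero
  simp only [nsmul_eq_mul, smul_eq_mul]
  push_cast
  rw [inv_pow]
  field_simp

/-- The integral of a non-integrable function is 0 by convention, whereas the value in
`integral_nsq_rpow` is positive. -/
theorem integrable_nsq_rpow {k : ℕ} (hk : k ≠ 0) {s : ℝ} (hs : -(k : ℝ) < s) :
    Integrable (fun x => nsq x ^ s) (cgPi k) := by
  by_contra h
  have h1 := integral_nsq_rpow hk hs
  rw [integral_undef h] at h1
  have hk' : (0 : ℝ) < k := by exact_mod_cast Nat.pos_of_ne_zero hk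
  have := div_pos (Real.Gamma_pos_of_pos (by linarith : 0 < (k : ℝ) + s)) (Real.Gamma_pos_of_pos hk')
  linarith

theorem measurableSet_nsq_le {k : ℕ} (x : ℝ) : MeasurableSet {b : Fin k → ℂ | nsq b ≤ x} :=
  measurable_nsq measurableSet_Iic

/-- On the ball the Gaussian density is at most `π⁻ᵏ` and at least `π⁻ᵏ e⁻ˣ`. With the volume of the
ball, these give this bound and `le_cgPi_nsq_le`, which are sharp to leading order at the origin. -/
theorem cgPi_nsq_le_le {k : ℕ} (hk : k ≠ 0) {x : ℝ} (hx : 0 ≤ x) :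
    (cgPi k).real {b | nsq b ≤ x} ≤ x ^ k / (k.factorial : ℝ) := by
  rw [Measure.real, cgPi_eq, withDensity_apply _ (measurableSet_nsq_le x)]
  refine ENNReal.toReal_le_of_le_ofReal (by positivity) ?_
  calc ∫⁻ b in {b : Fin k → ℂ | nsq b ≤ x}, ENNReal.ofReal (Real.pi⁻¹ ^ k * Real.exp (-nsq b))
      ≤ ∫⁻ b in {b : Fin k → ℂ | nsq b ≤ x}, ENNReal.ofReal (Real.pi⁻¹ ^ k) := by
        refine lintegral_mono fun b => ENNReal.ofReal_le_ofReal ?_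
        refine mul_le_of_le_one_right (by positivity) ?_
        rw [Real.exp_le_one_iff, neg_nonpos]
        exact nsq_nonneg b
    _ = _ := by
        rw [setLIntegral_const, volume_nsq_le hk hx, ← ENNReal.ofReal_mul (by positivity)]
        congr 1
        rw [← mul_assoc, ← mul_pow, inv_mul_cancel₀ Real.pi_ne_zero, one_pow, one_mul]

theorem le_cgPi_nsq_le {k : ℕ} (hk : k ≠ 0) {x : ℝ} (hx : 0 ≤ x) :
    Real.exp (-x) * (x ^ k / (k.factorial : ℝ)) ≤ (cgPi k).real {b | nsq b ≤ x} := by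
  rw [Measure.real]
  rw [← ENNReal.ofReal_le_iff_le_toReal (measure_ne_top _ _)]
  rw [cgPi_eq, withDensity_apply _ (measurableSet_nsq_le x)]
  calc ENNReal.ofReal (Real.exp (-x) * (x ^ k / (k.factorial : ℝ)))
      = ∫⁻ b in {b : Fin k → ℂ | nsq b ≤ x},
          ENNReal.ofReal (Real.pi⁻¹ ^ k * Real.exp (-x)) := by
        rw [setLIntegral_const, volume_nsq_le hk hx, ← ENNReal.ofReal_mul (by positivity)]
        congr 1
        have : Real.pi⁻¹ ^ k * Real.pi ^ k = 1 := by
          rw [← mul_pow, inv_mul_cancel₀ Real.pi_ne_zero, one_pow]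
        linear_combination (-Real.exp (-x) * (x ^ k / (k.factorial : ℝ))) * this
    _ ≤ _ := by
        refine setLIntegral_mono' (measurableSet_nsq_le x) fun b hb => ENNReal.ofReal_le_ofReal ?_
        have : nsq b ≤ x := hb
        gcongr

theorem cgPi_nsq_eq {k : ℕ} (hk : k ≠ 0) (x : ℝ) : cgPi k {b | nsq b = x} = 0 := by
  have : Nonempty (Fin k) := ⟨⟨0, Nat.pos_of_ne_zero hk⟩⟩
  rw [cgPi_eq]
  refine withDensity_absolutelyContinuous _ _ ?_
  have hm : Measurable (WithLp.linearEquiv 2 ℝ (Fin k → ℂ)).symm :=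
    (MeasurableEquiv.toLp 2 (Fin k → ℂ)).measurable
  have h := Measure.addHaar_sphere (volE k) 0 (√x)
  rw [volE, Measure.map_apply hm Metric.isClosed_sphere.measurableSet] at h
  refine measure_mono_null ?_ h
  intro b hb
  have hb : nsq b = x := hb
  simp only [Set.mem_preimage, mem_sphere_zero_iff_norm]
  change ‖WithLp.toLp 2 b‖ = _
  rw [← hb, ← norm_sq_toLp, Real.sqrt_sq (norm_nonneg _)]

end ZFC
end

/-! ### The Beta law of the squared distance from a uniform unit vector to a subspace. -/

noncomputable section
open scoped ENNReal
namespace ZFC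

/-- Concatenation of independent Gaussian vectors. -/
theorem measurePreserving_append (M m : ℕ) :
    MeasurePreserving (fun p : (Fin M → ℂ) × (Fin m → ℂ) => Fin.append p.1 p.2)
      ((cgPi M).prod (cgPi m)) (cgPi (M + m)) := by
  have hm : Measurable (fun p : (Fin M → ℂ) × (Fin m → ℂ) => Fin.append p.1 p.2) := by
    refine measurable_pi_iff.2 fun i => ?_
    refine Fin.addCases (fun j => ?_) (fun j => ?_) i
    · simp only [Fin.append_left]
      exact (measurable_pi_apply j).comp measurable_fst
    · simp only [Fin.append_right]
      exact (measurable_pi_apply j).comp measurable_snd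
  refine ⟨hm, ?_⟩
  symm
  refine Measure.pi_eq fun s hs => ?_
  rw [Measure.map_apply hm (MeasurableSet.univ_pi hs)]
  have : (fun p : (Fin M → ℂ) × (Fin m → ℂ) => Fin.append p.1 p.2) ⁻¹' (Set.pi Set.univ s) =
      (Set.pi Set.univ fun i => s (Fin.castAdd m i)) ×ˢ
        (Set.pi Set.univ fun i => s (Fin.natAdd M i)) := by
    ext p
    simp only [Set.mem_preimage, Set.mem_pi, Set.mem_univ, true_imp_iff, Set.mem_prod]
    constructor
    · intro h
      exact ⟨fun i => by simpa using h (Fin.castAdd m i), fun i => by simpa using h (Fin.natAdd M i)⟩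
    · rintro ⟨h1, h2⟩ i
      refine Fin.addCases (fun j => ?_) (fun j => ?_) i
      · simpa using h1 j
      · simpa using h2 j
  rw [this, Measure.prod_prod, Measure.pi_pi, Measure.pi_pi, Fin.prod_univ_add]

theorem nsq_append {M m : ℕ} (a : Fin M → ℂ) (b : Fin m → ℂ) :
    nsq (Fin.append a b) = nsq a + nsq b := by
  simp [nsq, Fin.sum_univ_add]

/-- The fraction of the squared norm of a Gaussian vector of `ℂ^(M+m)` that lies in the last `m`
coordinates. -/
def tailFrac {M m : ℕ} (p : (Fin M → ℂ) × (Fin m → ℂ)) : ℝ := nsq p.2 / (nsq p.1 + nsq p.2)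

theorem measurable_tailFrac {M m : ℕ} : Measurable (tailFrac (M := M) (m := m)) :=
  (measurable_nsq.comp measurable_snd).div
    ((measurable_nsq.comp measurable_fst).add (measurable_nsq.comp measurable_snd))

/-- The law of `1 - ‖P u‖²`, for `u` uniform on the unit sphere of `ℂ^(M+m)` and `P` a projection
of rank `M`. -/
def betaLaw (M m : ℕ) : Measure ℝ := ((cgPi M).prod (cgPi m)).map tailFrac

instance (M m : ℕ) : IsProbabilityMeasure (betaLaw M m) :=
  Measure.isProbabilityMeasure_map measurable_tailFrac.aemeasurable

/-- The linear isometric embedding on the first `M` coordinates. -/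
theorem exists_embedding (M m : ℕ) :
    ∃ f : EuclideanSpace ℂ (Fin M) →ₗᵢ[ℂ] EuclideanSpace ℂ (Fin (M + m)),
      ∀ a b, LinearMap.adjoint f.toLinearMap (WithLp.toLp 2 (Fin.append a b)) =
        WithLp.toLp 2 a := by
  let L : EuclideanSpace ℂ (Fin M) →ₗ[ℂ] EuclideanSpace ℂ (Fin (M + m)) :=
    { toFun := fun x => WithLp.toLp 2 (Fin.append x.ofLp 0)
      map_add' := by
        intro x y
        ext i
        refine Fin.addCases (fun j => ?_) (fun j => ?_) i <;> simp
      map_smul' := by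
        intro c x
        ext i
        refine Fin.addCases (fun j => ?_) (fun j => ?_) i <;> simp }
  have hL : ∀ x, ‖L x‖ = ‖x‖ := by
    intro x
    have h1 : ‖L x‖ ^ 2 = ‖x‖ ^ 2 := by
      have h2 : ‖L x‖ ^ 2 = nsq (Fin.append x.ofLp (0 : Fin m → ℂ)) := norm_sq_toLp _
      have h3 : ‖x‖ ^ 2 = nsq x.ofLp := norm_sq_toLp x.ofLp
      rw [h2, h3, nsq_append]
      simp [nsq]
    exact (pow_left_inj₀ (norm_nonneg _) (norm_nonneg _) two_ne_zero).1 h1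
  refine ⟨⟨L, hL⟩, fun a b => ?_⟩
  refine ext_inner_left ℂ fun x => ?_
  rw [LinearMap.adjoint_inner_right]
  change inner ℂ (L x) _ = _
  simp only [PiLp.inner_apply, L, LinearMap.coe_mk, AddHom.coe_mk, Fin.sum_univ_add]
  simp

/-- Two isometric embeddings differ by a unitary map, which preserves the law of `u`, so `f` may be
the embedding of the first `M` coordinates. With `u` a normalized Gaussian vector `(a, b)`, the
quantity becomes `‖b‖² / (‖a‖² + ‖b‖²)`. -/
theorem map_adjoint_eq_betaLaw {M m : ℕ} (hM : M ≠ 0)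
    (f : EuclideanSpace ℂ (Fin M) →ₗᵢ[ℂ] EuclideanSpace ℂ (Fin (M + m))) :
    (sphereLaw (M + m)).map (fun u => 1 - ‖LinearMap.adjoint f.toLinearMap u‖ ^ 2) =
      betaLaw M m := by
  have hmeas : ∀ f : EuclideanSpace ℂ (Fin M) →ₗᵢ[ℂ] EuclideanSpace ℂ (Fin (M + m)),
      Measurable (fun u => 1 - ‖LinearMap.adjoint f.toLinearMap u‖ ^ 2) := by
    intro f
    have := (LinearMap.adjoint f.toLinearMap).continuous_of_finiteDimensional
    exact (by fun_prop : Continuous fun u => 1 - ‖LinearMap.adjoint f.toLinearMap u‖ ^ 2).measurable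
  obtain ⟨f₀, hf₀⟩ := exists_embedding M m
  have key : (sphereLaw (M + m)).map (fun u => 1 - ‖LinearMap.adjoint f.toLinearMap u‖ ^ 2) =
      (sphereLaw (M + m)).map (fun u => 1 - ‖LinearMap.adjoint f₀.toLinearMap u‖ ^ 2) := by
    obtain ⟨U, hU⟩ := exists_unitary_comp f f₀
    conv_rhs => rw [← sphereLaw_map U]
    rw [Measure.map_map (hmeas f₀) U.continuous.measurable]
    congr 1
    funext u
    simp only [Function.comp]
    congr 3
    refine ext_inner_left ℂ fun x => ?_
    rw [LinearMap.adjoint_inner_right, LinearMap.adjoint_inner_right]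
    change inner ℂ (f x) u = inner ℂ (f₀ x) (U u)
    rw [← hU, U.inner_map_map]
  rw [key, sphereLaw_eq, Measure.map_map (hmeas f₀) measurable_dir, gaussVec, Measure.map_map
    ((hmeas f₀).comp measurable_dir) (by fun_prop), ← cgPi, ← (measurePreserving_append M m).map_eq,
    Measure.map_map (((hmeas f₀).comp measurable_dir).comp (by fun_prop))
      (measurePreserving_append M m).measurable, betaLaw]
  have h0 : ∀ᵐ p ∂(cgPi M).prod (cgPi m), nsq p.1 ≠ 0 := by
    have : ∀ᵐ a ∂cgPi M, nsq a ≠ 0 := by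
      rw [ae_iff]; simpa using cgPi_nsq_eq hM 0
    exact Measure.quasiMeasurePreserving_fst.ae this
  refine Measure.map_congr ?_
  filter_upwards [h0] with p hp
  simp only [Function.comp, dir, map_smul, hf₀, norm_smul, mul_pow, norm_sq_toLp, tailFrac]
  have h1 : ‖((‖WithLp.toLp 2 (Fin.append p.1 p.2)‖ : ℂ))⁻¹‖ ^ 2 = (nsq p.1 + nsq p.2)⁻¹ := by
    rw [norm_inv, inv_pow, Complex.norm_real, norm_norm, norm_sq_toLp, nsq_append]
  rw [h1]
  have : nsq p.1 + nsq p.2 ≠ 0 := by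
    have := nsq_nonneg p.1
    have := nsq_nonneg p.2
    have : 0 < nsq p.1 := lt_of_le_of_ne (by assumption) (Ne.symm hp)
    positivity
  field_simp
  ring

/-- The Beta law has no atoms. -/
theorem betaLaw_singleton {M m : ℕ} (hM : M ≠ 0) (hm : m ≠ 0) (x : ℝ) :
    betaLaw M m {x} = 0 := by
  rw [betaLaw, Measure.map_apply measurable_tailFrac (measurableSet_singleton x)]
  rw [Measure.measure_prod_null (measurable_tailFrac (measurableSet_singleton x))]
  have h0 : ∀ᵐ a ∂cgPi M, nsq a ≠ 0 := by
    rw [ae_iff]; simpa using cgPi_nsq_eq hM 0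
  filter_upwards [h0] with a ha
  have ha' : 0 < nsq a := lt_of_le_of_ne (nsq_nonneg a) (Ne.symm ha)
  refine measure_mono_null ?_ (cgPi_nsq_eq hm (x * nsq a / (1 - x)))
  intro b hb
  have hb : nsq b / (nsq a + nsq b) = x := hb
  have hb0 := nsq_nonneg b
  have hs : 0 < nsq a + nsq b := by positivity
  rw [div_eq_iff hs.ne'] at hb
  have hx : 1 - x ≠ 0 := by
    intro h
    have : x = 1 := by linarith
    rw [this] at hb; linarith
  change nsq b = _
  rw [eq_div_iff hx]
  linarith

/-- Distribution function of the Beta law as an average of Gaussian ball probabilities. -/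
theorem betaLaw_Iic {M m : ℕ} (hM : M ≠ 0) {t : ℝ} (ht : t < 1) :
    (betaLaw M m).real (Set.Iic t) =
      ∫ a, (cgPi m).real {b | nsq b ≤ t / (1 - t) * nsq a} ∂cgPi M := by
  rw [Measure.real, betaLaw, Measure.map_apply measurable_tailFrac measurableSet_Iic,
    Measure.prod_apply (measurable_tailFrac measurableSet_Iic), ← integral_toReal]
  · have h0 : ∀ᵐ a ∂cgPi M, nsq a ≠ 0 := by
      rw [ae_iff]; simpa using cgPi_nsq_eq hM 0
    refine integral_congr_ae ?_
    filter_upwards [h0] with a ha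
    have ha' : 0 < nsq a := lt_of_le_of_ne (nsq_nonneg a) (Ne.symm ha)
    have : Prod.mk a ⁻¹' (tailFrac ⁻¹' Set.Iic t) =
        {b : Fin m → ℂ | nsq b ≤ t / (1 - t) * nsq a} := by
      ext b
      have hb0 := nsq_nonneg b
      have hs : 0 < nsq a + nsq b := by positivity
      have h1 : 0 < 1 - t := by linarith
      change nsq b / (nsq a + nsq b) ≤ t ↔ nsq b ≤ t / (1 - t) * nsq a
      rw [div_le_iff₀ hs, div_mul_eq_mul_div, le_div_iff₀ h1]
      constructor <;> intro h <;> linarith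
    rw [this]; rfl
  · exact (measurable_measure_prodMk_left (measurable_tailFrac measurableSet_Iic)).aemeasurable
  · exact Eventually.of_forall fun a => measure_lt_top _ _

end ZFC
end

/-! ### High-resolution asymptotics of the minimum of independent Beta variables. -/

noncomputable section
open scoped ENNReal
namespace ZFC

theorem betaLaw_Ioi (M m : ℕ) (t : ℝ) :
    (betaLaw M m).real (Set.Ioi t) = 1 - (betaLaw M m).real (Set.Iic t) := by
  rw [← Set.compl_Iic, probReal_compl_eq_one_sub measurableSet_Iic]

theorem betaLaw_Ioi_eq_zero {M m : ℕ} {t : ℝ} (ht : 1 ≤ t) :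
    (betaLaw M m).real (Set.Ioi t) = 0 := by
  rw [Measure.real, betaLaw, Measure.map_apply measurable_tailFrac measurableSet_Ioi]
  have : tailFrac (M := M) (m := m) ⁻¹' Set.Ioi t = ∅ := by
    rw [Set.eq_empty_iff_forall_notMem]
    intro p hp
    have hp : t < nsq p.2 / (nsq p.1 + nsq p.2) := hp
    have : nsq p.2 / (nsq p.1 + nsq p.2) ≤ 1 :=
      div_le_one_of_le₀ (by linarith [nsq_nonneg p.1]) (by linarith [nsq_nonneg p.1, nsq_nonneg p.2])
    linarith
  rw [this]; simp

theorem measurable_cgPi_nsq_le {M m : ℕ} (c : ℝ) :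
    Measurable fun a : Fin M → ℂ => (cgPi m).real {b | nsq b ≤ c * nsq a} := by
  have hmono : Monotone fun x : ℝ => (cgPi m).real {b | nsq b ≤ x} := by
    intro x y hxy
    exact measureReal_mono (fun b (hb : nsq b ≤ x) => hb.trans hxy)
  exact hmono.measurable.comp (measurable_const.mul measurable_nsq)

theorem integral_nsq_pow {M : ℕ} (hM : M ≠ 0) (m : ℕ) :
    ∫ a, nsq a ^ m / (m.factorial : ℝ) ∂cgPi M = ((M + m - 1).choose (M - 1) : ℝ) := by
  have hM' : (0 : ℝ) < M := by exact_mod_cast Nat.pos_of_ne_zero hM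
  have h := integral_nsq_rpow hM (s := (m : ℝ)) (by have : (0:ℝ) ≤ m := m.cast_nonneg; linarith)
  simp only [Real.rpow_natCast] at h
  rw [integral_div, h]
  obtain ⟨k, rfl⟩ := Nat.exists_eq_succ_of_ne_zero hM
  have h1 : ((k.succ : ℝ) + m) = ((k + m : ℕ) : ℝ) + 1 := by push_cast; ring
  have h2 : (k.succ : ℝ) = (k : ℝ) + 1 := by push_cast; ring
  rw [h1, h2, Real.Gamma_nat_eq_factorial, Real.Gamma_nat_eq_factorial]
  have h3 : k.succ + m - 1 = k + m := by omega
  have h4 : k.succ - 1 = k := by omega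
  rw [h3, h4, Nat.cast_choose ℝ (by omega : k ≤ k + m)]
  have h5 : k + m - k = m := by omega
  rw [h5, div_div]

theorem integrable_nsq_pow {M : ℕ} (hM : M ≠ 0) (m : ℕ) :
    Integrable (fun a => nsq a ^ m / (m.factorial : ℝ)) (cgPi M) := by
  have h := integrable_nsq_rpow hM (s := (m : ℝ))
    (by have : (0:ℝ) ≤ m := m.cast_nonneg
        have hM' : (0 : ℝ) < M := by exact_mod_cast Nat.pos_of_ne_zero hM
        linarith)
  simp only [Real.rpow_natCast] at h
  exact h.div_const _

/-- Behaviour of the distribution function of the Beta law at the origin. -/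
theorem tendsto_betaLaw_Iic {M m : ℕ} (hM : M ≠ 0) (hm : m ≠ 0) :
    Tendsto (fun t : ℝ => (betaLaw M m).real (Set.Iic t) / t ^ m) (𝓝[>] 0)
      (𝓝 ((M + m - 1).choose (M - 1) : ℝ)) := by
  rw [← integral_nsq_pow hM m]
  have hev : ∀ᶠ t : ℝ in 𝓝[>] 0, 0 < t ∧ t ≤ 1 / 2 := by
    filter_upwards [Ioc_mem_nhdsGT (show (0 : ℝ) < 1 / 2 by norm_num)] with t ht using ht
  have heq : ∀ᶠ t : ℝ in 𝓝[>] 0, ∫ a, (cgPi m).real {b | nsq b ≤ t / (1 - t) * nsq a} / t ^ m ∂cgPi M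
      = (betaLaw M m).real (Set.Iic t) / t ^ m := by
    filter_upwards [hev] with t ht
    rw [betaLaw_Iic hM (by linarith [ht.2]), integral_div]
  refine Tendsto.congr' heq ?_
  -- For fixed `a` the ball probability is squeezed between two bounds whose quotients by `t ^ m`
  -- both tend to `nsq a ^ m / m!`. The restriction `t ≤ 1 / 2` gives `1 / (1 - t) ≤ 2`, hence the
  -- dominating factor `2 ^ m`.
  have hupper : ∀ t : ℝ, 0 < t → t ≤ 1 / 2 → ∀ a : Fin M → ℂ,
      (cgPi m).real {b | nsq b ≤ t / (1 - t) * nsq a} / t ^ m ≤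
        (1 / (1 - t)) ^ m * (nsq a ^ m / (m.factorial : ℝ)) := by
    intro t h0 h1 a
    have h2 : 0 < 1 - t := by linarith
    rw [div_le_iff₀ (by positivity)]
    refine (cgPi_nsq_le_le hm (by have := nsq_nonneg a; positivity)).trans (le_of_eq ?_)
    rw [mul_pow, div_pow, div_pow, one_pow]; ring
  have hlower : ∀ t : ℝ, 0 < t → t ≤ 1 / 2 → ∀ a : Fin M → ℂ,
      Real.exp (-(t / (1 - t) * nsq a)) * ((1 / (1 - t)) ^ m * (nsq a ^ m / (m.factorial : ℝ))) ≤
      (cgPi m).real {b | nsq b ≤ t / (1 - t) * nsq a} / t ^ m := by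
    intro t h0 h1 a
    have h2 : 0 < 1 - t := by linarith
    rw [le_div_iff₀ (by positivity)]
    refine (le_of_eq ?_).trans
      (le_cgPi_nsq_le hm (by have := nsq_nonneg a; positivity : 0 ≤ t / (1 - t) * nsq a))
    rw [mul_pow (t / (1 - t)), div_pow, div_pow, one_pow]; ring
  have ht0 : Tendsto (fun t : ℝ => t) (𝓝[>] 0) (𝓝 0) := tendsto_id.mono_left nhdsWithin_le_nhds
  have hsub : Tendsto (fun t : ℝ => 1 - t) (𝓝[>] 0) (𝓝 1) := by
    simpa using (tendsto_const_nhds (x := (1 : ℝ))).sub ht0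
  have hinv : Tendsto (fun t : ℝ => 1 / (1 - t)) (𝓝[>] 0) (𝓝 1) := by
    have h := (tendsto_const_nhds (x := (1 : ℝ))).div hsub one_ne_zero
    rw [div_one] at h
    exact h
  have hth : Tendsto (fun t : ℝ => t / (1 - t)) (𝓝[>] 0) (𝓝 0) := by
    have h := ht0.div hsub one_ne_zero
    rw [div_one] at h
    exact h
  refine tendsto_integral_filter_of_dominated_convergence
    (fun a => 2 ^ m * (nsq a ^ m / (m.factorial : ℝ))) ?_ ?_ ?_ ?_
  · exact Eventually.of_forall fun t =>
      ((measurable_cgPi_nsq_le _).div_const _).aestronglyMeasurable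
  · filter_upwards [hev] with t ht
    refine Eventually.of_forall fun a => ?_
    have h2 : 0 < 1 - t := by linarith [ht.2]
    have h3 : 0 < t ^ m := pow_pos ht.1 _
    rw [Real.norm_of_nonneg (by positivity)]
    refine (hupper t ht.1 ht.2 a).trans ?_
    have h4 : 1 / (1 - t) ≤ 2 := by
      rw [div_le_iff₀ h2]; linarith [ht.2]
    have := nsq_nonneg a
    gcongr
  · exact (integrable_nsq_pow hM m).const_mul _
  · refine Eventually.of_forall fun a => ?_
    have hu : Tendsto (fun t : ℝ => (1 / (1 - t)) ^ m * (nsq a ^ m / (m.factorial : ℝ))) (𝓝[>] 0)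
        (𝓝 (nsq a ^ m / (m.factorial : ℝ))) := by
      simpa using (hinv.pow m).mul_const (nsq a ^ m / (m.factorial : ℝ))
    have hl : Tendsto (fun t : ℝ => Real.exp (-(t / (1 - t) * nsq a)) *
        ((1 / (1 - t)) ^ m * (nsq a ^ m / (m.factorial : ℝ)))) (𝓝[>] 0)
        (𝓝 (nsq a ^ m / (m.factorial : ℝ))) := by
      have h1 : Tendsto (fun t : ℝ => Real.exp (-(t / (1 - t) * nsq a))) (𝓝[>] 0) (𝓝 1) := by
        have := (Real.continuous_exp.tendsto _).comp (hth.mul_const (nsq a)).neg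
        rw [zero_mul, neg_zero, Real.exp_zero] at this
        exact this
      simpa using h1.mul hu
    refine tendsto_of_tendsto_of_tendsto_of_le_of_le' hl hu ?_ ?_
    · filter_upwards [hev] with t ht using hlower t ht.1 ht.2 a
    · filter_upwards [hev] with t ht using hupper t ht.1 ht.2 a

/-- A bound of order `t ^ m` on all of `(0, 1)`, which the asymptotics at the origin alone would not
give; it supplies the dominating function in `tendsto_minBetaMean`. The ball of squared radius `t *
nsq a` already suffices because `t ≤ t / (1 - t)`. -/
theorem exists_le_betaLaw_Iic {M m : ℕ} (hM : M ≠ 0) (hm : m ≠ 0) :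
    ∃ c : ℝ, 0 < c ∧ ∀ t : ℝ, 0 < t → t < 1 → c * t ^ m ≤ (betaLaw M m).real (Set.Iic t) := by
  have hint : Integrable (fun a : Fin M → ℂ =>
      Real.exp (-nsq a) * (nsq a ^ m / (m.factorial : ℝ))) (cgPi M) := by
    refine (integrable_nsq_pow hM m).mono'
      ((Real.measurable_exp.comp measurable_nsq.neg).mul
        ((measurable_nsq.pow_const m).div_const _)).aestronglyMeasurable ?_
    refine Eventually.of_forall fun a => ?_
    have := nsq_nonneg a
    rw [Real.norm_of_nonneg (by positivity)]
    refine mul_le_of_le_one_left (by positivity) ?_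
    rw [Real.exp_le_one_iff]; linarith
  refine ⟨∫ a, Real.exp (-nsq a) * (nsq a ^ m / (m.factorial : ℝ)) ∂cgPi M, ?_, ?_⟩
  · rw [integral_pos_iff_support_of_nonneg
      (fun a => by have := nsq_nonneg a; positivity) hint]
    have h0 : ∀ᵐ a ∂cgPi M, nsq a ≠ 0 := by
      rw [ae_iff]; simpa using cgPi_nsq_eq hM 0
    have : cgPi M (Function.support fun a : Fin M → ℂ =>
        Real.exp (-nsq a) * (nsq a ^ m / (m.factorial : ℝ))) = 1 := by
      have h1 : ∀ᵐ a ∂cgPi M, a ∈ Function.support fun a : Fin M → ℂ =>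
          Real.exp (-nsq a) * (nsq a ^ m / (m.factorial : ℝ)) := by
        filter_upwards [h0] with a ha
        simp [ha, m.factorial_ne_zero]
      have h2 := eventuallyEq_univ.2 h1
      exact (measure_congr h2).trans measure_univ
    rw [this]; exact one_pos
  · intro t h0 h1
    rw [betaLaw_Iic hM h1, ← integral_mul_const]
    refine integral_mono (hint.mul_const _) ?_ fun a => ?_
    · refine Integrable.of_bound (measurable_cgPi_nsq_le _).aestronglyMeasurable 1
        (Eventually.of_forall fun a => ?_)
      rw [Real.norm_of_nonneg (by positivity)]
      exact measureReal_le_one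
    · have h2 : 0 < 1 - t := by linarith
      have h3 := nsq_nonneg a
      have h4 := le_cgPi_nsq_le hm (by positivity : 0 ≤ t * nsq a)
      have h5 : (cgPi m).real {b | nsq b ≤ t * nsq a} ≤
          (cgPi m).real {b | nsq b ≤ t / (1 - t) * nsq a} := by
        refine measureReal_mono fun b hb => ?_
        have hb : nsq b ≤ t * nsq a := hb
        refine hb.trans ?_
        have : t ≤ t / (1 - t) := by
          rw [le_div_iff₀ h2]; nlinarith
        gcongr
      refine le_trans ?_ (h4.trans h5)
      have h6 : Real.exp (-nsq a) ≤ Real.exp (-(t * nsq a)) := by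
        rw [Real.exp_le_exp]; nlinarith
      calc Real.exp (-nsq a) * (nsq a ^ m / (m.factorial : ℝ)) * t ^ m
          = Real.exp (-nsq a) * ((t * nsq a) ^ m / (m.factorial : ℝ)) := by rw [mul_pow]; ring
        _ ≤ _ := by gcongr

/-- The mean of the minimum of `n` independent variables with the Beta law. -/
def minBetaMean (M m n : ℕ) : ℝ := ∫ t in Set.Ioi (0 : ℝ), (betaLaw M m).real (Set.Ioi t) ^ n

/-- Let `F` be the distribution function. Substituting `t = n^{-1/m} x` turns the integrand into `(1
- F(n^{-1/m} x))^n`, where `n F(n^{-1/m} x) → C x^m`. The limit is `∫ exp(-C x^m) dx`, a Gamma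
integral. Domination by `exp(-c x^m)` follows from `1 - F ≤ exp(-F)` and `exists_le_betaLaw_Iic`
while `t < 1`; beyond 1 the tail vanishes. -/
theorem tendsto_minBetaMean {M m : ℕ} (hM : M ≠ 0) (hm : m ≠ 0) :
    Tendsto (fun n : ℕ => (n : ℝ) ^ (1 / (m : ℝ)) * minBetaMean M m n) atTop
      (𝓝 (((M + m - 1).choose (M - 1) : ℝ) ^ (-1 / (m : ℝ)) * Real.Gamma (1 / (m : ℝ) + 1))) := by
  have hm' : (0 : ℝ) < m := by exact_mod_cast Nat.pos_of_ne_zero hm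
  have hC : (0 : ℝ) < ((M + m - 1).choose (M - 1) : ℝ) := by
    exact_mod_cast Nat.choose_pos (by omega)
  set C : ℝ := ((M + m - 1).choose (M - 1) : ℝ)
  obtain ⟨c, hc, hlow⟩ := exists_le_betaLaw_Iic hM hm
  rw [← integral_exp_neg_mul_rpow hm' hC]
  set T : ℝ → ℝ := fun t => (betaLaw M m).real (Set.Ioi t) with hT
  set b : ℕ → ℝ := fun n => ((n : ℝ) ^ (1 / (m : ℝ)))⁻¹ with hb
  have hbm : ∀ n : ℕ, n ≠ 0 → b n ^ m = (n : ℝ)⁻¹ := by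
    intro n hn
    simp only [hb]
    rw [inv_pow, ← Real.rpow_natCast, ← Real.rpow_mul n.cast_nonneg, one_div,
      inv_mul_cancel₀ hm'.ne', Real.rpow_one]
  have hbpos : ∀ n : ℕ, n ≠ 0 → 0 < b n := by
    intro n hn
    have : (0 : ℝ) < n := by exact_mod_cast Nat.pos_of_ne_zero hn
    simp only [hb]; positivity
  have hb0 : Tendsto b atTop (𝓝 0) := by
    refine Tendsto.inv_tendsto_atTop ?_
    exact (tendsto_rpow_atTop (by positivity)).comp tendsto_natCast_atTop_atTop
  have heq : ∀ᶠ n : ℕ in atTop, ∫ x in Set.Ioi (0 : ℝ), T (b n * x) ^ n =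
      (n : ℝ) ^ (1 / (m : ℝ)) * minBetaMean M m n := by
    filter_upwards [eventually_ne_atTop 0] with n hn
    rw [integral_comp_mul_left_Ioi (fun t => T t ^ n) 0 (hbpos n hn), mul_zero, smul_eq_mul]
    simp only [hb, inv_inv]; rfl
  refine Tendsto.congr' heq ?_
  have hTanti : Antitone T := fun x y hxy =>
    measureReal_mono (fun z (hz : y < z) => lt_of_le_of_lt hxy hz)
  have hT0 : ∀ t, 0 ≤ T t := fun t => measureReal_nonneg
  refine tendsto_integral_filter_of_dominated_convergence
    (fun x => Real.exp (-c * x ^ (m : ℝ))) ?_ ?_ ?_ ?_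
  · exact Eventually.of_forall fun n =>
      ((hTanti.measurable.comp (measurable_const.mul measurable_id)).pow_const n).aestronglyMeasurable
  · filter_upwards [eventually_ne_atTop 0] with n hn
    rw [ae_restrict_iff' measurableSet_Ioi]
    refine Eventually.of_forall fun x (hx : 0 < x) => ?_
    rw [Real.norm_of_nonneg (pow_nonneg (hT0 _) _)]
    by_cases h1 : b n * x < 1
    · have h2 := hlow (b n * x) (mul_pos (hbpos n hn) hx) h1
      have h3 : T (b n * x) ≤ Real.exp (-(c * (b n * x) ^ m)) := by
        have h4 := Real.add_one_le_exp (-(c * (b n * x) ^ m))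
        have h5 : T (b n * x) = 1 - (betaLaw M m).real (Set.Iic (b n * x)) := betaLaw_Ioi M m _
        linarith
      calc T (b n * x) ^ n ≤ Real.exp (-(c * (b n * x) ^ m)) ^ n := by
            gcongr
        _ = Real.exp (-c * x ^ (m : ℝ)) := by
            rw [← Real.exp_nat_mul, mul_pow, hbm n hn, Real.rpow_natCast]
            congr 1
            have : (n : ℝ) ≠ 0 := by exact_mod_cast hn
            field_simp
    · have : T (b n * x) = 0 := betaLaw_Ioi_eq_zero (not_lt.1 h1)
      rw [this, zero_pow hn]
      positivity
  · have := integrableOn_rpow_mul_exp_neg_mul_rpow (p := (m : ℝ)) (s := 0) (b := c) (by norm_num)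
      (by exact_mod_cast Nat.one_le_iff_ne_zero.2 hm) hc
    simp only [Real.rpow_zero, one_mul] at this
    exact this
  · rw [ae_restrict_iff' measurableSet_Ioi]
    refine Eventually.of_forall fun x (hx : 0 < x) => ?_
    have h1 : Tendsto (fun n : ℕ => b n * x) atTop (𝓝[>] 0) := by
      rw [tendsto_nhdsWithin_iff]
      refine ⟨by simpa using hb0.mul_const x, ?_⟩
      filter_upwards [eventually_ne_atTop 0] with n hn
      exact mul_pos (hbpos n hn) hx
    have h2 := (tendsto_betaLaw_Iic hM hm).comp h1
    have h3 : Tendsto (fun n : ℕ => (n : ℝ) * (-(betaLaw M m).real (Set.Iic (b n * x)))) atTop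
        (𝓝 (-C * x ^ (m : ℝ))) := by
      have h4 : Tendsto (fun n : ℕ => -((betaLaw M m).real (Set.Iic (b n * x)) / (b n * x) ^ m *
          x ^ (m : ℝ))) atTop (𝓝 (-C * x ^ (m : ℝ))) := by
        rw [neg_mul]
        exact (h2.mul_const (x ^ (m : ℝ))).neg
      refine Tendsto.congr' ?_ h4
      filter_upwards [eventually_ne_atTop 0] with n hn
      have hn' : (n : ℝ) ≠ 0 := by exact_mod_cast hn
      have hx' : x ^ m ≠ 0 := (pow_pos hx m).ne'
      rw [mul_pow, hbm n hn, Real.rpow_natCast]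
      field_simp
    have h5 := Real.tendsto_one_add_pow_exp_of_tendsto h3
    refine h5.congr fun n => ?_
    rw [hT]
    simp only [betaLaw_Ioi, sub_eq_add_neg]

end ZFC
end

/-! ### The interpolation identities behind the closed form of the gain. -/

noncomputable section
open scoped ENNReal
namespace ZFC

/-- Lagrange interpolation of a polynomial function, in terms of values. -/
theorem lagrange_eval {s : Finset ℕ} {x : ℕ → ℝ} (hx : Set.InjOn x s) (p : Polynomial ℝ)
    (hp : p.degree < s.card) (y : ℝ) :
    ∑ n ∈ s, p.eval (x n) / (∏ i ∈ s.erase n, (x n - x i)) * ∏ i ∈ s.erase n, (y - x i) =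
      p.eval y := by
  have h := congrArg (Polynomial.eval y) (Lagrange.eq_interpolate hx hp)
  rw [h, Lagrange.interpolate_eq_sum, Polynomial.eval_finsetSum]
  refine Finset.sum_congr rfl fun n _ => ?_
  simp [Polynomial.eval_prod]

/-- The sum is the coefficient of degree `card - 1` in the Lagrange interpolant of `X ^ k`, and `k`
is smaller. -/
theorem sum_pow_div_prod_sub {s : Finset ℕ} {x : ℕ → ℝ} (hx : Set.InjOn x s) {k : ℕ}
    (hk : k + 1 < s.card) :
    ∑ n ∈ s, x n ^ k / (∏ i ∈ s.erase n, (x n - x i)) = 0 := by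
  have h := Lagrange.coeff_eq_sum hx (P := (Polynomial.X ^ k : Polynomial ℝ)) (by
    rw [Polynomial.degree_X_pow]; exact_mod_cast (by omega : k < s.card))
  simp only [Polynomial.eval_pow, Polynomial.eval_X, Polynomial.coeff_X_pow] at h
  rw [if_neg (by omega)] at h
  exact h.symm

/-- Partial fractions for a product of `1 / (1 + s x_i)`. -/
theorem prod_inv_one_add {I : Finset ℕ} {x : ℕ → ℝ} (hx : Set.InjOn x I)
    (hpos : ∀ i ∈ I, 0 < x i) (hI : I.Nonempty) {s : ℝ} (hs : 0 < s) :
    ∏ i ∈ I, (1 + s * x i)⁻¹ =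
      ∑ n ∈ I, x n ^ (I.card - 1) / (∏ i ∈ I.erase n, (x n - x i)) * (1 + s * x n)⁻¹ := by
  have hc : 0 < I.card := hI.card_pos
  -- The point `-1 / s` is chosen because `-s * (-1 / s - x i) = 1 + s * x i`: multiplication by
  -- `(-s) ^ (card - 1)` clears all denominators.
  have h := lagrange_eval hx (Polynomial.X ^ (I.card - 1) : Polynomial ℝ) (by
    rw [Polynomial.degree_X_pow]; exact_mod_cast (by omega : I.card - 1 < I.card)) (-1 / s)
  simp only [Polynomial.eval_pow, Polynomial.eval_X] at h
  have h1 : ∑ n ∈ I, x n ^ (I.card - 1) / (∏ i ∈ I.erase n, (x n - x i)) *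
      ∏ i ∈ I.erase n, (1 + s * x i) = 1 := by
    have h2 : (-s) ^ (I.card - 1) * (-1 / s) ^ (I.card - 1) = 1 := by
      rw [← mul_pow]
      have : -s * (-1 / s) = 1 := by field_simp
      rw [this, one_pow]
    refine Eq.trans ?_ h2
    rw [← h, Finset.mul_sum]
    refine Finset.sum_congr rfl fun n hn => ?_
    rw [mul_left_comm]
    congr 1
    rw [← Finset.card_erase_of_mem hn, ← Finset.prod_const, ← Finset.prod_mul_distrib]
    refine Finset.prod_congr rfl fun i _ => ?_
    field_simp
    ring
  have hne : ∀ i ∈ I, 1 + s * x i ≠ 0 := fun i hi => by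
    have := hpos i hi; positivity
  calc ∏ i ∈ I, (1 + s * x i)⁻¹ = (∏ i ∈ I, (1 + s * x i)⁻¹) *
        ∑ n ∈ I, x n ^ (I.card - 1) / (∏ i ∈ I.erase n, (x n - x i)) *
          ∏ i ∈ I.erase n, (1 + s * x i) := by rw [h1, mul_one]
    _ = _ := by
      rw [Finset.mul_sum]
      refine Finset.sum_congr rfl fun n hn => ?_
      rw [← Finset.mul_prod_erase I (fun i => (1 + s * x i)⁻¹) hn, Finset.prod_inv_distrib]
      have h3 : ∏ i ∈ I.erase n, (1 + s * x i) ≠ 0 :=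
        Finset.prod_ne_zero_iff.2 fun i hi => hne i (Finset.mem_of_mem_erase hi)
      have h4 : (∏ i ∈ I.erase n, (1 + s * x i))⁻¹ * ∏ i ∈ I.erase n, (1 + s * x i) = 1 :=
        inv_mul_cancel₀ h3
      linear_combination ((1 + s * x n)⁻¹ * (x n ^ (I.card - 1) /
        (∏ i ∈ I.erase n, (x n - x i)))) * h4

/-- Partial fractions give the antiderivative `∑ eₙ log(1 + s xₙ)`. Since `∑ eₙ = 0`, a term `log s`
may be subtracted from every logarithm, so the limit at infinity is finite. The integrand is
nonnegative, so this limit also gives integrability. -/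
theorem integral_prod_inv_one_add {I : Finset ℕ} {x : ℕ → ℝ} (hx : Set.InjOn x I)
    (hpos : ∀ i ∈ I, 0 < x i) (hI : 2 ≤ I.card) :
    IntegrableOn (fun s => ∏ i ∈ I, (1 + s * x i)⁻¹) (Set.Ioi (0 : ℝ)) ∧
    ∫ s in Set.Ioi (0 : ℝ), ∏ i ∈ I, (1 + s * x i)⁻¹ =
      ∑ n ∈ I, x n ^ (I.card - 2) / (∏ i ∈ I.erase n, (x n - x i)) * Real.log (x n) := by
  have hne : I.Nonempty := Finset.card_pos.1 (by omega)
  have hpos' : ∀ n ∈ I, ∀ s : ℝ, 0 ≤ s → 0 < 1 + s * x n := fun n hn s hs => by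
    have := hpos n hn; positivity
  have hzero := sum_pow_div_prod_sub hx (k := I.card - 2) (by omega)
  set e : ℕ → ℝ := fun n => x n ^ (I.card - 2) / ∏ i ∈ I.erase n, (x n - x i) with he
  set g : ℝ → ℝ := fun s => ∑ n ∈ I, e n * Real.log (1 + s * x n) with hg
  have hderiv : ∀ s ∈ Set.Ici (0 : ℝ), HasDerivAt g (∑ n ∈ I, e n * (x n / (1 + s * x n))) s := by
    intro s hs
    refine HasDerivAt.fun_sum fun n hn => ?_
    refine HasDerivAt.const_mul _ ?_
    have h1 : HasDerivAt (fun s : ℝ => 1 + s * x n) (x n) s := by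
      simpa using ((hasDerivAt_id s).mul_const (x n)).const_add 1
    exact h1.log (hpos' n hn s hs).ne'
  have heq : ∀ s ∈ Set.Ioi (0 : ℝ), ∏ i ∈ I, (1 + s * x i)⁻¹ =
      ∑ n ∈ I, e n * (x n / (1 + s * x n)) := by
    intro s hs
    rw [prod_inv_one_add hx hpos hne hs]
    refine Finset.sum_congr rfl fun n _ => ?_
    have : I.card - 1 = I.card - 2 + 1 := by omega
    rw [this, pow_succ, he]
    ring
  rw [setIntegral_congr_fun measurableSet_Ioi heq]
  have hlim : Tendsto g atTop (𝓝 (∑ n ∈ I, e n * Real.log (x n))) := by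
    have h1 : ∀ᶠ s : ℝ in atTop, ∑ n ∈ I, e n * Real.log (s⁻¹ + x n) = g s := by
      filter_upwards [eventually_gt_atTop 0] with s hs
      have h2 : ∀ n ∈ I, Real.log (s⁻¹ + x n) = Real.log (1 + s * x n) - Real.log s := by
        intro n hn
        rw [← Real.log_div (hpos' n hn s hs.le).ne' hs.ne']
        congr 1
        field_simp
      rw [Finset.sum_congr rfl fun n hn => by rw [h2 n hn, mul_sub], Finset.sum_sub_distrib,
        ← Finset.sum_mul, hzero, zero_mul, sub_zero]
    refine Tendsto.congr' h1 ?_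
    refine tendsto_finsetSum _ fun n hn => Tendsto.const_mul _ ?_
    refine Tendsto.log ?_ (hpos n hn).ne'
    simpa using tendsto_inv_atTop_zero.add_const (x n)
  have hnn : ∀ s ∈ Set.Ioi (0 : ℝ), 0 ≤ ∑ n ∈ I, e n * (x n / (1 + s * x n)) := by
    intro s hs
    rw [← heq s hs]
    exact Finset.prod_nonneg fun i hi => (inv_pos.2 (hpos' i hi s (le_of_lt hs))).le
  rw [integral_Ioi_of_hasDerivAt_of_nonneg' hderiv hnn hlim]
  refine ⟨?_, by simp [hg, he]⟩
  exact (integrableOn_congr_fun heq measurableSet_Ioi).2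
    (integrableOn_Ioi_deriv_of_nonneg' hderiv hnn hlim)

/-- Derivative in `a` of the binomial expansion of `(a + z) ^ m`, with the factor `(m - s) / a` in
the shape in which it occurs in `coeffA`. -/
theorem sum_choose_mul_sub (m : ℕ) {a : ℝ} (ha : a ≠ 0) (z : ℝ) :
    ∑ s ∈ Finset.range (m + 1), (m.choose s : ℝ) * a ^ (m - s) * z ^ s * (((m : ℝ) - s) / a) =
      m * (a + z) ^ (m - 1) := by
  cases m with
  | zero => simp
  | succ k =>
    rw [Finset.sum_range_succ]
    simp only [sub_self, zero_div, mul_zero, add_zero, Nat.add_sub_cancel]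
    rw [add_comm a z, add_pow, Finset.mul_sum]
    refine Finset.sum_congr rfl fun s hs => ?_
    have hs' : s ≤ k := by simpa [Nat.lt_succ_iff] using hs
    have h1 := Nat.choose_mul_succ_eq k s
    have h2 : ((k.choose s : ℝ)) * (k + 1) = ((k + 1).choose s : ℝ) * ((k : ℝ) + 1 - s) := by
      have := congrArg (Nat.cast (R := ℝ)) h1
      rw [Nat.cast_mul, Nat.cast_mul, Nat.cast_sub (by omega)] at this
      push_cast at this
      exact this
    have h3 : k + 1 - s = (k - s) + 1 := by omega
    rw [h3, pow_succ]
    push_cast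
    field_simp
    linear_combination (-z ^ s) * h2

theorem integral_pow_div {a b : ℝ} (ha : 0 < a) (hb : 0 < b) (k : ℕ) :
    ∫ y in a..b, y ^ k / y = if k = 0 then Real.log (b / a) else (b ^ k - a ^ k) / k := by
  cases k with
  | zero => simp [integral_inv_of_pos ha hb]
  | succ k =>
    have h : Set.EqOn (fun y : ℝ => y ^ (k + 1) / y) (fun y => y ^ k) (Set.uIcc a b) := by
      intro y hy
      have : 0 < y := lt_of_lt_of_le (lt_min ha hb) hy.1
      simp only
      rw [pow_succ]; field_simp
    rw [intervalIntegral.integral_congr h, integral_pow]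
    simp

theorem intervalIntegrable_div_id {a b : ℝ} (ha : 0 < a) (hb : 0 < b) {f : ℝ → ℝ}
    (hf : Continuous f) : IntervalIntegrable (fun y => f y / y) volume a b := by
  refine ContinuousOn.intervalIntegrable ?_
  refine hf.continuousOn.div continuousOn_id fun y hy => ?_
  exact (lt_of_lt_of_le (lt_min ha hb) hy.1).ne'

/-- The numerator is minus the derivative in `y` of `(xₙ - y)^m (y - x_t)^(M-m-1)`. Expanded in
powers of `y` and divided by `y`, its constant term integrates to the logarithm in `coeffA` and the
other terms to the differences of powers. -/
theorem coeffA_eq_integral {M : ℕ} {x : ℕ → ℝ} {m n t : ℕ} (hm : 1 ≤ m) (hmM : m + 1 ≤ M)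
    (hn : x n ≠ 0) (ht : x t ≠ 0) (h1 : 0 < x (m + 1)) (h2 : 0 < x m) :
    coeffA M x m n t = ∫ y in x (m + 1)..x m,
      (m * (x n - y) ^ (m - 1) * (y - x t) ^ (M - m - 1) -
        (x n - y) ^ m * ((M - m - 1 : ℕ) * (y - x t) ^ (M - m - 1 - 1))) / y := by
  obtain ⟨q, rfl⟩ : ∃ q, M = m + 1 + q := ⟨M - (m + 1), by omega⟩
  have hq : m + 1 + q - m - 1 = q := by omega
  have hq' : m + 1 + q - m = q + 1 := by omega
  set K : ℕ → ℕ → ℝ := fun s r => (m.choose s : ℝ) * (q.choose r : ℝ) *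
    (x n ^ (m - s) * (-x t) ^ (q - r) * (-1) ^ s) * (((m : ℝ) - s) / x n + ((q : ℝ) - r) / x t)
    with hK
  have hint : ∀ y : ℝ, m * (x n - y) ^ (m - 1) * (y - x t) ^ q -
        (x n - y) ^ m * (q * (y - x t) ^ (q - 1)) =
        ∑ s ∈ Finset.range (m + 1), ∑ r ∈ Finset.range (q + 1), K s r * y ^ (s + r) := by
    intro y
    have e1 := sum_choose_mul_sub m hn (-y)
    have e2 := sum_choose_mul_sub q (neg_ne_zero.2 ht) y
    have e3 : (x n - y) ^ m = ∑ s ∈ Finset.range (m + 1),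
        (m.choose s : ℝ) * x n ^ (m - s) * (-y) ^ s := by
      rw [sub_eq_add_neg, add_comm, add_pow]
      exact Finset.sum_congr rfl fun s _ => by ring
    have e4 : (y - x t) ^ q = ∑ r ∈ Finset.range (q + 1),
        (q.choose r : ℝ) * (-x t) ^ (q - r) * y ^ r := by
      rw [sub_eq_add_neg, add_pow]
      exact Finset.sum_congr rfl fun s _ => by ring
    rw [← sub_eq_add_neg] at e1
    rw [neg_add_eq_sub] at e2
    rw [← e1, ← e2, e3, e4, Finset.sum_mul_sum, Finset.sum_mul_sum, ← Finset.sum_sub_distrib]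
    refine Finset.sum_congr rfl fun s _ => ?_
    rw [← Finset.sum_sub_distrib]
    refine Finset.sum_congr rfl fun r _ => ?_
    rw [hK]
    simp only
    rw [neg_pow y s, pow_add, div_neg]
    ring
  rw [hq]
  have hint' : (fun y : ℝ => (m * (x n - y) ^ (m - 1) * (y - x t) ^ q -
        (x n - y) ^ m * (q * (y - x t) ^ (q - 1))) / y) =
        fun y => ∑ s ∈ Finset.range (m + 1), ∑ r ∈ Finset.range (q + 1),
          K s r * (y ^ (s + r) / y) := by
    funext y
    rw [hint, Finset.sum_div]
    refine Finset.sum_congr rfl fun s _ => ?_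
    rw [Finset.sum_div]
    exact Finset.sum_congr rfl fun r _ => mul_div_assoc _ _ _
  rw [hint', intervalIntegral.integral_finsetSum]
  · simp_rw [intervalIntegral.integral_finsetSum (fun r _ =>
      (intervalIntegrable_div_id h1 h2 (continuous_pow _)).const_mul _),
      intervalIntegral.integral_const_mul, integral_pow_div h1 h2]
    have hsplit : ∀ s r : ℕ, K s r * (if s + r = 0 then Real.log (x m / x (m + 1)) else
        (x m ^ (s + r) - x (m + 1) ^ (s + r)) / ((s + r : ℕ) : ℝ)) =
        (if s = 0 then if r = 0 then K 0 0 * Real.log (x m / x (m + 1)) else 0 else 0) +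
        (if s + r = 0 then 0 else K s r * ((x m ^ (s + r) - x (m + 1) ^ (s + r)) /
          ((s + r : ℕ) : ℝ))) := by
      intro s r
      by_cases hs : s = 0
      · by_cases hr : r = 0
        · simp [hs, hr]
        · simp [hs, hr]
      · simp [hs]
    simp_rw [hsplit, Finset.sum_add_distrib]
    unfold coeffA
    rw [hq, hq']
    congr 1
    · rw [Finset.sum_eq_single 0 (fun s _ hs => by simp [hs]) (fun h => by simp at h),
        Finset.sum_eq_single 0 (fun r _ hr => by simp [hr]) (fun h => by simp at h)]
      simp only [if_true, hK]
      -- The integer exponent equals `1 - q` and may be negative.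
      have hz : (-x t) ^ ((2 : ℤ) + m - ((m + 1 + q : ℕ) : ℤ)) = (-x t) / (-x t) ^ q := by
        have : (2 : ℤ) + m - ((m + 1 + q : ℕ) : ℤ) = 1 - (q : ℤ) := by push_cast; ring
        rw [this, zpow_sub₀ (neg_ne_zero.2 ht), zpow_one, zpow_natCast]
      have hlog : Real.log (x (m + 1) / x m) = -Real.log (x m / x (m + 1)) := by
        rw [← Real.log_inv, inv_div]
      obtain ⟨k, rfl⟩ : ∃ k, m = k + 1 := ⟨m - 1, by omega⟩
      have hxt : -x t ≠ 0 := neg_ne_zero.2 ht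
      rw [hz, hlog]
      simp only [Nat.add_sub_cancel, Nat.choose_zero_right, Nat.cast_one, Nat.sub_zero, pow_zero,
        Nat.cast_zero, sub_zero, pow_succ]
      push_cast
      rw [neg_div, div_neg_eq_neg_div', ]
      field_simp
      ring
    · refine Finset.sum_congr rfl fun s _ => Finset.sum_congr rfl fun r _ => ?_
      by_cases hsr : s + r = 0
      · simp [hsr]
      · rw [if_neg hsr, if_neg hsr, hK]
        have h3 : ((s : ℝ) + r) ≠ 0 := by exact_mod_cast hsr
        have h4 : ((-1 : ℝ) ^ s) * (-1) ^ s = 1 := by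
          rw [← mul_pow]; norm_num
        have h5 : ((-1 : ℝ) ^ s) ≠ 0 := by positivity
        have h6 : ((-1 : ℝ) ^ s)⁻¹ = (-1) ^ s := inv_eq_of_mul_eq_one_left h4
        rw [add_comm r s]
        push_cast
        have h7 : (m : ℝ) + 1 + q - m - 1 - r = q - r := by ring
        rw [h7]
        simp only [div_eq_mul_inv, mul_inv, h6]
        ring
  · intro s _
    have : (fun y : ℝ => ∑ r ∈ Finset.range (q + 1), K s r * (y ^ (s + r) / y)) =
        ∑ r ∈ Finset.range (q + 1), fun y : ℝ => K s r * (y ^ (s + r) / y) := by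
      funext y; simp
    rw [this]
    exact IntervalIntegrable.sum _ fun r _ =>
      (intervalIntegrable_div_id h1 h2 (continuous_pow _)).const_mul _

/-- For fixed `n`, the sum over `t` is the Lagrange interpolation of the polynomial `(y -
X)^(M-m-1)` at the nodes `x_t`, `t > m`, evaluated at `xₙ`. The degree is one less than the number
of nodes, so the polynomial is recovered exactly. The leftover product of `xₙ - x_t` completes the
denominator to all indices other than `n`. -/
theorem sum_sum_eq {M : ℕ} {x : ℕ → ℝ} {m : ℕ} (hmM : m + 1 ≤ M)
    (hx : Set.InjOn x (Finset.Icc 1 M)) (y : ℝ) :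
    ∑ n ∈ Finset.Icc 1 m, ∑ t ∈ Finset.Icc (m + 1) M,
      (x n - y) ^ m * (y - x t) ^ (M - m - 1) /
      ((x n - x t) * (∏ i ∈ (Finset.Icc 1 m).erase n, (x n - x i)) *
        ∏ j ∈ (Finset.Icc (m + 1) M).erase t, (x j - x t)) =
    ∑ n ∈ Finset.Icc 1 m, (x n - y) ^ (M - 1) / ∏ i ∈ (Finset.Icc 1 M).erase n, (x n - x i) := by
  refine Finset.sum_congr rfl fun n hn => ?_
  have hn' := Finset.mem_Icc.1 hn
  set J := Finset.Icc (m + 1) M with hJ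
  set q := M - m - 1 with hq
  have hJc : J.card = q + 1 := by rw [hJ, Nat.card_Icc]; omega
  have hJs : J ⊆ Finset.Icc 1 M := Finset.Icc_subset_Icc (by omega) le_rfl
  have hxJ : Set.InjOn x J := hx.mono (by exact_mod_cast hJs)
  have hnJ : ∀ t ∈ J, x n - x t ≠ 0 := by
    intro t ht
    have ht' := Finset.mem_Icc.1 ht
    rw [sub_ne_zero]
    intro h
    have := hx (by simp; omega) (by simp; omega) h
    omega
  have hprodJ : ∀ t ∈ J, ∏ j ∈ J.erase t, (x t - x j) ≠ 0 := by
    intro t ht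
    refine Finset.prod_ne_zero_iff.2 fun j hj => ?_
    rw [sub_ne_zero]
    intro h
    exact (Finset.ne_of_mem_erase hj) (hxJ (Finset.mem_of_mem_erase hj) ht h.symm)
  have hlag := lagrange_eval hxJ ((Polynomial.C y - Polynomial.X) ^ q : Polynomial ℝ) (by
    rw [hJc]
    refine lt_of_le_of_lt (Polynomial.degree_pow_le _ _) ?_
    have h1 : (Polynomial.C y - Polynomial.X : Polynomial ℝ).degree ≤ 1 :=
      (Polynomial.degree_sub_le _ _).trans
        (max_le (Polynomial.degree_C_le.trans (by norm_num)) Polynomial.degree_X_le)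
    calc q • (Polynomial.C y - Polynomial.X : Polynomial ℝ).degree ≤ q • (1 : WithBot ℕ) :=
          nsmul_le_nsmul_right h1 q
      _ = (q : WithBot ℕ) := by simp
      _ < ((q + 1 : ℕ) : WithBot ℕ) := by exact_mod_cast Nat.lt_succ_self q) (x n)
  simp only [Polynomial.eval_pow, Polynomial.eval_sub, Polynomial.eval_C, Polynomial.eval_X] at hlag
  have hsgn : ∀ t ∈ J, ∏ j ∈ J.erase t, (x j - x t) =
      (-1) ^ q * ∏ j ∈ J.erase t, (x t - x j) := by
    intro t ht
    have hc : (J.erase t).card = q := by rw [Finset.card_erase_of_mem ht, hJc]; omega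
    rw [← hc, ← Finset.prod_const, ← Finset.prod_mul_distrib]
    exact Finset.prod_congr rfl fun j _ => by ring
  have hPJ : ∏ t ∈ J, (x n - x t) ≠ 0 := Finset.prod_ne_zero_iff.2 hnJ
  have h4 : ((-1 : ℝ) ^ q) * (-1) ^ q = 1 := by rw [← mul_pow]; norm_num
  have h5 : ((-1 : ℝ) ^ q)⁻¹ = (-1) ^ q := inv_eq_of_mul_eq_one_left h4
  have hinner : ∑ t ∈ J, (y - x t) ^ q / ((x n - x t) * ∏ j ∈ J.erase t, (x j - x t)) =
      (x n - y) ^ q / ∏ t ∈ J, (x n - x t) := by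
    rw [eq_div_iff hPJ, Finset.sum_mul]
    have h6 : (x n - y) ^ q = (-1) ^ q * (y - x n) ^ q := by rw [← mul_pow]; ring
    rw [h6, ← hlag, Finset.mul_sum]
    refine Finset.sum_congr rfl fun t ht => ?_
    rw [hsgn t ht, ← Finset.mul_prod_erase J (fun t => x n - x t) ht]
    have := hnJ t ht
    have := hprodJ t ht
    have h7 : (y - x t) ^ q / ((x n - x t) * ((-1) ^ q * ∏ j ∈ J.erase t, (x t - x j))) =
        (-1) ^ q * ((y - x t) ^ q / ((x n - x t) * ∏ j ∈ J.erase t, (x t - x j))) := by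
      simp only [div_eq_mul_inv, mul_inv, h5]; ring
    rw [h7]
    field_simp
  have hsplit : (Finset.Icc 1 M).erase n = (Finset.Icc 1 m).erase n ∪ J := by
    ext i
    simp only [Finset.mem_erase, Finset.mem_union, Finset.mem_Icc, hJ]
    omega
  have hdisj : Disjoint ((Finset.Icc 1 m).erase n) J := by
    rw [Finset.disjoint_left]
    intro i hi hi'
    simp only [Finset.mem_erase, Finset.mem_Icc, hJ] at hi hi'
    omega
  rw [hsplit, Finset.prod_union hdisj]
  have hpow : (x n - y) ^ (M - 1) = (x n - y) ^ m * (x n - y) ^ q := by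
    rw [← pow_add]; congr 1; omega
  calc ∑ t ∈ J, (x n - y) ^ m * (y - x t) ^ q /
        ((x n - x t) * (∏ i ∈ (Finset.Icc 1 m).erase n, (x n - x i)) *
        ∏ j ∈ J.erase t, (x j - x t))
      = (x n - y) ^ m / (∏ i ∈ (Finset.Icc 1 m).erase n, (x n - x i)) *
        ∑ t ∈ J, (y - x t) ^ q / ((x n - x t) * ∏ j ∈ J.erase t, (x j - x t)) := by
        rw [Finset.mul_sum]
        refine Finset.sum_congr rfl fun t _ => ?_
        rw [div_mul_div_comm]
        congr 1; ring
    _ = _ := by rw [hinner, div_mul_div_comm, hpow]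

/-- The derivative in `y` of the identity `sum_sum_eq`. -/
theorem sum_sum_deriv_eq {M : ℕ} {x : ℕ → ℝ} {m : ℕ} (hmM : m + 1 ≤ M)
    (hx : Set.InjOn x (Finset.Icc 1 M)) (y : ℝ) :
    ∑ n ∈ Finset.Icc 1 m, ∑ t ∈ Finset.Icc (m + 1) M,
      (m * (x n - y) ^ (m - 1) * (y - x t) ^ (M - m - 1) -
        (x n - y) ^ m * ((M - m - 1 : ℕ) * (y - x t) ^ (M - m - 1 - 1))) /
      ((x n - x t) * (∏ i ∈ (Finset.Icc 1 m).erase n, (x n - x i)) *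
        ∏ j ∈ (Finset.Icc (m + 1) M).erase t, (x j - x t)) =
    ∑ n ∈ Finset.Icc 1 m, ((M - 1 : ℕ) : ℝ) * (x n - y) ^ (M - 1 - 1) /
      ∏ i ∈ (Finset.Icc 1 M).erase n, (x n - x i) := by
  have hA : ∀ (n k : ℕ) (y : ℝ), HasDerivAt (fun y => (x n - y) ^ k)
      (-(k * (x n - y) ^ (k - 1))) y := by
    intro n k y
    have h := ((hasDerivAt_id y).const_sub (x n)).fun_pow k
    simpa using h
  have hB : ∀ (n k : ℕ) (y : ℝ), HasDerivAt (fun y => (y - x n) ^ k)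
      (k * (y - x n) ^ (k - 1)) y := by
    intro n k y
    have h := ((hasDerivAt_id y).sub_const (x n)).fun_pow k
    simpa using h
  have hL : HasDerivAt (fun y => ∑ n ∈ Finset.Icc 1 m, ∑ t ∈ Finset.Icc (m + 1) M,
      (x n - y) ^ m * (y - x t) ^ (M - m - 1) /
      ((x n - x t) * (∏ i ∈ (Finset.Icc 1 m).erase n, (x n - x i)) *
        ∏ j ∈ (Finset.Icc (m + 1) M).erase t, (x j - x t))) _ y :=
    HasDerivAt.fun_sum fun n _ => HasDerivAt.fun_sum fun t _ =>
      ((hA n m y).mul (hB t (M - m - 1) y)).div_const _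
  have hR : HasDerivAt (fun y => ∑ n ∈ Finset.Icc 1 m, (x n - y) ^ (M - 1) /
      ∏ i ∈ (Finset.Icc 1 M).erase n, (x n - x i)) _ y :=
    HasDerivAt.fun_sum fun n _ => (hA n (M - 1) y).div_const _
  have heq : (fun y => ∑ n ∈ Finset.Icc 1 m, ∑ t ∈ Finset.Icc (m + 1) M,
      (x n - y) ^ m * (y - x t) ^ (M - m - 1) /
      ((x n - x t) * (∏ i ∈ (Finset.Icc 1 m).erase n, (x n - x i)) *
        ∏ j ∈ (Finset.Icc (m + 1) M).erase t, (x j - x t))) =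
      fun y => ∑ n ∈ Finset.Icc 1 m, (x n - y) ^ (M - 1) /
      ∏ i ∈ (Finset.Icc 1 M).erase n, (x n - x i) := by
    funext y; exact sum_sum_eq hmM hx y
  rw [heq] at hL
  have h := hL.unique hR
  rw [← neg_inj, ← Finset.sum_neg_distrib, ← Finset.sum_neg_distrib]
  rw [← Finset.sum_congr rfl fun n _ => neg_div (∏ i ∈ (Finset.Icc 1 M).erase n, (x n - x i))
    (((M - 1 : ℕ) : ℝ) * (x n - y) ^ (M - 1 - 1)), ← h]
  refine Finset.sum_congr rfl fun n _ => ?_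
  rw [← Finset.sum_neg_distrib]
  refine Finset.sum_congr rfl fun t _ => ?_
  rw [← neg_div]
  congr 1
  ring

/-- After expansion of `(xₙ - y)^(M-2)`, every non-logarithmic term contributes powers `xₙ ^ k` with
`k ≤ M - 2`, and these sums vanish by `sum_pow_div_prod_sub`. The lower limit `x M` disappears from
the logarithm for the same reason. -/
theorem sum_integral_div {M : ℕ} (hM : 2 ≤ M) {x : ℕ → ℝ} (hx : Set.InjOn x (Finset.Icc 1 M))
    (hpos : ∀ i ∈ Finset.Icc 1 M, 0 < x i) :
    ∑ n ∈ Finset.Icc 1 M, (∫ y in x M..x n, (x n - y) ^ (M - 2) / y) /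
      (∏ i ∈ (Finset.Icc 1 M).erase n, (x n - x i)) =
    ∑ n ∈ Finset.Icc 1 M, x n ^ (M - 2) / (∏ i ∈ (Finset.Icc 1 M).erase n, (x n - x i)) *
      Real.log (x n) := by
  have hxM : 0 < x M := hpos M (by simp; omega)
  have hcard : (Finset.Icc 1 M).card = M := by simp
  have hzero : ∀ k, k ≤ M - 2 →
      ∑ n ∈ Finset.Icc 1 M, x n ^ k / (∏ i ∈ (Finset.Icc 1 M).erase n, (x n - x i)) = 0 :=
    fun k hk => sum_pow_div_prod_sub hx (by rw [hcard]; omega)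
  set Q : ℕ → ℝ := fun n => ∏ i ∈ (Finset.Icc 1 M).erase n, (x n - x i) with hQ
  set J : ℕ → ℕ → ℝ := fun n j => if j = 0 then Real.log (x n / x M)
    else (x n ^ j - x M ^ j) / j with hJ
  have hint : ∀ n ∈ Finset.Icc 1 M, ∫ y in x M..x n, (x n - y) ^ (M - 2) / y =
      ∑ j ∈ Finset.range (M - 2 + 1),
        ((M - 2).choose j : ℝ) * x n ^ (M - 2 - j) * (-1) ^ j * J n j := by
    intro n hn
    have h1 : (fun y : ℝ => (x n - y) ^ (M - 2) / y) = fun y =>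
        ∑ j ∈ Finset.range (M - 2 + 1),
          ((M - 2).choose j : ℝ) * x n ^ (M - 2 - j) * (-1) ^ j * (y ^ j / y) := by
      funext y
      rw [sub_eq_add_neg, add_comm, add_pow, Finset.sum_div]
      refine Finset.sum_congr rfl fun j _ => ?_
      rw [neg_pow y j]; ring
    rw [h1, intervalIntegral.integral_finsetSum]
    · refine Finset.sum_congr rfl fun j _ => ?_
      rw [intervalIntegral.integral_const_mul, integral_pow_div hxM (hpos n hn)]
    · exact fun j _ => (intervalIntegrable_div_id hxM (hpos n hn) (continuous_pow _)).const_mul _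
  rw [Finset.sum_congr rfl fun n hn => by rw [hint n hn, Finset.sum_div], Finset.sum_comm,
    Finset.sum_eq_single 0]
  · have h2 : ∀ n ∈ Finset.Icc 1 M, ((M - 2).choose 0 : ℝ) * x n ^ (M - 2 - 0) * (-1) ^ 0 * J n 0 /
        Q n = x n ^ (M - 2) / Q n * Real.log (x n) - x n ^ (M - 2) / Q n * Real.log (x M) := by
      intro n hn
      simp only [hJ, if_true, Real.log_div (hpos n hn).ne' hxM.ne']
      simp only [Nat.choose_zero_right, Nat.cast_one, Nat.sub_zero, pow_zero]
      ring
    rw [Finset.sum_congr rfl h2, Finset.sum_sub_distrib, ← Finset.sum_mul _ _ (Real.log (x M)),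
      hzero _ le_rfl, zero_mul, sub_zero]
  · intro j hj hj0
    have hj' : j ≤ M - 2 := by have := Finset.mem_range.1 hj; omega
    have h3 : ∀ n ∈ Finset.Icc 1 M, ((M - 2).choose j : ℝ) * x n ^ (M - 2 - j) * (-1) ^ j * J n j /
        Q n = ((M - 2).choose j : ℝ) * (-1) ^ j / j * (x n ^ (M - 2) / Q n) -
          ((M - 2).choose j : ℝ) * (-1) ^ j / j * x M ^ j * (x n ^ (M - 2 - j) / Q n) := by
      intro n _
      have h4 : x n ^ (M - 2) = x n ^ (M - 2 - j) * x n ^ j := by rw [← pow_add]; congr 1; omega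
      simp only [hJ, if_neg hj0, h4]
      ring
    rw [Finset.sum_congr rfl h3, Finset.sum_sub_distrib, ← Finset.mul_sum, ← Finset.mul_sum,
      hzero _ le_rfl, hzero _ (Nat.sub_le _ _)]
    ring
  · intro h; simp at h

/-- By `coeffA_eq_integral` and `sum_sum_deriv_eq`, the `m`-th term is an integral from `x (m + 1)`
to `x m` of a sum over `n ≤ m` whose summands no longer involve `m`. For fixed `n` the intervals
with `n ≤ m < M` join into one from `x M` to `x n`, and `sum_integral_div` identifies the result
with the value in `integral_prod_inv_one_add`. -/
theorem gain_eq (N : ℕ) {M : ℕ} (hM : 2 ≤ M) {x : ℕ → ℝ} (hx : Set.InjOn x (Finset.Icc 1 M))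
    (hpos : ∀ i ∈ Finset.Icc 1 M, 0 < x i) :
    gain N M x = ((N : ℝ) - M + 1) * (((M : ℝ) - 1) *
      ∫ s in Set.Ioi (0 : ℝ), ∏ i ∈ Finset.Icc 1 M, (1 + s * x i)⁻¹) := by
  have hcard : (Finset.Icc 1 M).card = M := by simp
  rw [(integral_prod_inv_one_add hx hpos (by rw [hcard]; exact hM)).2, hcard,
    ← sum_integral_div hM hx hpos]
  set Q : ℕ → ℝ := fun n => ∏ i ∈ (Finset.Icc 1 M).erase n, (x n - x i) with hQ
  have hp : ∀ m, 1 ≤ m → m ≤ M → 0 < x m := fun m h1 h2 => hpos m (Finset.mem_Icc.2 ⟨h1, h2⟩)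
  have step : ∀ m ∈ Finset.Icc 1 (M - 1), ∑ n ∈ Finset.Icc 1 m, ∑ t ∈ Finset.Icc (m + 1) M,
      ((N : ℝ) - M + 1) * coeffA M x m n t /
      ((x n - x t) * (∏ i ∈ (Finset.Icc 1 m).erase n, (x n - x i)) *
        ∏ j ∈ (Finset.Icc (m + 1) M).erase t, (x j - x t)) =
      ∑ n ∈ Finset.Icc 1 m, ((N : ℝ) - M + 1) * (((M : ℝ) - 1) *
        ((∫ y in x (m + 1)..x m, (x n - y) ^ (M - 2) / y) / Q n)) := by
    intro m hm
    have hm' := Finset.mem_Icc.1 hm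
    have hmM : m + 1 ≤ M := by omega
    have h1 := hp (m + 1) (by omega) hmM
    have h2 := hp m hm'.1 (by omega)
    have hcont : ∀ n t : ℕ, Continuous fun y : ℝ =>
        (m * (x n - y) ^ (m - 1) * (y - x t) ^ (M - m - 1) -
        (x n - y) ^ m * ((M - m - 1 : ℕ) * (y - x t) ^ (M - m - 1 - 1))) := by
      intro n t; fun_prop
    have e1 : ∀ n ∈ Finset.Icc 1 m, ∀ t ∈ Finset.Icc (m + 1) M, coeffA M x m n t =
        ∫ y in x (m + 1)..x m, (m * (x n - y) ^ (m - 1) * (y - x t) ^ (M - m - 1) -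
        (x n - y) ^ m * ((M - m - 1 : ℕ) * (y - x t) ^ (M - m - 1 - 1))) / y := by
      intro n hn t ht
      have hn' := Finset.mem_Icc.1 hn
      have ht' := Finset.mem_Icc.1 ht
      exact coeffA_eq_integral hm'.1 hmM (hp n hn'.1 (by omega)).ne'
        (hp t (by omega) ht'.2).ne' h1 h2
    set D : ℕ → ℕ → ℝ := fun n t => (x n - x t) * (∏ i ∈ (Finset.Icc 1 m).erase n, (x n - x i)) *
        ∏ j ∈ (Finset.Icc (m + 1) M).erase t, (x j - x t) with hD
    set f : ℕ → ℕ → ℝ → ℝ := fun n t y => (m * (x n - y) ^ (m - 1) * (y - x t) ^ (M - m - 1) -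
        (x n - y) ^ m * ((M - m - 1 : ℕ) * (y - x t) ^ (M - m - 1 - 1))) with hf
    have hint : ∀ n t, IntervalIntegrable (fun y => f n t y / y / D n t) volume (x (m + 1)) (x m) :=
      fun n t => (intervalIntegrable_div_id h1 h2 (hcont n t)).div_const _
    have e2 : ∑ n ∈ Finset.Icc 1 m, ∑ t ∈ Finset.Icc (m + 1) M, coeffA M x m n t / D n t =
        ∑ n ∈ Finset.Icc 1 m, ((M : ℝ) - 1) *
          ((∫ y in x (m + 1)..x m, (x n - y) ^ (M - 2) / y) / Q n) := by
      calc ∑ n ∈ Finset.Icc 1 m, ∑ t ∈ Finset.Icc (m + 1) M, coeffA M x m n t / D n t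
          = ∑ n ∈ Finset.Icc 1 m, ∑ t ∈ Finset.Icc (m + 1) M,
              ∫ y in x (m + 1)..x m, f n t y / y / D n t :=
            Finset.sum_congr rfl fun n hn => Finset.sum_congr rfl fun t ht => by
              rw [e1 n hn t ht, intervalIntegral.integral_div]
        _ = ∫ y in x (m + 1)..x m, ∑ n ∈ Finset.Icc 1 m, ∑ t ∈ Finset.Icc (m + 1) M,
              f n t y / y / D n t := by
            rw [intervalIntegral.integral_finsetSum]
            · refine Finset.sum_congr rfl fun n _ => ?_
              rw [intervalIntegral.integral_finsetSum]
              exact fun t _ => hint n t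
            · intro n _
              have : (fun y : ℝ => ∑ t ∈ Finset.Icc (m + 1) M, f n t y / y / D n t) =
                  ∑ t ∈ Finset.Icc (m + 1) M, fun y : ℝ => f n t y / y / D n t := by
                funext y; simp
              rw [this]
              exact IntervalIntegrable.sum _ fun t _ => hint n t
        _ = ∫ y in x (m + 1)..x m, ∑ n ∈ Finset.Icc 1 m,
              ((M : ℝ) - 1) / Q n * ((x n - y) ^ (M - 2) / y) := by
            congr 1
            funext y
            have h3 := sum_sum_deriv_eq hmM hx y
            have h4 : ∑ n ∈ Finset.Icc 1 m, ∑ t ∈ Finset.Icc (m + 1) M, f n t y / y / D n t =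
                (∑ n ∈ Finset.Icc 1 m, ∑ t ∈ Finset.Icc (m + 1) M, f n t y / D n t) / y := by
              rw [Finset.sum_div]
              refine Finset.sum_congr rfl fun n _ => ?_
              rw [Finset.sum_div]
              exact Finset.sum_congr rfl fun t _ => div_right_comm _ _ _
            rw [h4, h3, Finset.sum_div]
            refine Finset.sum_congr rfl fun n _ => ?_
            have h5 : ((M - 1 : ℕ) : ℝ) = (M : ℝ) - 1 := by
              rw [Nat.cast_sub (by omega)]; simp
            have h6 : M - 1 - 1 = M - 2 := by omega
            rw [h5, h6]
            ring
        _ = _ := by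
            rw [intervalIntegral.integral_finsetSum]
            · refine Finset.sum_congr rfl fun n _ => ?_
              rw [intervalIntegral.integral_const_mul]
              ring
            · exact fun n _ => (intervalIntegrable_div_id h1 h2 (by fun_prop)).const_mul _
    rw [← Finset.mul_sum, ← e2, Finset.mul_sum]
    refine Finset.sum_congr rfl fun n _ => ?_
    rw [Finset.mul_sum]
    exact Finset.sum_congr rfl fun t _ => mul_div_assoc _ _ _
  unfold gain
  rw [Finset.sum_congr rfl step]
  have swap : ∑ m ∈ Finset.Icc 1 (M - 1), ∑ n ∈ Finset.Icc 1 m,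
      (∫ y in x (m + 1)..x m, (x n - y) ^ (M - 2) / y) / Q n =
      ∑ n ∈ Finset.Icc 1 M, (∫ y in x M..x n, (x n - y) ^ (M - 2) / y) / Q n := by
    -- The added index `n = M` has an empty inner range, in agreement with the integral from `x M`
    -- to itself.
    rw [Finset.sum_comm' (t' := Finset.Icc 1 M) (s' := fun n => Finset.Ico n M)]
    · refine Finset.sum_congr rfl fun n hn => ?_
      have hn' := Finset.mem_Icc.1 hn
      rw [← Finset.sum_div]
      congr 1
      have h7 := intervalIntegral.sum_integral_adjacent_intervals_Ico (μ := volume)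
        (f := fun y : ℝ => (x n - y) ^ (M - 2) / y) (a := x) hn'.2 (fun k hk => by
          have hk' := Set.mem_Ico.1 hk
          exact intervalIntegrable_div_id (hp k (by omega) (by omega))
            (hp (k + 1) (by omega) (by omega)) (by fun_prop))
      rw [intervalIntegral.integral_symm, ← h7, ← Finset.sum_neg_distrib]
      exact Finset.sum_congr rfl fun k _ => intervalIntegral.integral_symm _ _
    · intro m n
      simp only [Finset.mem_Icc, Finset.mem_Ico]
      omega
  simp_rw [← Finset.mul_sum]
  rw [swap]

end ZFC
end

/-! ### Mean of an inverse quadratic form on the sphere. -/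

noncomputable section
open scoped ENNReal
namespace ZFC

theorem lintegral_stdComplexGaussian_exp {c : ℝ} (hc : 0 ≤ c) :
    ∫⁻ z, ENNReal.ofReal (Real.exp (-(c * ‖z‖ ^ 2))) ∂stdComplexGaussian =
      ENNReal.ofReal (1 + c)⁻¹ := by
  have hc1 : 0 < 1 + c := by linarith
  rw [stdComplexGaussian_eq, lintegral_withDensity_eq_lintegral_mul _ measurable_cgDensity
    (by fun_prop)]
  have h1 : ∀ z : ℂ, (cgDensity * fun z : ℂ => ENNReal.ofReal (Real.exp (-(c * ‖z‖ ^ 2)))) z =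
      ENNReal.ofReal (Real.pi⁻¹ * Real.exp (-(1 + c) * ‖z‖ ^ (2 : ℝ))) := by
    intro z
    simp only [Pi.mul_apply, cgDensity]
    rw [← ENNReal.ofReal_mul (by positivity), mul_assoc, ← Real.exp_add, Real.rpow_two]
    congr 3; ring
  simp_rw [h1]
  have h2 := Complex.integral_exp_neg_mul_rpow (p := 2) (by norm_num) hc1
  have hpi := Real.pi_pos
  have h3 : ∫ z : ℂ, Real.pi⁻¹ * Real.exp (-(1 + c) * ‖z‖ ^ (2 : ℝ)) = (1 + c)⁻¹ := by
    rw [integral_const_mul, h2]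
    have : (2 / 2 + 1 : ℝ) = 2 := by norm_num
    rw [this, Real.Gamma_two]
    have : (-2 / 2 : ℝ) = -1 := by norm_num
    rw [this, Real.rpow_neg_one]
    field_simp
  have h4 : Integrable fun z : ℂ => Real.pi⁻¹ * Real.exp (-(1 + c) * ‖z‖ ^ (2 : ℝ)) := by
    by_contra h
    rw [integral_undef h] at h3
    have := inv_pos.2 hc1
    linarith
  rw [← ofReal_integral_eq_lintegral_ofReal h4 (Eventually.of_forall fun z => by positivity), h3]

theorem lintegral_cgPi_exp {k : ℕ} {x : Fin k → ℝ} (hx : ∀ i, 0 ≤ x i) :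
    ∫⁻ g, ENNReal.ofReal (Real.exp (-∑ i, x i * ‖g i‖ ^ 2)) ∂cgPi k =
      ENNReal.ofReal (∏ i, (1 + x i)⁻¹) := by
  have hm : ∀ i, Measurable fun z : ℂ => ENNReal.ofReal (Real.exp (-(x i * ‖z‖ ^ 2))) := by
    intro i; fun_prop
  have h1 : ∀ g : Fin k → ℂ, ENNReal.ofReal (Real.exp (-∑ i, x i * ‖g i‖ ^ 2)) =
      ∏ i, ENNReal.ofReal (Real.exp (-(x i * ‖g i‖ ^ 2))) := by
    intro g
    rw [← Finset.sum_neg_distrib, Real.exp_sum, ENNReal.ofReal_prod_of_nonneg]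
    exact fun i _ => (Real.exp_pos _).le
  simp_rw [h1]
  have hind : iIndepFun (fun i (g : Fin k → ℂ) => ENNReal.ofReal (Real.exp (-(x i * ‖g i‖ ^ 2))))
      (cgPi k) :=
    iIndepFun_pi (X := fun i z => ENNReal.ofReal (Real.exp (-(x i * ‖z‖ ^ 2))))
      fun i => (hm i).aemeasurable
  rw [lintegral_prod_eq_prod_lintegral_of_indepFun _ _ hind
    fun i => (hm i).comp (measurable_pi_apply i)]
  rw [ENNReal.ofReal_prod_of_nonneg fun i _ => inv_nonneg.2 (by linarith [hx i])]
  refine Finset.prod_congr rfl fun i _ => ?_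
  rw [← lintegral_stdComplexGaussian_exp (hx i)]
  exact (measurePreserving_eval (fun _ : Fin k => stdComplexGaussian) i).lintegral_comp (hm i)

theorem lintegral_exp_neg_mul_Ioi {r : ℝ} (hr : 0 < r) :
    ∫⁻ s in Set.Ioi (0 : ℝ), ENNReal.ofReal (Real.exp (-(s * r))) = ENNReal.ofReal r⁻¹ := by
  have h1 : ∀ s : ℝ, -(s * r) = (-r) * s := fun s => by ring
  simp_rw [h1]
  rw [← ofReal_integral_eq_lintegral_ofReal (integrableOn_exp_mul_Ioi (by linarith) 0)
    (Eventually.of_forall fun s => (Real.exp_pos _).le), integral_exp_mul_Ioi (by linarith)]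
  congr 1
  simp [neg_div_neg_eq]

/-- Writing `1 / r = ∫₀^∞ exp(-s r) ds` replaces the mean of an inverse by an integral of the
Laplace transform, which factorizes over independent coordinates. -/
theorem lintegral_cgPi_inv {k : ℕ} (hk : k ≠ 0) {x : Fin k → ℝ} (hx : ∀ i, 0 < x i) :
    ∫⁻ g, ENNReal.ofReal (∑ i, x i * ‖g i‖ ^ 2)⁻¹ ∂cgPi k =
      ∫⁻ s in Set.Ioi (0 : ℝ), ENNReal.ofReal (∏ i, (1 + s * x i)⁻¹) := by
  have h0 : ∀ᵐ g ∂cgPi k, nsq g ≠ 0 := by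
    rw [ae_iff]; simpa using cgPi_nsq_eq hk 0
  have h1 : ∀ᵐ g ∂cgPi k, ENNReal.ofReal (∑ i, x i * ‖g i‖ ^ 2)⁻¹ =
      ∫⁻ s in Set.Ioi (0 : ℝ), ENNReal.ofReal (Real.exp (-∑ i, s * x i * ‖g i‖ ^ 2)) := by
    filter_upwards [h0] with g hg
    have hpos : 0 < ∑ i, x i * ‖g i‖ ^ 2 := by
      obtain ⟨i, _, hi⟩ := Finset.exists_ne_zero_of_sum_ne_zero hg
      refine Finset.sum_pos' (fun i _ => mul_nonneg (hx i).le (by positivity))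
        ⟨i, Finset.mem_univ i, ?_⟩
      exact mul_pos (hx i) (lt_of_le_of_ne (by positivity) (Ne.symm hi))
    rw [← lintegral_exp_neg_mul_Ioi hpos]
    simp_rw [Finset.mul_sum, mul_assoc]
  rw [lintegral_congr_ae h1, lintegral_lintegral_swap]
  · refine setLIntegral_congr_fun measurableSet_Ioi fun s hs => ?_
    exact lintegral_cgPi_exp fun i => (mul_pos hs (hx i)).le
  · fun_prop

/-- Average of the inverse of a diagonal quadratic form over the unit sphere. -/
theorem lintegral_sphereLaw_inv {k : ℕ} (hk : 2 ≤ k) {x : Fin k → ℝ} (hx : ∀ i, 0 < x i) :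
    ∫⁻ b, ENNReal.ofReal (∑ i, x i * ‖b i‖ ^ 2)⁻¹ ∂sphereLaw k =
      ENNReal.ofReal ((k : ℝ) - 1) *
        ∫⁻ s in Set.Ioi (0 : ℝ), ENNReal.ofReal (∏ i, (1 + s * x i)⁻¹) := by
  have hk0 : k ≠ 0 := by omega
  have hk1 : (0 : ℝ) < (k : ℝ) - 1 := by
    have : (2 : ℝ) ≤ k := by exact_mod_cast hk
    linarith
  rw [← lintegral_cgPi_inv hk0 hx]
  set ρ : EuclideanSpace ℂ (Fin k) → ℝ := fun b => ∑ i, x i * ‖b i‖ ^ 2 with hρ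
  have hρm : Measurable fun b : EuclideanSpace ℂ (Fin k) => ENNReal.ofReal (ρ b)⁻¹ := by
    have : Continuous ρ := by rw [hρ]; fun_prop
    exact this.measurable.inv.ennreal_ofReal
  have h1 : ∫⁻ g, ENNReal.ofReal (∑ i, x i * ‖g i‖ ^ 2)⁻¹ ∂cgPi k =
      ∫⁻ g, ENNReal.ofReal (ρ g)⁻¹ ∂gaussVec k := by
    rw [gaussVec, lintegral_map hρm (by fun_prop)]
  have hnz : ∀ᵐ v ∂gaussVec k, v ≠ 0 := by
    rw [ae_iff]; simpa using gaussVec_zero hk0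
  let F : EuclideanSpace ℂ (Fin k) → ℝ × EuclideanSpace ℂ (Fin k) := fun g => (‖g‖, g)
  have hF : Measurable F := measurable_norm.prodMk measurable_id
  have hprod := map_dir_eq_prod hk0 ((gaussVec k).map F) (by
    intro U
    rw [Measure.map_map (measurable_id.prodMap U.continuous.measurable) hF]
    have : Prod.map id U ∘ F = F ∘ U := by
      funext g; simp [F]
    rw [this, ← Measure.map_map hF U.continuous.measurable, gaussVec_map]) (by
    exact (ae_map_iff (p := fun p => p.2 ≠ 0) hF.aemeasurable
      (measurable_snd (measurableSet_singleton 0).compl)).2 hnz)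
  -- Norm and direction of a Gaussian vector are independent, so the Gaussian mean is the spherical
  -- mean times `E ‖g‖⁻² = 1 / (k - 1)`; finiteness of the latter is where `k ≥ 2` enters.
  have h2 : ∫⁻ g, ENNReal.ofReal (ρ g)⁻¹ ∂gaussVec k =
      (∫⁻ b, ENNReal.ofReal (ρ b)⁻¹ ∂sphereLaw k) *
        ∫⁻ g, ENNReal.ofReal (‖g‖ ^ 2)⁻¹ ∂gaussVec k := by
    have hm2 : Measurable fun p : ℝ × EuclideanSpace ℂ (Fin k) =>
        ENNReal.ofReal (p.1 ^ 2)⁻¹ * ENNReal.ofReal (ρ p.2)⁻¹ :=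
      Measurable.mul (by fun_prop) (hρm.comp measurable_snd)
    calc ∫⁻ g, ENNReal.ofReal (ρ g)⁻¹ ∂gaussVec k
        = ∫⁻ g, ENNReal.ofReal (‖g‖ ^ 2)⁻¹ * ENNReal.ofReal (ρ (dir g))⁻¹ ∂gaussVec k := by
          refine lintegral_congr_ae ?_
          filter_upwards [hnz] with g hg
          rw [← ENNReal.ofReal_mul (by positivity), ← mul_inv]
          congr 2
          have hg' : ‖g‖ ≠ 0 := norm_ne_zero_iff.2 hg
          simp only [hρ, dir, PiLp.smul_apply, norm_inv, Complex.norm_real,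
            norm_norm, Finset.mul_sum, smul_eq_mul, norm_mul]
          refine Finset.sum_congr rfl fun i _ => ?_
          field_simp
      _ = ∫⁻ p, ENNReal.ofReal (p.1 ^ 2)⁻¹ * ENNReal.ofReal (ρ p.2)⁻¹
            ∂(((gaussVec k).map F).map (Prod.map id dir)) := by
          rw [lintegral_map hm2 (measurable_id.prodMap measurable_dir)]
          exact (lintegral_map (hm2.comp (measurable_id.prodMap measurable_dir)) hF).symm
      _ = _ := by
          rw [hprod, lintegral_prod_mul (f := fun r : ℝ => ENNReal.ofReal (r ^ 2)⁻¹)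
            (g := fun b => ENNReal.ofReal (ρ b)⁻¹) (by fun_prop) hρm.aemeasurable, mul_comm]
          congr 1
          rw [Measure.map_map measurable_fst hF, lintegral_map (by fun_prop)
            (measurable_fst.comp hF)]
          rfl
  have h3 : ∫⁻ g, ENNReal.ofReal (‖g‖ ^ 2)⁻¹ ∂gaussVec k = ENNReal.ofReal ((k : ℝ) - 1)⁻¹ := by
    rw [gaussVec, lintegral_map (by fun_prop) (by fun_prop)]
    simp only [norm_sq_toLp]
    have e1 := integral_nsq_rpow hk0 (s := -1) (by linarith)
    have e2 := integrable_nsq_rpow hk0 (s := -1) (by linarith)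
    simp only [Real.rpow_neg_one] at e1 e2
    have e3 : Real.Gamma (k : ℝ) = ((k : ℝ) - 1) * Real.Gamma ((k : ℝ) + -1) := by
      have := Real.Gamma_add_one hk1.ne'
      rw [sub_add_cancel] at this
      exact this
    rw [← ofReal_integral_eq_lintegral_ofReal e2
      (Eventually.of_forall fun g => inv_nonneg.2 (nsq_nonneg g)), e1, e3]
    have : Real.Gamma ((k : ℝ) + -1) ≠ 0 := (Real.Gamma_pos_of_pos (by linarith)).ne'
    congr 1
    field_simp
  rw [h1, h2, h3, mul_left_comm, ← ENNReal.ofReal_mul hk1.le, mul_inv_cancel₀ hk1.ne']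
  simp [hρ]

end ZFC
end

/-! ### Matrices on Euclidean space, projection to the row space, rotations of the channel. -/

noncomputable section
open scoped ENNReal
namespace ZFC

/-- A matrix acting on Euclidean space. -/
def mulE {m n : ℕ} (A : Matrix (Fin m) (Fin n) ℂ) (v : EuclideanSpace ℂ (Fin n)) :
    EuclideanSpace ℂ (Fin m) :=
  WithLp.toLp 2 (A *ᵥ v.ofLp)

theorem mulE_mulE {l m n : ℕ} (A : Matrix (Fin l) (Fin m) ℂ) (B : Matrix (Fin m) (Fin n) ℂ)
    (v : EuclideanSpace ℂ (Fin n)) : mulE A (mulE B v) = mulE (A * B) v := by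
  simp [mulE, Matrix.mulVec_mulVec]

theorem mulE_one {n : ℕ} (v : EuclideanSpace ℂ (Fin n)) : mulE 1 v = v := by
  simp [mulE]

theorem mulE_smul {m n : ℕ} (A : Matrix (Fin m) (Fin n) ℂ) (c : ℂ)
    (v : EuclideanSpace ℂ (Fin n)) : mulE A (c • v) = c • mulE A v := by
  simp [mulE, Matrix.mulVec_smul]

theorem mulE_sub {m n : ℕ} (A : Matrix (Fin m) (Fin n) ℂ) (v w : EuclideanSpace ℂ (Fin n)) :
    mulE A (v - w) = mulE A v - mulE A w := by
  simp [mulE, Matrix.mulVec_sub]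

theorem mulE_add {m n : ℕ} (A : Matrix (Fin m) (Fin n) ℂ) (v w : EuclideanSpace ℂ (Fin n)) :
    mulE A (v + w) = mulE A v + mulE A w := by
  simp [mulE, Matrix.mulVec_add]

theorem mulE_zero {m n : ℕ} (A : Matrix (Fin m) (Fin n) ℂ) : mulE A 0 = 0 := by
  simp [mulE]

theorem inner_mulE_left {m n : ℕ} (A : Matrix (Fin m) (Fin n) ℂ) (c : EuclideanSpace ℂ (Fin m))
    (u : EuclideanSpace ℂ (Fin n)) : inner ℂ (mulE Aᴴ c) u = inner ℂ c (mulE A u) := by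
  simp only [mulE, EuclideanSpace.inner_eq_star_dotProduct]
  rw [Matrix.star_mulVec, Matrix.conjTranspose_conjTranspose, dotProduct_comm,
    ← Matrix.dotProduct_mulVec, dotProduct_comm]

theorem effChannel_eq {M N : ℕ} (H : Matrix (Fin M) (Fin N) ℂ) (c : EuclideanSpace ℂ (Fin M)) :
    effChannel H c = mulE Hᴴ c := rfl

theorem continuous_mulE {m n : ℕ} (A : Matrix (Fin m) (Fin n) ℂ) : Continuous (mulE A) :=
  (PiLp.continuous_toLp 2 _).comp
    (Continuous.matrix_mulVec continuous_const (PiLp.continuous_ofLp 2 _))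

theorem measurable_mulE {α : Type*} [MeasurableSpace α] {m n : ℕ}
    {A : α → Matrix (Fin m) (Fin n) ℂ} {v : α → EuclideanSpace ℂ (Fin n)}
    (hA : ∀ i j, Measurable fun a => A a i j) (hv : Measurable v) :
    Measurable fun a => mulE (A a) (v a) := by
  refine (WithLp.measurable_toLp 2 _).comp (measurable_pi_lambda _ fun i => ?_)
  change Measurable fun a => ∑ j, A a i j * (v a).ofLp j
  refine Finset.measurable_sum _ fun j _ => (hA i j).mul ?_
  exact (measurable_pi_apply j).comp ((WithLp.measurable_ofLp 2 _).comp hv)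

theorem norm_mulE_unitary {n : ℕ} {A : Matrix (Fin n) (Fin n) ℂ} (hA : Aᴴ * A = 1)
    (v : EuclideanSpace ℂ (Fin n)) : ‖mulE A v‖ = ‖v‖ := by
  have h : inner ℂ (mulE A v) (mulE A v) = inner ℂ v v := by
    have := inner_mulE_left Aᴴ v (mulE A v)
    rw [Matrix.conjTranspose_conjTranspose, mulE_mulE, hA, mulE_one] at this
    exact this
  rw [inner_self_eq_norm_sq_to_K, inner_self_eq_norm_sq_to_K] at h
  have h' : ‖mulE A v‖ ^ 2 = ‖v‖ ^ 2 := by exact_mod_cast h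
  exact (sq_eq_sq₀ (norm_nonneg _) (norm_nonneg _)).1 h'

theorem mulE_injective {m n : ℕ} {A B : Matrix (Fin m) (Fin n) ℂ}
    (h : ∀ v, mulE A v = mulE B v) : A = B := by
  refine Matrix.ext_of_mulVec_single fun i => ?_
  have := congrArg WithLp.ofLp (h (WithLp.toLp 2 (Pi.single i 1)))
  exact this

theorem exists_matrix_unitary {n : ℕ} (U : EuclideanSpace ℂ (Fin n) ≃ₗᵢ[ℂ] EuclideanSpace ℂ (Fin n)) :
    ∃ A : Matrix (Fin n) (Fin n) ℂ, Aᴴ * A = 1 ∧ A * Aᴴ = 1 ∧ ∀ v, U v = mulE A v := by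
  obtain ⟨A, hA⟩ : ∃ A : Matrix (Fin n) (Fin n) ℂ, ∀ v, U v = mulE A v :=
    ⟨Matrix.toEuclideanLin.symm U.toLinearEquiv.toLinearMap, fun v => by
      have := congrArg (fun f => f v)
        (Matrix.toEuclideanLin.apply_symm_apply U.toLinearEquiv.toLinearMap)
      exact this.symm⟩
  have h : Aᴴ * A = 1 := by
    refine mulE_injective fun v => ?_
    rw [← mulE_mulE, mulE_one]
    refine ext_inner_right ℂ fun w => ?_
    rw [inner_mulE_left, ← hA, ← hA, U.inner_map_map]
  exact ⟨A, h, mul_eq_one_comm.1 h, hA⟩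

/-- Gram matrix of the rows. -/
def rowGram {M N : ℕ} (X : Fin M → Fin N → ℂ) : Matrix (Fin M) (Fin M) ℂ :=
  Matrix.of X * (Matrix.of X)ᴴ

/-- Coefficients of the orthogonal projection of `u` to the row space. -/
def coef {M N : ℕ} (X : Fin M → Fin N → ℂ) (u : EuclideanSpace ℂ (Fin N)) :
    EuclideanSpace ℂ (Fin M) :=
  mulE ((rowGram X)⁻¹ * Matrix.of X) u

/-- Orthogonal projection to the row space. -/
def proj {M N : ℕ} (X : Fin M → Fin N → ℂ) (u : EuclideanSpace ℂ (Fin N)) :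
    EuclideanSpace ℂ (Fin N) :=
  mulE (Matrix.of X)ᴴ (coef X u)

/-- The inverse is the adjugate times the inverted determinant, so it is measurable everywhere,
including at singular matrices, where it is zero by convention. -/
theorem measurable_rowGram_inv {M N : ℕ} (i j : Fin M) :
    Measurable fun X : Fin M → Fin N → ℂ => (rowGram X)⁻¹ i j := by
  have hc : Continuous fun X : Fin M → Fin N → ℂ => rowGram X := by
    unfold rowGram
    have : Continuous fun X : Fin M → Fin N → ℂ => Matrix.of X := continuous_id
    exact this.matrix_mul this.matrix_conjTranspose
  simp only [Matrix.inv_def, Ring.inverse_eq_inv', Matrix.smul_apply, smul_eq_mul]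
  refine Measurable.mul ?_ ?_
  · exact (hc.matrix_det).measurable.inv
  · exact ((continuous_apply_apply i j).comp hc.matrix_adjugate).measurable

theorem measurable_coef {M N : ℕ} :
    Measurable fun p : (Fin M → Fin N → ℂ) × EuclideanSpace ℂ (Fin N) => coef p.1 p.2 := by
  unfold coef
  refine measurable_mulE (fun i j => ?_) measurable_snd
  simp only [Matrix.mul_apply, Matrix.of_apply]
  refine Finset.measurable_sum _ fun k _ => Measurable.mul ?_ ?_
  · exact (measurable_rowGram_inv i k).comp measurable_fst
  · fun_prop

theorem measurable_proj {M N : ℕ} :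
    Measurable fun p : (Fin M → Fin N → ℂ) × EuclideanSpace ℂ (Fin N) => proj p.1 p.2 := by
  unfold proj
  refine measurable_mulE (fun i j => ?_) measurable_coef
  simp only [Matrix.conjTranspose_apply, Matrix.of_apply]
  fun_prop

section FullRank

variable {M N : ℕ} {X : Fin M → Fin N → ℂ}

theorem rowGram_mulE_coef (hX : (rowGram X).PosDef) (u : EuclideanSpace ℂ (Fin N)) :
    mulE (rowGram X) (coef X u) = mulE (Matrix.of X) u := by
  rw [coef, mulE_mulE, ← Matrix.mul_assoc, Matrix.mul_nonsing_inv _ ((Matrix.isUnit_iff_isUnit_det _).1 hX.isUnit), Matrix.one_mul]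

theorem mulE_proj (hX : (rowGram X).PosDef) (u : EuclideanSpace ℂ (Fin N)) :
    mulE (Matrix.of X) (proj X u) = mulE (Matrix.of X) u := by
  rw [proj, mulE_mulE]
  exact rowGram_mulE_coef hX u

theorem inner_mulE_proj (hX : (rowGram X).PosDef) (c : EuclideanSpace ℂ (Fin M))
    (u : EuclideanSpace ℂ (Fin N)) :
    inner ℂ (mulE (Matrix.of X)ᴴ c) (proj X u) = inner ℂ (mulE (Matrix.of X)ᴴ c) u := by
  rw [inner_mulE_left, inner_mulE_left, mulE_proj hX]

theorem inner_proj_self (hX : (rowGram X).PosDef) (u : EuclideanSpace ℂ (Fin N)) :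
    inner ℂ (proj X u) u = (‖proj X u‖ ^ 2 : ℂ) := by
  rw [proj, ← inner_mulE_proj hX, ← proj, inner_self_eq_norm_sq_to_K]
  rfl

/-- Isometric parametrization of the row space. -/
theorem exists_isometry_row (hX : (rowGram X).PosDef) :
    ∃ (Q : Matrix (Fin M) (Fin M) ℂ)
      (f : EuclideanSpace ℂ (Fin M) →ₗᵢ[ℂ] EuclideanSpace ℂ (Fin N)),
      IsUnit Q.det ∧ Qᴴ * Q = (rowGram X)⁻¹ ∧
      (∀ u, coef X u = mulE Q (LinearMap.adjoint f.toLinearMap u)) ∧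
      ∀ u, proj X u = f (LinearMap.adjoint f.toLinearMap u) := by
  -- With `G` the Gram matrix, the choice is `Q = G^{-1/2}` and `f = Xᴴ G^{-1/2}`, which
  -- orthonormalizes the rows.
  have hS := CFC.sqrt_mul_sqrt_self (rowGram X) hX.posSemidef.nonneg
  set S := CFC.sqrt (rowGram X) with hSdef
  have hSu : IsUnit S.det := by
    have := ((Matrix.isUnit_iff_isUnit_det _).1 hX.isUnit)
    rw [← hS, Matrix.det_mul] at this
    exact isUnit_of_mul_isUnit_left this
  have hSh : Sᴴ = S := (Matrix.nonneg_iff_posSemidef.1 (CFC.sqrt_nonneg (rowGram X))).isHermitian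
  have hQh : (S⁻¹)ᴴ = S⁻¹ := by rw [Matrix.conjTranspose_nonsing_inv, hSh]
  have hQQ : S⁻¹ * S⁻¹ = (rowGram X)⁻¹ := by rw [← hS, Matrix.mul_inv_rev]
  have hSQ : S * S⁻¹ = 1 := Matrix.mul_nonsing_inv _ hSu
  have hQS : S⁻¹ * S = 1 := Matrix.nonsing_inv_mul _ hSu
  have hnorm : ∀ c : EuclideanSpace ℂ (Fin M), ‖mulE ((Matrix.of X)ᴴ * S⁻¹) c‖ = ‖c‖ := by
    intro c
    have h : inner ℂ (mulE ((Matrix.of X)ᴴ * S⁻¹) c) (mulE ((Matrix.of X)ᴴ * S⁻¹) c) =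
        inner ℂ c c := by
      have e : (Matrix.of X)ᴴ * S⁻¹ = (S⁻¹ * Matrix.of X)ᴴ := by
        rw [Matrix.conjTranspose_mul, hQh]
      have e2 : S⁻¹ * Matrix.of X * (S⁻¹ * Matrix.of X)ᴴ = 1 := by
        rw [Matrix.conjTranspose_mul, hQh]
        calc S⁻¹ * Matrix.of X * ((Matrix.of X)ᴴ * S⁻¹) = S⁻¹ * (rowGram X) * S⁻¹ := by
              simp only [rowGram, Matrix.mul_assoc]
          _ = (S⁻¹ * S) * (S * S⁻¹) := by rw [← hS]; simp only [Matrix.mul_assoc]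
          _ = 1 := by rw [hSQ, hQS, Matrix.one_mul]
      rw [e, inner_mulE_left, mulE_mulE, e2, mulE_one]
    rw [inner_self_eq_norm_sq_to_K, inner_self_eq_norm_sq_to_K] at h
    have h' : ‖mulE ((Matrix.of X)ᴴ * S⁻¹) c‖ ^ 2 = ‖c‖ ^ 2 := by exact_mod_cast h
    exact (sq_eq_sq₀ (norm_nonneg _) (norm_nonneg _)).1 h'
  let f : EuclideanSpace ℂ (Fin M) →ₗᵢ[ℂ] EuclideanSpace ℂ (Fin N) :=
    { toFun := mulE ((Matrix.of X)ᴴ * S⁻¹)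
      map_add' := mulE_add _
      map_smul' := mulE_smul _
      norm_map' := hnorm }
  have hadj : ∀ u, LinearMap.adjoint f.toLinearMap u = mulE (S⁻¹ * Matrix.of X) u := by
    intro u
    refine ext_inner_left ℂ fun c => ?_
    rw [LinearMap.adjoint_inner_right, ← inner_mulE_left, Matrix.conjTranspose_mul, hQh]
    rfl
  have hcoef : ∀ u, coef X u = mulE S⁻¹ (LinearMap.adjoint f.toLinearMap u) := by
    intro u
    rw [hadj, mulE_mulE, ← Matrix.mul_assoc, hQQ]; rfl
  refine ⟨S⁻¹, f, ?_, by rw [hQh, hQQ], hcoef, fun u => ?_⟩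
  · exact (Matrix.isUnit_nonsing_inv_det_iff).2 hSu
  · rw [proj, hcoef, mulE_mulE]; rfl

theorem norm_proj_eq {f : EuclideanSpace ℂ (Fin M) →ₗᵢ[ℂ] EuclideanSpace ℂ (Fin N)}
    (h : ∀ u, proj X u = f (LinearMap.adjoint f.toLinearMap u)) (u : EuclideanSpace ℂ (Fin N)) :
    ‖proj X u‖ = ‖LinearMap.adjoint f.toLinearMap u‖ := by
  rw [h, f.norm_map]

theorem norm_proj_le (hX : (rowGram X).PosDef) (u : EuclideanSpace ℂ (Fin N)) :
    ‖proj X u‖ ≤ ‖u‖ := by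
  have h := inner_proj_self hX u
  have h2 : ‖proj X u‖ ^ 2 ≤ ‖proj X u‖ * ‖u‖ := by
    have := norm_inner_le_norm (𝕜 := ℂ) (proj X u) u
    rw [h] at this
    simpa using this
  by_contra! hlt
  have : 0 < ‖proj X u‖ := (norm_nonneg u).trans_lt hlt
  nlinarith

theorem proj_eq_zero_iff (hX : (rowGram X).PosDef) (u : EuclideanSpace ℂ (Fin N)) :
    coef X u = 0 ↔ proj X u = 0 := by
  refine ⟨fun h => by rw [proj, h, mulE_zero], fun h => ?_⟩
  have h1 := mulE_proj hX u
  rw [h, mulE_zero] at h1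
  rw [coef, ← mulE_mulE, ← h1, mulE_zero]

end FullRank

/-- The Gaussian matrix has full row rank almost surely. -/
theorem ae_rowGram_posDef {M N : ℕ} (hMN : M ≤ N) :
    ∀ᵐ X ∂gaussMatrix M N, (rowGram X).PosDef := by
  have h1 := ae_linearIndepOn (fun _ : Fin M => gaussVec N) (fun _ W hW => gaussVec_submodule W hW)
    Finset.univ (by simpa using hMN)
  have h2 : (Measure.pi fun _ : Fin M => gaussVec N) =
      (gaussMatrix M N).map fun X i => WithLp.toLp 2 (X i) := by
    unfold gaussVec gaussMatrix
    rw [Measure.pi_map_pi]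
    intro i
    exact (WithLp.measurable_toLp 2 _).aemeasurable
  rw [h2] at h1
  have h3 := ae_of_ae_map (Measurable.aemeasurable (measurable_pi_lambda _ fun i =>
    (WithLp.measurable_toLp 2 _).comp (measurable_pi_apply i))) h1
  filter_upwards [h3] with X hX
  refine Matrix.PosDef.mul_conjTranspose_self _ ?_
  rw [Matrix.vecMul_injective_iff]
  rw [Finset.coe_univ, linearIndepOn_univ_iff] at hX
  exact hX.map' (WithLp.linearEquiv 2 ℂ (Fin N → ℂ)).toLinearMap (LinearEquiv.ker _)

/-- Right rotation of a channel matrix. -/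
def rotR {M N : ℕ} (A : Matrix (Fin N) (Fin N) ℂ) (X : Fin M → Fin N → ℂ) : Fin M → Fin N → ℂ :=
  Matrix.of X * Aᴴ

/-- Left rotation of a channel matrix. -/
def rotL {M N : ℕ} (A : Matrix (Fin M) (Fin M) ℂ) (X : Fin M → Fin N → ℂ) : Fin M → Fin N → ℂ :=
  A * Matrix.of X

theorem sum_norm_sq_eq_trace {M N : ℕ} (A : Matrix (Fin M) (Fin N) ℂ) :
    ((∑ i, ∑ j, ‖A i j‖ ^ 2 : ℝ) : ℂ) = (A * Aᴴ).trace := by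
  simp only [Matrix.trace, Matrix.diag, Matrix.mul_apply, Matrix.conjTranspose_apply]
  push_cast
  refine Finset.sum_congr rfl fun i _ => Finset.sum_congr rfl fun j _ => ?_
  exact (Complex.mul_conj' _).symm

theorem gaussMatrix_rotR {M N : ℕ} {A : Matrix (Fin N) (Fin N) ℂ} (hA : Aᴴ * A = 1) :
    (gaussMatrix M N).map (rotR A) = gaussMatrix M N := by
  let T : (Fin M → Fin N → ℂ) →ₗ[ℂ] Fin M → Fin N → ℂ :=
    { toFun := rotR A
      map_add' := fun X Y => Matrix.add_mul (Matrix.of X) (Matrix.of Y) Aᴴ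
      map_smul' := fun c X => Matrix.smul_mul c (Matrix.of X) Aᴴ }
  refine gaussMatrix_map T fun X => ?_
  have h1 := sum_norm_sq_eq_trace (Matrix.of X * Aᴴ)
  have h2 := sum_norm_sq_eq_trace (Matrix.of X)
  rw [Matrix.conjTranspose_mul, Matrix.conjTranspose_conjTranspose, Matrix.mul_assoc, ← Matrix.mul_assoc Aᴴ,
    hA, Matrix.one_mul, ← h2] at h1
  exact_mod_cast h1

theorem gaussMatrix_rotL {M N : ℕ} {A : Matrix (Fin M) (Fin M) ℂ} (hA : Aᴴ * A = 1) :
    (gaussMatrix M N).map (rotL A) = gaussMatrix M N := by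
  let T : (Fin M → Fin N → ℂ) →ₗ[ℂ] Fin M → Fin N → ℂ :=
    { toFun := rotL A
      map_add' := fun X Y => Matrix.mul_add A (Matrix.of X) (Matrix.of Y)
      map_smul' := fun c X => Matrix.mul_smul A c (Matrix.of X) }
  refine gaussMatrix_map T fun X => ?_
  have h1 := sum_norm_sq_eq_trace (A * Matrix.of X)
  have h2 := sum_norm_sq_eq_trace (Matrix.of X)
  rw [Matrix.conjTranspose_mul, ← Matrix.mul_assoc, Matrix.trace_mul_comm, ← Matrix.mul_assoc, ← Matrix.mul_assoc,
    hA, Matrix.one_mul, ← h2] at h1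
  exact_mod_cast h1

theorem measurable_rotR {M N : ℕ} (A : Matrix (Fin N) (Fin N) ℂ) :
    Measurable (rotR A : (Fin M → Fin N → ℂ) → _) := by
  refine measurable_pi_lambda _ fun i => measurable_pi_lambda _ fun j => ?_
  simp only [rotR, Matrix.mul_apply, Matrix.of_apply]
  fun_prop

theorem measurable_rotL {M N : ℕ} (A : Matrix (Fin M) (Fin M) ℂ) :
    Measurable (rotL A : (Fin M → Fin N → ℂ) → _) := by
  refine measurable_pi_lambda _ fun i => measurable_pi_lambda _ fun j => ?_
  simp only [rotL, Matrix.mul_apply, Matrix.of_apply]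
  fun_prop

section Rot

variable {M N : ℕ} (X : Fin M → Fin N → ℂ)

theorem rowGram_rotR {A : Matrix (Fin N) (Fin N) ℂ} (hA : Aᴴ * A = 1) :
    rowGram (rotR A X) = rowGram X := by
  change Matrix.of X * Aᴴ * (Matrix.of X * Aᴴ)ᴴ = _
  rw [Matrix.conjTranspose_mul, Matrix.conjTranspose_conjTranspose, Matrix.mul_assoc, ← Matrix.mul_assoc Aᴴ,
    hA, Matrix.one_mul]
  rfl

theorem coef_rotR {A : Matrix (Fin N) (Fin N) ℂ} (hA : Aᴴ * A = 1)
    (u : EuclideanSpace ℂ (Fin N)) : coef (rotR A X) (mulE A u) = coef X u := by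
  rw [coef, coef, rowGram_rotR X hA, mulE_mulE]
  change mulE ((rowGram X)⁻¹ * (Matrix.of X * Aᴴ) * A) u = _
  rw [Matrix.mul_assoc, Matrix.mul_assoc, hA, Matrix.mul_one]

theorem proj_rotR {A : Matrix (Fin N) (Fin N) ℂ} (hA : Aᴴ * A = 1)
    (u : EuclideanSpace ℂ (Fin N)) : proj (rotR A X) (mulE A u) = mulE A (proj X u) := by
  rw [proj, coef_rotR X hA, proj, mulE_mulE]
  change mulE (Matrix.of X * Aᴴ)ᴴ _ = _
  rw [Matrix.conjTranspose_mul, Matrix.conjTranspose_conjTranspose]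

theorem rowGram_rotL (A : Matrix (Fin M) (Fin M) ℂ) :
    rowGram (rotL A X) = A * rowGram X * Aᴴ := by
  change A * Matrix.of X * (A * Matrix.of X)ᴴ = _
  rw [Matrix.conjTranspose_mul]
  simp only [rowGram, Matrix.mul_assoc]

theorem rowGram_rotL_inv {A : Matrix (Fin M) (Fin M) ℂ} (hA : Aᴴ * A = 1) :
    (rowGram (rotL A X))⁻¹ = A * (rowGram X)⁻¹ * Aᴴ := by
  have h1 : A⁻¹ = Aᴴ := Matrix.inv_eq_left_inv hA
  have h2 : (Aᴴ)⁻¹ = A := Matrix.inv_eq_right_inv hA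
  rw [rowGram_rotL, Matrix.mul_inv_rev, Matrix.mul_inv_rev, h1, h2, Matrix.mul_assoc]

theorem coef_rotL {A : Matrix (Fin M) (Fin M) ℂ} (hA : Aᴴ * A = 1)
    (u : EuclideanSpace ℂ (Fin N)) : coef (rotL A X) u = mulE A (coef X u) := by
  rw [coef, coef, rowGram_rotL_inv X hA, mulE_mulE]
  change mulE (A * (rowGram X)⁻¹ * Aᴴ * (A * Matrix.of X)) u = _
  congr 1
  calc A * (rowGram X)⁻¹ * Aᴴ * (A * Matrix.of X)
      = A * (rowGram X)⁻¹ * (Aᴴ * A) * Matrix.of X := by simp only [Matrix.mul_assoc]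
    _ = _ := by rw [hA, Matrix.mul_one, Matrix.mul_assoc]

theorem proj_rotL {A : Matrix (Fin M) (Fin M) ℂ} (hA : Aᴴ * A = 1)
    (u : EuclideanSpace ℂ (Fin N)) : proj (rotL A X) u = proj X u := by
  rw [proj, coef_rotL X hA, proj, mulE_mulE]
  change mulE ((A * Matrix.of X)ᴴ * A) _ = _
  rw [Matrix.conjTranspose_mul, Matrix.mul_assoc, hA, Matrix.mul_one]

end Rot

end ZFC
end

/-! ### The best codeword: its distortion and the independence of the gain. -/

noncomputable section
open scoped ENNReal
namespace ZFC

/-- Squared norm of the combined channel that is best aligned with `u`; here `A` is the inverse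
square root of the correlation matrix. -/
def effGain {M N : ℕ} (A : Matrix (Fin M) (Fin M) ℂ) (X : Fin M → Fin N → ℂ)
    (u : EuclideanSpace ℂ (Fin N)) : ℝ :=
  ‖proj X u‖ ^ 2 / ‖mulE A (coef X u)‖ ^ 2

theorem effGain_nonneg {M N : ℕ} (A : Matrix (Fin M) (Fin M) ℂ) (X : Fin M → Fin N → ℂ)
    (u : EuclideanSpace ℂ (Fin N)) : 0 ≤ effGain A X u := by
  unfold effGain; positivity

theorem measurable_effGain {M N : ℕ} (A : Matrix (Fin M) (Fin M) ℂ) :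
    Measurable fun p : (Fin M → Fin N → ℂ) × EuclideanSpace ℂ (Fin N) => effGain A p.1 p.2 :=
  (measurable_proj.norm.pow_const 2).div
    (((continuous_mulE A).measurable.comp measurable_coef).norm.pow_const 2)

open Classical in
/-- The codeword closest to the row space, if it is unique. -/
def best {M N L : ℕ} (X : Fin M → Fin N → ℂ) (C : Fin L → EuclideanSpace ℂ (Fin N)) :
    EuclideanSpace ℂ (Fin N) :=
  ∑ i, if ∀ j, j ≠ i → ‖proj X (C j)‖ < ‖proj X (C i)‖ then C i else 0

section

variable {M N L : ℕ}

theorem best_eq {X : Fin M → Fin N → ℂ} {C : Fin L → EuclideanSpace ℂ (Fin N)} {i : Fin L}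
    (hi : ∀ j, j ≠ i → ‖proj X (C j)‖ < ‖proj X (C i)‖) : best X C = C i := by
  unfold best
  rw [Finset.sum_eq_single i, if_pos hi]
  · intro j _ hj
    rw [if_neg]
    intro h
    exact lt_asymm (hi j hj) (h i hj.symm)
  · simp

theorem exists_best [NeZero L] {X : Fin M → Fin N → ℂ} {C : Fin L → EuclideanSpace ℂ (Fin N)}
    (h : Function.Injective fun i => ‖proj X (C i)‖) :
    ∃ i, ∀ j, j ≠ i → ‖proj X (C j)‖ < ‖proj X (C i)‖ := by
  obtain ⟨i, hi⟩ := Finite.exists_max fun i => ‖proj X (C i)‖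
  exact ⟨i, fun j hj => lt_of_le_of_ne (hi j) fun e => hj (h e)⟩

theorem measurable_best : Measurable
    fun p : (Fin M → Fin N → ℂ) × (Fin L → EuclideanSpace ℂ (Fin N)) => best p.1 p.2 := by
  classical
  have hp : ∀ j, Measurable fun p : (Fin M → Fin N → ℂ) × (Fin L → EuclideanSpace ℂ (Fin N)) =>
      ‖proj p.1 (p.2 j)‖ := fun j =>
    (measurable_proj.comp (measurable_fst.prodMk
      ((measurable_pi_apply j).comp measurable_snd))).norm
  unfold best
  refine Finset.measurable_sum _ fun i _ => ?_
  refine Measurable.ite ?_ ((measurable_pi_apply i).comp measurable_snd) measurable_const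
  simp only [Set.ofPred_forall]
  exact MeasurableSet.iInter fun j => MeasurableSet.iInter fun _ =>
    measurableSet_lt (hp j) (hp i)

/-- Since `best` is a sum of indicator terms and not a choice, it commutes with a linear isometry
without excluding ties. -/
theorem best_equivariant (X Y : Fin M → Fin N → ℂ) (C : Fin L → EuclideanSpace ℂ (Fin N))
    (U : EuclideanSpace ℂ (Fin N) ≃ₗᵢ[ℂ] EuclideanSpace ℂ (Fin N))
    (h : ∀ i, ‖proj Y (U (C i))‖ = ‖proj X (C i)‖) :
    best Y (fun i => U (C i)) = U (best X C) := by
  unfold best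
  rw [map_sum]
  refine Finset.sum_congr rfl fun i _ => ?_
  rw [apply_ite U, map_zero]
  simp only [h]

/-- Law of a random codebook. -/
def codeLaw (L N : ℕ) : Measure (Fin L → EuclideanSpace ℂ (Fin N)) :=
  Measure.pi fun _ => sphereLaw N

instance (L N : ℕ) : IsProbabilityMeasure (codeLaw L N) := by unfold codeLaw; infer_instance

theorem codeLaw_map (U : EuclideanSpace ℂ (Fin N) ≃ₗᵢ[ℂ] EuclideanSpace ℂ (Fin N)) :
    (codeLaw L N).map (fun C i => U (C i)) = codeLaw L N := by
  have : IsProbabilityMeasure ((sphereLaw N).map U) := by rw [sphereLaw_map]; infer_instance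
  unfold codeLaw
  rw [Measure.pi_map_pi fun _ => U.continuous.measurable.aemeasurable]
  simp_rw [sphereLaw_map]

theorem ae_codeLaw {p : EuclideanSpace ℂ (Fin N) → Prop} (h : ∀ᵐ u ∂sphereLaw N, p u) :
    ∀ᵐ C ∂codeLaw L N, ∀ i, p (C i) := by
  rw [ae_all_iff]
  intro i
  exact (measurePreserving_eval (fun _ : Fin L => sphereLaw N) i).quasiMeasurePreserving.ae h

end

section FullRank

variable {M m : ℕ} {X : Fin M → Fin (M + m) → ℂ}

theorem sphereLaw_map_proj (hM : M ≠ 0) (hX : (rowGram X).PosDef) :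
    (sphereLaw (M + m)).map (fun u => 1 - ‖proj X u‖ ^ 2) = betaLaw M m := by
  obtain ⟨Q, f, -, -, -, hf⟩ := exists_isometry_row hX
  simp_rw [norm_proj_eq hf]
  exact map_adjoint_eq_betaLaw hM f

theorem measurable_proj_right {M N : ℕ} (X : Fin M → Fin N → ℂ) : Measurable (proj X) :=
  measurable_proj.of_uncurry_left (x := X)

theorem ae_norm_proj_ne (hM : M ≠ 0) (hm : m ≠ 0) (hX : (rowGram X).PosDef) (r : ℝ) :
    ∀ᵐ u ∂sphereLaw (M + m), ‖proj X u‖ ≠ r := by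
  have h := betaLaw_singleton hM hm (1 - r ^ 2)
  have hm : Measurable fun u => 1 - ‖proj X u‖ ^ 2 :=
    measurable_const.sub ((measurable_proj_right X).norm.pow_const 2)
  rw [← sphereLaw_map_proj hM hX, Measure.map_apply hm (measurableSet_singleton _)] at h
  filter_upwards [compl_mem_ae_iff.2 h] with u hu he
  exact hu (by simp [he])

/-- Resample one codeword and freeze the others: a tie would be an atom of the Beta law. -/
theorem ae_injective_norm_proj {L : ℕ} (hM : M ≠ 0) (hm : m ≠ 0) (hX : (rowGram X).PosDef) :
    ∀ᵐ C ∂codeLaw L (M + m), Function.Injective fun i => ‖proj X (C i)‖ := by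
  have h : ∀ i j : Fin L, i ≠ j → ∀ᵐ C ∂codeLaw L (M + m), ‖proj X (C i)‖ ≠ ‖proj X (C j)‖ := by
    intro i j hij
    have hmeas : ∀ k, Measurable fun C : Fin L → EuclideanSpace ℂ (Fin (M + m)) =>
        ‖proj X (C k)‖ := fun k =>
      ((measurable_proj_right X).comp (measurable_pi_apply k)).norm
    refine ae_pi_of_ae_update _ i ?_ (Eventually.of_forall fun C => ?_)
    · exact (measurableSet_eq_fun (hmeas i) (hmeas j)).compl
    · filter_upwards [ae_norm_proj_ne hM hm hX ‖proj X (C j)‖] with u hu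
      simpa [Function.update_of_ne hij.symm] using hu
  have h' : ∀ᵐ C ∂codeLaw L (M + m), ∀ i j : Fin L, i ≠ j → ‖proj X (C i)‖ ≠ ‖proj X (C j)‖ := by
    simp only [ae_all_iff, eventually_imp_distrib_left]
    exact h
  filter_upwards [h'] with C hC i j hij
  by_contra hne
  exact hC i j hne hij

variable {L : ℕ} [NeZero L]

theorem ae_exists_best (hM : M ≠ 0) (hm : m ≠ 0) (hX : (rowGram X).PosDef) :
    ∀ᵐ C ∂codeLaw L (M + m), ∃ i, (∀ j, j ≠ i → ‖proj X (C j)‖ < ‖proj X (C i)‖) ∧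
      best X C = C i ∧ ‖proj X (C i)‖ ≠ 0 ∧ ‖C i‖ = 1 := by
  filter_upwards [ae_injective_norm_proj hM hm hX, ae_codeLaw (ae_norm_proj_ne hM hm hX 0),
    ae_codeLaw (sphereLaw_norm (by omega))] with C h1 h2 h3
  obtain ⟨i, hi⟩ := exists_best h1
  exact ⟨i, hi, best_eq hi, h2 i, h3 i⟩

/-- The error of the best codeword exceeds `t` exactly when all errors do. These events are
independent with the same Beta tail, so the layer-cake formula yields `minBetaMean`, for every
full-rank `X` alike. -/
theorem lintegral_one_sub_proj_best (hM : M ≠ 0) (hm : m ≠ 0) (hX : (rowGram X).PosDef) :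
    ∫⁻ C, ENNReal.ofReal (1 - ‖proj X (best X C)‖ ^ 2) ∂codeLaw L (M + m) =
      ENNReal.ofReal (minBetaMean M m L) := by
  have hmb : Measurable (best X : (Fin L → _) → _) := measurable_best.of_uncurry_left (x := X)
  have hmp : Measurable fun u => 1 - ‖proj X u‖ ^ 2 :=
    measurable_const.sub ((measurable_proj_right X).norm.pow_const 2)
  have hae := ae_exists_best (L := L) hM hm hX
  rw [lintegral_eq_lintegral_meas_lt]
  rotate_left
  · filter_upwards [hae] with C ⟨i, _, hb, _, hn⟩
    have h1 := norm_proj_le hX (C i)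
    have h0 := norm_nonneg (proj X (C i))
    simp only [Pi.zero_apply, hb]
    nlinarith
  · exact (hmp.comp hmb).aemeasurable
  have hlt : ∀ t : ℝ, codeLaw L (M + m) {C | t < 1 - ‖proj X (best X C)‖ ^ 2} =
      ENNReal.ofReal ((betaLaw M m).real (Set.Ioi t) ^ L) := by
    intro t
    have hset : {C : Fin L → _ | t < 1 - ‖proj X (best X C)‖ ^ 2} =ᵐ[codeLaw L (M + m)]
        Set.univ.pi fun _ : Fin L => (fun u => 1 - ‖proj X u‖ ^ 2) ⁻¹' Set.Ioi t := by
      filter_upwards [hae] with C ⟨i, hi, hb, _, _⟩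
      refine propext ?_
      change t < 1 - ‖proj X (best X C)‖ ^ 2 ↔ C ∈ Set.univ.pi _
      rw [hb, Set.mem_univ_pi]
      simp only [Set.mem_preimage, Set.mem_Ioi]
      refine ⟨fun h j => ?_, fun h => h i⟩
      by_cases hj : j = i
      · rw [hj]; exact h
      · have := hi j hj
        have h0 := norm_nonneg (proj X (C j))
        nlinarith
    rw [measure_congr hset]
    unfold codeLaw
    rw [Measure.pi_pi]
    simp only [Finset.prod_const, Finset.card_univ, Fintype.card_fin]
    rw [← Measure.map_apply hmp measurableSet_Ioi, sphereLaw_map_proj hM hX,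
      ENNReal.ofReal_pow measureReal_nonneg, ofReal_measureReal]
  simp_rw [hlt]
  have hLn : L ≠ 0 := NeZero.ne L
  have hanti : Antitone fun t : ℝ => (betaLaw M m).real (Set.Ioi t) ^ L := fun a b hab =>
    pow_le_pow_left₀ measureReal_nonneg (measureReal_mono (Set.Ioi_subset_Ioi hab)) L
  have hint : IntegrableOn (fun t : ℝ => (betaLaw M m).real (Set.Ioi t) ^ L) (Set.Ioi 0) := by
    have h1 : IntegrableOn (fun t : ℝ => (betaLaw M m).real (Set.Ioi t) ^ L) (Set.Icc 0 1) :=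
      (hanti.antitoneOn _).integrableOn_isCompact isCompact_Icc
    have h2 : IntegrableOn (fun t : ℝ => (betaLaw M m).real (Set.Ioi t) ^ L) (Set.Ioi 1) := by
      refine (integrableOn_zero (s := Set.Ioi (1 : ℝ))).congr_fun (fun t ht => ?_) measurableSet_Ioi
      change 0 = (betaLaw M m).real (Set.Ioi t) ^ L
      rw [betaLaw_Ioi_eq_zero (le_of_lt ht), zero_pow hLn]
    refine (h1.union h2).mono_set fun t ht => ?_
    by_cases h : t ≤ 1
    · exact Or.inl ⟨le_of_lt ht, h⟩
    · exact Or.inr (not_le.1 h)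
  rw [minBetaMean, ofReal_integral_eq_lintegral_ofReal hint]
  exact Eventually.of_forall fun t => pow_nonneg measureReal_nonneg L

/-- The quotient is homogeneous of degree 0, so only the direction of the projection in the row
space matters. -/
theorem effGain_eq {N : ℕ} {X : Fin M → Fin N → ℂ} (A : Matrix (Fin M) (Fin M) ℂ)
    {Q : Matrix (Fin M) (Fin M) ℂ}
    {f : EuclideanSpace ℂ (Fin M) →ₗᵢ[ℂ] EuclideanSpace ℂ (Fin N)}
    (hc : ∀ u, coef X u = mulE Q (LinearMap.adjoint f.toLinearMap u))
    (hf : ∀ u, proj X u = f (LinearMap.adjoint f.toLinearMap u))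
    {u : EuclideanSpace ℂ (Fin N)} (hu : LinearMap.adjoint f.toLinearMap u ≠ 0) :
    effGain A X u = (‖mulE (A * Q) (dir (LinearMap.adjoint f.toLinearMap u))‖ ^ 2)⁻¹ := by
  set y := LinearMap.adjoint f.toLinearMap u
  have hy : ‖y‖ ≠ 0 := norm_ne_zero_iff.2 hu
  rw [effGain, norm_proj_eq hf, hc, mulE_mulE]
  change ‖y‖ ^ 2 / ‖mulE (A * Q) y‖ ^ 2 = _
  rw [dir, mulE_smul, norm_smul, norm_inv, Complex.norm_real, norm_norm, mul_pow, mul_inv, inv_pow,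
    inv_inv, div_eq_mul_inv]

/-- A rotation of the row space extends to a unitary map of `ℂ^N`. Applied to all codewords, it
preserves their joint law and all projection lengths, and it rotates the coordinates of the best
projection. By `map_dir_eq_prod` the direction of that projection is uniform and independent of its
length, and the gain is a function of the direction alone. -/
theorem lintegral_best_aux (hM : M ≠ 0) (hm : m ≠ 0) (hX : (rowGram X).PosDef)
    (A Q : Matrix (Fin M) (Fin M) ℂ)
    (f : EuclideanSpace ℂ (Fin M) →ₗᵢ[ℂ] EuclideanSpace ℂ (Fin (M + m)))
    (hc : ∀ u, coef X u = mulE Q (LinearMap.adjoint f.toLinearMap u))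
    (hf : ∀ u, proj X u = f (LinearMap.adjoint f.toLinearMap u))
    {φ : ℝ → ℝ≥0∞} (hφ : Measurable φ) :
    ∫⁻ C, φ ‖proj X (best X C)‖ * ENNReal.ofReal (effGain A X (best X C)) ∂codeLaw L (M + m) =
      (∫⁻ C, φ ‖proj X (best X C)‖ ∂codeLaw L (M + m)) *
        ∫⁻ a, ENNReal.ofReal (‖mulE (A * Q) a‖ ^ 2)⁻¹ ∂sphereLaw M := by
  set y := fun u => LinearMap.adjoint f.toLinearMap u with hy
  have hym : Measurable y := (LinearMap.continuous_of_finiteDimensional _).measurable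
  have hmb : Measurable (best X : (Fin L → _) → _) := measurable_best.of_uncurry_left (x := X)
  let F : (Fin L → EuclideanSpace ℂ (Fin (M + m))) → ℝ × EuclideanSpace ℂ (Fin M) :=
    fun C => (‖proj X (best X C)‖, y (best X C))
  have hF : Measurable F :=
    ((measurable_proj_right X).comp hmb).norm.prodMk (hym.comp hmb)
  have hyne : ∀ᵐ C ∂codeLaw L (M + m), y (best X C) ≠ 0 := by
    filter_upwards [ae_exists_best (L := L) hM hm hX] with C ⟨i, _, hb, h0, _⟩
    rw [hb]
    intro h
    rw [norm_proj_eq hf] at h0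
    exact h0 (norm_eq_zero.2 h)
  have hprod := map_dir_eq_prod hM ((codeLaw L (M + m)).map F) (by
    intro U
    -- `V` acts on the row space as `U` does in coordinates: `V ∘ f = f ∘ U`, whence the adjoints
    -- intertwine as well.
    obtain ⟨V, hV⟩ := exists_unitary_comp f (f.comp U.toLinearIsometry)
    have hVy : ∀ u, y (V u) = U (y u) := by
      intro u
      refine ext_inner_left ℂ fun c => ?_
      simp only [hy]
      rw [LinearMap.adjoint_inner_right]
      have h1 : f.toLinearMap c = V (f (U.symm c)) := by
        rw [hV]; simp
      rw [h1, V.inner_map_map]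
      change inner ℂ (f.toLinearMap _) u = _
      rw [← LinearMap.adjoint_inner_right, ← U.inner_map_map, U.apply_symm_apply]
    have hVp : ∀ u, ‖proj X (V u)‖ = ‖proj X u‖ := by
      intro u
      rw [norm_proj_eq hf, norm_proj_eq hf]
      change ‖y (V u)‖ = ‖y u‖
      rw [hVy, U.norm_map]
    rw [Measure.map_map (measurable_id.prodMap U.continuous.measurable) hF]
    have hVm : Measurable fun (C : Fin L → EuclideanSpace ℂ (Fin (M + m))) i => V (C i) :=
      measurable_pi_lambda _ fun i => V.continuous.measurable.comp (measurable_pi_apply i)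
    have : Prod.map id U ∘ F = F ∘ fun C i => V (C i) := by
      funext C
      simp only [Function.comp_apply, F, Prod.map_apply, id]
      rw [best_equivariant X X C V fun i => hVp _, hVp, hVy]
    rw [this, ← Measure.map_map hF hVm, codeLaw_map]) ((ae_map_iff (p := fun p => p.2 ≠ 0)
      hF.aemeasurable (measurable_snd (measurableSet_singleton 0).compl)).2 hyne)
  have hg : Measurable fun a : EuclideanSpace ℂ (Fin M) =>
      ENNReal.ofReal (‖mulE (A * Q) a‖ ^ 2)⁻¹ :=
    ((continuous_mulE _).measurable.norm.pow_const 2).inv.ennreal_ofReal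
  have hm2 : Measurable fun p : ℝ × EuclideanSpace ℂ (Fin M) =>
      φ p.1 * ENNReal.ofReal (‖mulE (A * Q) p.2‖ ^ 2)⁻¹ :=
    (hφ.comp measurable_fst).mul (hg.comp measurable_snd)
  calc ∫⁻ C, φ ‖proj X (best X C)‖ * ENNReal.ofReal (effGain A X (best X C)) ∂codeLaw L (M + m)
      = ∫⁻ C, φ ‖proj X (best X C)‖ *
          ENNReal.ofReal (‖mulE (A * Q) (dir (y (best X C)))‖ ^ 2)⁻¹ ∂codeLaw L (M + m) := by
        refine lintegral_congr_ae ?_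
        filter_upwards [hyne] with C hC
        rw [effGain_eq A hc hf hC]
    _ = ∫⁻ p, φ p.1 * ENNReal.ofReal (‖mulE (A * Q) p.2‖ ^ 2)⁻¹
          ∂(((codeLaw L (M + m)).map F).map (Prod.map id dir)) := by
        rw [lintegral_map hm2 (measurable_id.prodMap measurable_dir)]
        exact (lintegral_map (hm2.comp (measurable_id.prodMap measurable_dir)) hF).symm
    _ = _ := by
        rw [hprod, lintegral_prod_mul hφ.aemeasurable hg.aemeasurable]
        congr 1
        rw [Measure.map_map measurable_fst hF]
        exact lintegral_map hφ (measurable_fst.comp hF)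

/-- Average gain of a channel with isotropic codeword. -/
def meanGain {M N : ℕ} (A : Matrix (Fin M) (Fin M) ℂ) (X : Fin M → Fin N → ℂ) : ℝ≥0∞ :=
  ∫⁻ u, ENNReal.ofReal (effGain A X u) ∂sphereLaw N

theorem best_one {M N : ℕ} (X : Fin M → Fin N → ℂ) (C : Fin 1 → EuclideanSpace ℂ (Fin N)) :
    best X C = C 0 :=
  best_eq fun j hj => absurd (Subsingleton.elim j 0) hj

/-- With a single codeword nothing is selected, so `lintegral_best_aux` for the constant function 1
evaluates the mean over one isotropic codeword. -/
theorem meanGain_eq (hM : M ≠ 0) (hm : m ≠ 0) (hX : (rowGram X).PosDef)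
    (A Q : Matrix (Fin M) (Fin M) ℂ)
    (f : EuclideanSpace ℂ (Fin M) →ₗᵢ[ℂ] EuclideanSpace ℂ (Fin (M + m)))
    (hc : ∀ u, coef X u = mulE Q (LinearMap.adjoint f.toLinearMap u))
    (hf : ∀ u, proj X u = f (LinearMap.adjoint f.toLinearMap u)) :
    meanGain A X = ∫⁻ a, ENNReal.ofReal (‖mulE (A * Q) a‖ ^ 2)⁻¹ ∂sphereLaw M := by
  have h := lintegral_best_aux (L := 1) hM hm hX A Q f hc hf (φ := fun _ => 1) measurable_const
  simp only [one_mul, lintegral_const, measure_univ, best_one] at h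
  rw [← h, meanGain]
  exact ((measurePreserving_eval (fun _ : Fin 1 => sphereLaw (M + m)) 0).lintegral_comp
    ((measurable_effGain A).of_uncurry_left (x := X)).ennreal_ofReal).symm

/-- Selecting the codeword by its quantization error does not bias the gain: it averages as for one
isotropic codeword and factors out of any function of the error. -/
theorem lintegral_best (hM : M ≠ 0) (hm : m ≠ 0) (hX : (rowGram X).PosDef)
    (A : Matrix (Fin M) (Fin M) ℂ) {φ : ℝ → ℝ≥0∞} (hφ : Measurable φ) :
    ∫⁻ C, φ ‖proj X (best X C)‖ * ENNReal.ofReal (effGain A X (best X C)) ∂codeLaw L (M + m) =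
      (∫⁻ C, φ ‖proj X (best X C)‖ ∂codeLaw L (M + m)) * meanGain A X := by
  obtain ⟨Q, f, -, -, hc, hf⟩ := exists_isometry_row hX
  rw [meanGain_eq hM hm hX A Q f hc hf]
  exact lintegral_best_aux hM hm hX A Q f hc hf hφ

end FullRank

end ZFC
end

/-! ### Mean gain: inverse Gram matrix and separation of the correlation. -/

noncomputable section
open scoped ENNReal
namespace ZFC

/-- All unit vectors give the same value by invariance, and an orthonormal basis gives the total `E
‖g‖² = n`. -/
theorem lintegral_norm_inner_gaussVec {n : ℕ} {v : EuclideanSpace ℂ (Fin n)} (hv : ‖v‖ = 1) :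
    ∫⁻ g, ENNReal.ofReal (‖inner ℂ v g‖ ^ 2) ∂gaussVec n = 1 := by
  have hn : n ≠ 0 := by
    rintro rfl
    rw [Subsingleton.elim v 0, norm_zero] at hv
    exact zero_ne_one hv
  have hm : ∀ w : EuclideanSpace ℂ (Fin n),
      Measurable fun g : EuclideanSpace ℂ (Fin n) => ENNReal.ofReal (‖inner ℂ w g‖ ^ 2) := by
    intro w
    have : Continuous fun g : EuclideanSpace ℂ (Fin n) => ‖inner ℂ w g‖ ^ 2 := by fun_prop
    exact this.measurable.ennreal_ofReal
  have hall : ∀ w : EuclideanSpace ℂ (Fin n), ‖w‖ = 1 →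
      ∫⁻ g, ENNReal.ofReal (‖inner ℂ w g‖ ^ 2) ∂gaussVec n =
        ∫⁻ g, ENNReal.ofReal (‖inner ℂ v g‖ ^ 2) ∂gaussVec n := by
    intro w hw
    obtain ⟨U, hU⟩ := exists_unitary_of_norm_eq (hw.trans hv.symm)
    conv_rhs => rw [← gaussVec_map U, lintegral_map (hm v) U.continuous.measurable]
    simp_rw [← hU, U.inner_map_map]
  have hsum : ∫⁻ g, ENNReal.ofReal (‖g‖ ^ 2) ∂gaussVec n = n := by
    rw [gaussVec, lintegral_map (by fun_prop) (by fun_prop)]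
    simp only [norm_sq_toLp]
    have e1 := integral_nsq_rpow hn (s := 1) (by have : (0 : ℝ) ≤ n := by positivity
                                                 linarith)
    have e2 := integrable_nsq_rpow hn (s := 1) (by have : (0 : ℝ) ≤ n := by positivity
                                                   linarith)
    simp only [Real.rpow_one] at e1 e2
    have hn' : (n : ℝ) ≠ 0 := by exact_mod_cast hn
    have hG : Real.Gamma (n : ℝ) ≠ 0 := (Real.Gamma_pos_of_pos (by positivity)).ne'
    rw [← ofReal_integral_eq_lintegral_ofReal e2 (Eventually.of_forall fun g => nsq_nonneg g), e1,
      Real.Gamma_add_one hn', mul_div_assoc, div_self hG, mul_one, ENNReal.ofReal_natCast]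
  have hsum2 : ∫⁻ g, ENNReal.ofReal (‖g‖ ^ 2) ∂gaussVec n =
      ∑ i : Fin n, ∫⁻ g, ENNReal.ofReal (‖inner ℂ (EuclideanSpace.single i (1 : ℂ)) g‖ ^ 2)
        ∂gaussVec n := by
    rw [← lintegral_finsetSum _ fun i _ => hm _]
    refine lintegral_congr fun g => ?_
    rw [EuclideanSpace.norm_sq_eq, ENNReal.ofReal_sum_of_nonneg fun i _ => by positivity]
    simp [EuclideanSpace.inner_single_left]
  rw [hsum, Finset.sum_congr rfl fun i _ => hall _ (by simp)] at hsum2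
  simp only [Finset.sum_const, Finset.card_univ, Fintype.card_fin, nsmul_eq_mul] at hsum2
  have h0 : (n : ℝ≥0∞) ≠ 0 := by exact_mod_cast hn
  have h1 : (n : ℝ≥0∞) * 1 =
      n * ∫⁻ g, ENNReal.ofReal (‖inner ℂ v g‖ ^ 2) ∂gaussVec n := by rw [mul_one]; exact hsum2
  exact ((ENNReal.mul_right_inj h0 (by simp)).1 h1).symm

/-- Conjugate row of a channel matrix, as a vector. -/
def conjVec {N : ℕ} (x : Fin N → ℂ) : EuclideanSpace ℂ (Fin N) := WithLp.toLp 2 (star x)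

/-- In an orthonormal basis of `W` each coordinate of the conjugated Gaussian vector has second
moment one. -/
theorem lintegral_norm_proj_conjVec {N : ℕ} (W : Submodule ℂ (EuclideanSpace ℂ (Fin N))) :
    ∫⁻ x, ENNReal.ofReal (‖W.starProjection (conjVec x)‖ ^ 2) ∂cgPi N =
      Module.finrank ℂ W := by
  let b := stdOrthonormalBasis ℂ W
  have h1 : ∀ x : Fin N → ℂ, ENNReal.ofReal (‖W.starProjection (conjVec x)‖ ^ 2) =
      ∑ i, ENNReal.ofReal (‖inner ℂ (conjVec (b i : EuclideanSpace ℂ (Fin N)).ofLp)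
        (WithLp.toLp 2 x : EuclideanSpace ℂ (Fin N))‖ ^ 2) := by
    intro x
    rw [← ENNReal.ofReal_sum_of_nonneg fun i _ => by positivity]
    congr 1
    have e1 : ‖W.starProjection (conjVec x)‖ = ‖W.orthogonalProjectionOnto (conjVec x)‖ := rfl
    rw [e1, ← b.sum_sq_norm_inner_right]
    refine Finset.sum_congr rfl fun i _ => ?_
    rw [Submodule.inner_orthogonalProjectionOnto_eq_of_mem_left]
    congr 1
    rw [← RCLike.norm_conj, inner_conj_symm]
    simp only [conjVec, EuclideanSpace.inner_eq_star_dotProduct, star_star, dotProduct_comm]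
  have hm : ∀ w : EuclideanSpace ℂ (Fin N),
      Measurable fun g : EuclideanSpace ℂ (Fin N) => ENNReal.ofReal (‖inner ℂ w g‖ ^ 2) := by
    intro w
    have : Continuous fun g : EuclideanSpace ℂ (Fin N) => ‖inner ℂ w g‖ ^ 2 := by fun_prop
    exact this.measurable.ennreal_ofReal
  have hm' : ∀ i, Measurable fun x : Fin N → ℂ =>
      ENNReal.ofReal (‖inner ℂ (conjVec (b i : EuclideanSpace ℂ (Fin N)).ofLp)
        (WithLp.toLp 2 x : EuclideanSpace ℂ (Fin N))‖ ^ 2) := fun i =>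
    (hm _).comp (WithLp.measurable_toLp 2 _)
  simp_rw [h1]
  rw [lintegral_finsetSum _ fun i _ => hm' i]
  have h2 : ∀ i, ∫⁻ x, ENNReal.ofReal (‖inner ℂ (conjVec (b i : EuclideanSpace ℂ (Fin N)).ofLp)
        (WithLp.toLp 2 x : EuclideanSpace ℂ (Fin N))‖ ^ 2) ∂cgPi N = 1 := by
    intro i
    rw [← lintegral_norm_inner_gaussVec (v := conjVec (b i : EuclideanSpace ℂ (Fin N)).ofLp),
      gaussVec, lintegral_map (hm _) (by fun_prop)]
    have : ‖(b i : EuclideanSpace ℂ (Fin N))‖ = 1 := b.orthonormal.norm_eq_one i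
    rw [← this, ← sq_eq_sq₀ (norm_nonneg _) (norm_nonneg _), EuclideanSpace.norm_sq_eq,
      EuclideanSpace.norm_sq_eq]
    simp [conjVec]
  rw [Finset.sum_congr rfl fun i _ => h2 i]
  simp

/-- Span of all conjugate rows but one. -/
def otherRows {M N : ℕ} (i : Fin M) (X : Fin M → Fin N → ℂ) :
    Submodule ℂ (EuclideanSpace ℂ (Fin N)) :=
  Submodule.span ℂ (Set.range fun j : {j : Fin M // j ≠ i} => conjVec (X j))

theorem otherRows_update {M N : ℕ} (i : Fin M) (X : Fin M → Fin N → ℂ) (x : Fin N → ℂ) :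
    otherRows i (Function.update X i x) = otherRows i X := by
  unfold otherRows
  congr 2
  funext j
  rw [Function.update_of_ne j.2]

theorem mulE_conjTranspose_eq {M N : ℕ} (X : Fin M → Fin N → ℂ) (c : EuclideanSpace ℂ (Fin M)) :
    mulE (Matrix.of X)ᴴ c = ∑ j, c j • conjVec (X j) := by
  ext i
  simp [mulE, conjVec, Matrix.mulVec, dotProduct, mul_comm]

theorem linearIndependent_conjVec {M N : ℕ} {X : Fin M → Fin N → ℂ} (hX : (rowGram X).PosDef) :
    LinearIndependent ℂ fun j => conjVec (X j) := by
  rw [Fintype.linearIndependent_iff]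
  intro g hg i
  have h1 : mulE (Matrix.of X)ᴴ (WithLp.toLp 2 g) = 0 := by
    rw [mulE_conjTranspose_eq]; exact hg
  have h2 : mulE (rowGram X) (WithLp.toLp 2 g) = 0 := by
    rw [rowGram, ← mulE_mulE, h1, mulE_zero]
  have h3 : (WithLp.toLp 2 g : EuclideanSpace ℂ (Fin M)) = 0 := by
    rw [← mulE_one (WithLp.toLp 2 g),
      ← Matrix.nonsing_inv_mul _ ((Matrix.isUnit_iff_isUnit_det _).1 hX.isUnit), ← mulE_mulE, h2,
      mulE_zero]
  exact congrArg (fun v : EuclideanSpace ℂ (Fin M) => v i) h3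

theorem finrank_otherRows {M N : ℕ} {X : Fin M → Fin N → ℂ} (hX : (rowGram X).PosDef)
    (i : Fin M) : Module.finrank ℂ (otherRows i X) = M - 1 := by
  have h := (linearIndependent_conjVec hX).comp (fun j : {j : Fin M // j ≠ i} => (j : Fin M))
    Subtype.val_injective
  rw [otherRows]
  exact (finrank_span_eq_card h).trans (by simp)

/-- A diagonal entry of the inverse Gram matrix is the inverse squared distance of a row to the
span of the other rows. -/
theorem rowGram_inv_diag {M N : ℕ} {X : Fin M → Fin N → ℂ} (hX : (rowGram X).PosDef)
    (i : Fin M) :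
    ((rowGram X)⁻¹ i i).re⁻¹ = ‖(otherRows i X)ᗮ.starProjection (conjVec (X i))‖ ^ 2 := by
  set W := otherRows i X
  set r := conjVec (X i)
  set t := Wᗮ.starProjection r with ht
  have htW : t ∈ Wᗮ := by
    rw [ht]; exact Submodule.starProjection_apply_mem _ _
  have hrt : r - t ∈ W := by
    have : r - t = W.starProjection r := by
      rw [ht, Submodule.starProjection_orthogonal]; simp
    rw [this]; exact Submodule.starProjection_apply_mem _ _
  -- `c` expresses the part of row `i` lying in the other rows. Then `e - c` combines the rows to
  -- the residual `t`, and `X t = ‖t‖² e`, so `e - c` solves the Gram system for column `i`; its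
  -- `i`-th entry is 1.
  obtain ⟨c, hc0, hc⟩ : ∃ c : EuclideanSpace ℂ (Fin M), c i = 0 ∧
      mulE (Matrix.of X)ᴴ c = r - t := by
    obtain ⟨g, hg⟩ := (Submodule.mem_span_range_iff_exists_fun ℂ).1 hrt
    refine ⟨WithLp.toLp 2 fun j => if h : j ≠ i then g ⟨j, h⟩ else 0, by simp, ?_⟩
    rw [mulE_conjTranspose_eq, ← hg]
    rw [← Fintype.sum_subtype_add_sum_subtype (fun j => j ≠ i)]
    rw [Finset.sum_eq_zero (s := (Finset.univ : Finset {j // ¬j ≠ i})) fun j _ => by simp [j.2],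
      add_zero]
    refine Finset.sum_congr rfl fun j _ => ?_
    simp [j.2]
  let e : EuclideanSpace ℂ (Fin M) := EuclideanSpace.single i 1
  have hre : mulE (Matrix.of X)ᴴ e = r := by
    rw [mulE_conjTranspose_eq]
    simp [e, r]
  have htb : mulE (Matrix.of X)ᴴ (e - c) = t := by
    rw [mulE_sub, hre, hc]; abel
  have hXt : mulE (Matrix.of X) t = ((‖t‖ ^ 2 : ℝ) : ℂ) • e := by
    have hrow : ∀ j, mulE (Matrix.of X) t j = inner ℂ (conjVec (X j)) t := by
      intro j
      simp [mulE, conjVec, EuclideanSpace.inner_eq_star_dotProduct, Matrix.mulVec, dotProduct_comm]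
    ext j
    rw [hrow]
    by_cases hj : j = i
    · subst hj
      have : inner ℂ r t = inner ℂ t t := by
        have h0 : inner ℂ (r - t) t = 0 := Submodule.inner_right_of_mem_orthogonal hrt htW
        rw [inner_sub_left, sub_eq_zero] at h0
        exact h0
      change inner ℂ r t = _
      rw [this, inner_self_eq_norm_sq_to_K]
      simp [e]
    · have hmem : conjVec (X j) ∈ W := Submodule.subset_span ⟨⟨j, hj⟩, rfl⟩
      rw [Submodule.inner_right_of_mem_orthogonal hmem htW]
      simp [e, hj]
  have hb : e - c = ((‖t‖ ^ 2 : ℝ) : ℂ) • mulE (rowGram X)⁻¹ e := by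
    rw [← mulE_smul, ← hXt, ← htb, mulE_mulE, mulE_mulE, Matrix.mul_assoc]
    change _ = mulE ((rowGram X)⁻¹ * rowGram X) (e - c)
    rw [Matrix.nonsing_inv_mul _ ((Matrix.isUnit_iff_isUnit_det _).1 hX.isUnit), mulE_one]
  have hbi := congrArg (fun v : EuclideanSpace ℂ (Fin M) => v i) hb
  have hent : mulE (rowGram X)⁻¹ e i = (rowGram X)⁻¹ i i := by
    simp [mulE, e]
  simp only [PiLp.sub_apply, PiLp.smul_apply, hc0, sub_zero, hent, smul_eq_mul] at hbi
  have he : e i = 1 := by simp [e]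
  rw [he] at hbi
  have hre' := congrArg Complex.re hbi
  rw [Complex.re_ofReal_mul, Complex.one_re] at hre'
  exact (eq_inv_of_mul_eq_one_left hre'.symm).symm

/-- Resample row `i`: given the other rows, the quantity is the squared norm of a Gaussian row
projected onto a subspace of dimension `N - (M - 1)`. -/
theorem lintegral_rowGram_inv_diag {M N : ℕ} (hMN : M ≤ N) (i : Fin M) :
    ∫⁻ X, ENNReal.ofReal (((rowGram X)⁻¹ i i).re⁻¹) ∂gaussMatrix M N =
      ENNReal.ofReal ((N : ℝ) - M + 1) := by
  have hmp := measurePreserving_update (fun _ : Fin M => cgPi N) i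
  have hmeas : Measurable fun X : Fin M → Fin N → ℂ =>
      ENNReal.ofReal (((rowGram X)⁻¹ i i).re⁻¹) :=
    (Complex.measurable_re.comp (measurable_rowGram_inv i i)).inv.ennreal_ofReal
  rw [← hmp.lintegral_comp hmeas]
  refine (lintegral_prod _ (hmeas.comp hmp.measurable).aemeasurable).trans ?_
  have hae := Measure.ae_ae_of_ae_prod (hmp.quasiMeasurePreserving.ae (ae_rowGram_posDef hMN))
  have h : ∀ᵐ X ∂gaussMatrix M N,
      ∫⁻ x, ENNReal.ofReal (((rowGram (Function.update X i x))⁻¹ i i).re⁻¹) ∂cgPi N =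
        ENNReal.ofReal ((N : ℝ) - M + 1) := by
    filter_upwards [hae] with X hX
    have h1 : ∀ᵐ x ∂cgPi N, ENNReal.ofReal (((rowGram (Function.update X i x))⁻¹ i i).re⁻¹) =
        ENNReal.ofReal (‖(otherRows i X)ᗮ.starProjection (conjVec x)‖ ^ 2) := by
      filter_upwards [hX] with x hx
      rw [rowGram_inv_diag hx]
      simp only [otherRows_update, Function.update_self]
    rw [lintegral_congr_ae h1, lintegral_norm_proj_conjVec]
    -- A single full-rank completion is enough to know the dimension of the span of the other rows.
    obtain ⟨x, hx⟩ := hX.exists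
    have h2 := finrank_otherRows hx i
    rw [otherRows_update] at h2
    have h3 := Submodule.finrank_add_finrank_orthogonal (otherRows i X)
    rw [h2, finrank_euclideanSpace, Fintype.card_fin] at h3
    have hM : 1 ≤ M := by have := i.2; omega
    have h4 : (N : ℝ) - M + 1 = (Module.finrank ℂ (otherRows i X)ᗮ : ℝ) := by
      have h5 : ((M - 1 : ℕ) : ℝ) + (Module.finrank ℂ (otherRows i X)ᗮ : ℝ) = N := by
        exact_mod_cast h3
      rw [Nat.cast_sub hM] at h5
      push_cast at h5
      linarith
    rw [h4, ENNReal.ofReal_natCast]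
  refine (lintegral_congr_ae h).trans ?_
  simp

/-- Left rotation of the Gaussian matrix carries `a` to a coordinate vector, which reduces the claim
to a diagonal entry. -/
theorem lintegral_inner_rowGram_inv {M N : ℕ} (hM : M ≠ 0) (hMN : M ≤ N)
    {a : EuclideanSpace ℂ (Fin M)} (ha : ‖a‖ = 1) :
    ∫⁻ X, ENNReal.ofReal ((inner ℂ a (mulE (rowGram X)⁻¹ a)).re⁻¹) ∂gaussMatrix M N =
      ENNReal.ofReal ((N : ℝ) - M + 1) := by
  let i : Fin M := ⟨0, Nat.pos_of_ne_zero hM⟩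
  let e : EuclideanSpace ℂ (Fin M) := EuclideanSpace.single i 1
  obtain ⟨U, hU⟩ := exists_unitary_of_norm_eq (x := e) (y := a) (by simp [e, ha])
  obtain ⟨A, hA, -, hUA⟩ := exists_matrix_unitary U
  have hmeas : Measurable fun X : Fin M → Fin N → ℂ =>
      ENNReal.ofReal ((inner ℂ a (mulE (rowGram X)⁻¹ a)).re⁻¹) := by
    have : Measurable fun X : Fin M → Fin N → ℂ => mulE (rowGram X)⁻¹ a :=
      measurable_mulE measurable_rowGram_inv measurable_const
    exact (Complex.measurable_re.comp (measurable_const.inner this)).inv.ennreal_ofReal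
  rw [← lintegral_rowGram_inv_diag hMN i]
  conv_lhs => rw [← gaussMatrix_rotL hA, lintegral_map hmeas (measurable_rotL A)]
  refine lintegral_congr fun X => ?_
  congr 3
  rw [rowGram_rotL_inv X hA, ← hU, hUA, mulE_mulE, Matrix.mul_assoc, Matrix.mul_assoc, hA,
    Matrix.mul_one, ← mulE_mulE, ← hUA, ← hUA, U.inner_map_map]
  simp [e, mulE, EuclideanSpace.inner_single_left]

theorem norm_mulE_sq {m n : ℕ} (Q : Matrix (Fin m) (Fin n) ℂ) (a : EuclideanSpace ℂ (Fin n)) :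
    ‖mulE Q a‖ ^ 2 = (inner ℂ a (mulE (Qᴴ * Q) a)).re := by
  have h := inner_mulE_left Qᴴ a (mulE Q a)
  rw [Matrix.conjTranspose_conjTranspose, mulE_mulE] at h
  rw [← h, inner_self_eq_norm_sq_to_K]
  norm_cast

/-- For trivial correlation the mean gain of a fixed channel is the spherical mean of `1 / (aᴴ
(XXᴴ)⁻¹ a)`. After exchanging the integrals each unit vector `a` contributes `N - M + 1`, which is
`m + 1` here. -/
theorem lintegral_meanGain_one {M m : ℕ} (hM : M ≠ 0) (hm : m ≠ 0) :
    ∫⁻ X, meanGain 1 X ∂gaussMatrix M (M + m) = ENNReal.ofReal ((m : ℝ) + 1) := by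
  have h1 : ∀ᵐ X ∂gaussMatrix M (M + m), meanGain 1 X =
      ∫⁻ a, ENNReal.ofReal ((inner ℂ a (mulE (rowGram X)⁻¹ a)).re⁻¹) ∂sphereLaw M := by
    filter_upwards [ae_rowGram_posDef (Nat.le_add_right M m)] with X hX
    obtain ⟨Q, f, -, hQ, hc, hf⟩ := exists_isometry_row hX
    rw [meanGain_eq hM hm hX 1 Q f hc hf]
    simp only [Matrix.one_mul, norm_mulE_sq, hQ]
  rw [lintegral_congr_ae h1, lintegral_lintegral_swap]
  · have h2 : ∀ᵐ a ∂sphereLaw M,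
        ∫⁻ X, ENNReal.ofReal ((inner ℂ a (mulE (rowGram X)⁻¹ a)).re⁻¹) ∂gaussMatrix M (M + m) =
          ENNReal.ofReal ((m : ℝ) + 1) := by
      filter_upwards [sphereLaw_norm hM] with a ha
      rw [lintegral_inner_rowGram_inv hM (Nat.le_add_right M m) ha]
      congr 1; push_cast; ring
    rw [lintegral_congr_ae h2]
    simp
  · have : Measurable fun p : (Fin M → Fin (M + m) → ℂ) × EuclideanSpace ℂ (Fin M) =>
        mulE (rowGram p.1)⁻¹ p.2 :=
      measurable_mulE (fun i j => (measurable_rowGram_inv i j).comp measurable_fst) measurable_snd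
    exact (Complex.measurable_re.comp
      (measurable_snd.inner this)).inv.ennreal_ofReal.aemeasurable

/-- Separation of the correlation from the rest of the average gain. -/
theorem lintegral_meanGain {M m : ℕ} (hM : M ≠ 0) (hm : m ≠ 0) (A : Matrix (Fin M) (Fin M) ℂ) :
    ∫⁻ X, meanGain A X ∂gaussMatrix M (M + m) =
      ENNReal.ofReal ((m : ℝ) + 1) *
        ∫⁻ b, ENNReal.ofReal (‖mulE A b‖ ^ 2)⁻¹ ∂sphereLaw M := by
  have hcoef : ∀ᵐ p ∂((gaussMatrix M (M + m)).prod (sphereLaw (M + m))), coef p.1 p.2 ≠ 0 := by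
    refine (Measure.ae_prod_iff_ae_ae (p := fun p => coef p.1 p.2 ≠ 0)
      (measurable_coef (measurableSet_singleton 0).compl)).2 ?_
    filter_upwards [ae_rowGram_posDef (Nat.le_add_right M m)] with X hX
    filter_upwards [ae_norm_proj_ne hM hm hX 0] with u hu
    rw [Ne, proj_eq_zero_iff hX, ← norm_eq_zero]
    exact hu
  let F : (Fin M → Fin (M + m) → ℂ) × EuclideanSpace ℂ (Fin (M + m)) →
      ℝ × EuclideanSpace ℂ (Fin M) := fun p => (effGain 1 p.1 p.2, coef p.1 p.2)
  have hF : Measurable F := (measurable_effGain 1).prodMk measurable_coef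
  -- Left rotation of `X` rotates `coef` and leaves the uncorrelated gain unchanged, so the
  -- direction of `coef` is uniform and independent of that gain. The matrix `A` acts only through
  -- this direction.
  have hprod := map_dir_eq_prod hM
    (((gaussMatrix M (M + m)).prod (sphereLaw (M + m))).map F) (by
    intro U
    obtain ⟨V, hV, -, hUV⟩ := exists_matrix_unitary U
    rw [Measure.map_map (measurable_id.prodMap U.continuous.measurable) hF]
    have hcomp : Prod.map id U ∘ F = F ∘ Prod.map (rotL V) id := by
      funext ⟨X, u⟩
      change (effGain 1 X u, U (coef X u)) = (effGain 1 (rotL V X) u, coef (rotL V X) u)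
      simp only [effGain, mulE_one, proj_rotL _ hV, coef_rotL _ hV, hUV, norm_mulE_unitary hV]
    rw [hcomp, ← Measure.map_map hF ((measurable_rotL V).prodMap measurable_id),
      ← Measure.map_prod_map _ _ (measurable_rotL V) measurable_id, gaussMatrix_rotL hV,
      Measure.map_id]) ((ae_map_iff (p := fun p => p.2 ≠ 0)
      hF.aemeasurable (measurable_snd (measurableSet_singleton 0).compl)).2 hcoef)
  have hg : Measurable fun a : EuclideanSpace ℂ (Fin M) => ENNReal.ofReal (‖mulE A a‖ ^ 2)⁻¹ :=
    ((continuous_mulE _).measurable.norm.pow_const 2).inv.ennreal_ofReal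
  have hm2 : Measurable fun p : ℝ × EuclideanSpace ℂ (Fin M) =>
      ENNReal.ofReal p.1 * ENNReal.ofReal (‖mulE A p.2‖ ^ 2)⁻¹ :=
    measurable_fst.ennreal_ofReal.mul (hg.comp measurable_snd)
  calc ∫⁻ X, meanGain A X ∂gaussMatrix M (M + m)
      = ∫⁻ p, ENNReal.ofReal (effGain A p.1 p.2)
          ∂((gaussMatrix M (M + m)).prod (sphereLaw (M + m))) := by
        rw [lintegral_prod _ (measurable_effGain A).ennreal_ofReal.aemeasurable]
        rfl
    _ = ∫⁻ p, ENNReal.ofReal (effGain 1 p.1 p.2) *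
          ENNReal.ofReal (‖mulE A (dir (coef p.1 p.2))‖ ^ 2)⁻¹
          ∂((gaussMatrix M (M + m)).prod (sphereLaw (M + m))) := by
        refine lintegral_congr_ae ?_
        filter_upwards [hcoef] with p hp
        have hy : ‖coef p.1 p.2‖ ≠ 0 := norm_ne_zero_iff.2 hp
        rw [← ENNReal.ofReal_mul (effGain_nonneg _ _ _)]
        congr 1
        rw [effGain, effGain, mulE_one, dir, mulE_smul, norm_smul, norm_inv, Complex.norm_real,
          norm_norm, mul_pow, mul_inv, inv_pow, inv_inv]
        field_simp
    _ = ∫⁻ p, ENNReal.ofReal p.1 * ENNReal.ofReal (‖mulE A p.2‖ ^ 2)⁻¹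
          ∂((((gaussMatrix M (M + m)).prod (sphereLaw (M + m))).map F).map
            (Prod.map id dir)) := by
        rw [lintegral_map hm2 (measurable_id.prodMap measurable_dir)]
        exact (lintegral_map (hm2.comp (measurable_id.prodMap measurable_dir)) hF).symm
    _ = _ := by
        rw [hprod, lintegral_prod_mul ENNReal.measurable_ofReal.aemeasurable hg.aemeasurable]
        congr 1
        rw [Measure.map_map measurable_fst hF, ← lintegral_meanGain_one hM hm,
          lintegral_map ENNReal.measurable_ofReal (measurable_fst.comp hF)]
        exact lintegral_prod _ (measurable_effGain 1).ennreal_ofReal.aemeasurable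

end ZFC
end

/-! ### Correlation eigenvalues and the solution of quantization-based combining. -/

noncomputable section
open scoped ENNReal
namespace ZFC

/-- Inverse square root of a correlation matrix. -/
def whitening {M : ℕ} (R : Matrix (Fin M) (Fin M) ℂ) : Matrix (Fin M) (Fin M) ℂ := (CFC.sqrt R)⁻¹

section Whitening

variable {M : ℕ} {R : Matrix (Fin M) (Fin M) ℂ}

theorem sqrt_conjTranspose (R : Matrix (Fin M) (Fin M) ℂ) : (CFC.sqrt R)ᴴ = CFC.sqrt R :=
  (Matrix.nonneg_iff_posSemidef.1 (CFC.sqrt_nonneg R)).isHermitian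

theorem isUnit_det_sqrt (hR : R.PosDef) : IsUnit (CFC.sqrt R).det := by
  have hS := CFC.sqrt_mul_sqrt_self R hR.posSemidef.nonneg
  have := (Matrix.isUnit_iff_isUnit_det _).1 hR.isUnit
  rw [← hS, Matrix.det_mul] at this
  exact isUnit_of_mul_isUnit_left this

theorem sqrt_mul_whitening (hR : R.PosDef) : CFC.sqrt R * whitening R = 1 :=
  Matrix.mul_nonsing_inv _ (isUnit_det_sqrt hR)

theorem whitening_mul_sqrt (hR : R.PosDef) : whitening R * CFC.sqrt R = 1 :=
  Matrix.nonsing_inv_mul _ (isUnit_det_sqrt hR)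

theorem whitening_sq (hR : R.PosDef) : (whitening R)ᴴ * whitening R = R⁻¹ := by
  have hS := CFC.sqrt_mul_sqrt_self R hR.posSemidef.nonneg
  unfold whitening
  rw [Matrix.conjTranspose_nonsing_inv, sqrt_conjTranspose, ← Matrix.mul_inv_rev, hS]

theorem mulE_whitening_eq_zero (hR : R.PosDef) {v : EuclideanSpace ℂ (Fin M)}
    (h : mulE (whitening R) v = 0) : v = 0 := by
  rw [← mulE_one v, ← sqrt_mul_whitening hR, ← mulE_mulE, h, mulE_zero]

/-- Orthonormal eigenvectors for a strictly increasing family of eigenvalues. -/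
theorem exists_orthonormal_eigenvectors (hR : R.PosDef) {lam : ℕ → ℝ}
    (hlam : StrictMonoOn lam (Set.Icc 1 M))
    (hev : ∀ m ∈ Set.Icc 1 M, Module.End.HasEigenvalue (Matrix.toLin' R) (lam m : ℂ)) :
    ∃ v : Fin M → EuclideanSpace ℂ (Fin M), Orthonormal ℂ v ∧
      ∀ i : Fin M, 0 < lam (i + 1) ∧ mulE R (v i) = (lam (i + 1) : ℂ) • v i := by
  have hmem : ∀ i : Fin M, (i : ℕ) + 1 ∈ Set.Icc 1 M := fun i => ⟨by omega, by omega⟩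
  have h1 : ∀ i : Fin M, ∃ v : EuclideanSpace ℂ (Fin M), ‖v‖ = 1 ∧
      mulE R v = (lam (i + 1) : ℂ) • v := by
    intro i
    obtain ⟨x, hx⟩ := (hev _ (hmem i)).exists_hasEigenvector
    let y : EuclideanSpace ℂ (Fin M) := WithLp.toLp 2 x
    have hy : y ≠ 0 := fun h => hx.2 (congrArg WithLp.ofLp h)
    have hyR : mulE R y = (lam (i + 1) : ℂ) • y := by
      have := hx.apply_eq_smul
      rw [Matrix.toLin'_apply] at this
      exact congrArg (WithLp.toLp 2) this
    refine ⟨dir y, norm_dir hy, ?_⟩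
    rw [dir, mulE_smul, hyR, smul_comm]
  choose v hv1 hvR using h1
  have hRh : ∀ a b : EuclideanSpace ℂ (Fin M), inner ℂ (mulE R a) b = inner ℂ a (mulE R b) := by
    intro a b
    rw [← inner_mulE_left, hR.isHermitian.eq]
  refine ⟨v, ⟨hv1, fun i j hij => ?_⟩, fun i => ⟨?_, hvR i⟩⟩
  · have h := hRh (v i) (v j)
    rw [hvR, hvR, inner_smul_left, inner_smul_right, Complex.conj_ofReal] at h
    have hne : (lam (i + 1) : ℂ) ≠ lam (j + 1) := by
      intro e
      have e' : lam (i + 1) = lam (j + 1) := by exact_mod_cast e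
      have := hlam.injOn (hmem i) (hmem j) e'
      exact hij (Fin.ext (by omega))
    have h2 : ((lam (i + 1) : ℂ) - lam (j + 1)) * inner ℂ (v i) (v j) = 0 := by
      rw [sub_mul, h, sub_self]
    exact (mul_eq_zero.1 h2).resolve_left (sub_ne_zero.2 hne)
  · have hne : (v i).ofLp ≠ 0 := by
      intro h
      have : v i = 0 := by ext j; exact congrFun h j
      have h1 := hv1 i
      rw [this, norm_zero] at h1
      exact zero_ne_one h1
    have h := hR.re_dotProduct_pos hne
    have h2 : (inner ℂ (v i) (mulE R (v i))).re = RCLike.re (star (v i).ofLp ⬝ᵥ R *ᵥ (v i).ofLp) := by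
      rw [EuclideanSpace.inner_eq_star_dotProduct, dotProduct_comm]
      rfl
    rw [← h2, hvR, inner_smul_right, inner_self_eq_norm_sq_to_K, hv1] at h
    simpa using h

theorem prod_fin_eq_prod_Icc (M : ℕ) (f : ℕ → ℝ) :
    ∏ i : Fin M, f (i + 1) = ∏ i ∈ Finset.Icc 1 M, f i := by
  rw [← Finset.prod_range fun i => f (i + 1), Finset.range_eq_Ico, Finset.prod_Ico_add' f, zero_add]
  rfl

/-- In the eigenbasis of `R` the form `‖R^{-1/2} b‖² = bᴴ R⁻¹ b` is diagonal with entries `1 / λᵢ`,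
and the uniform law is invariant under this change of basis. -/
theorem lintegral_inv_norm_whitening (hM : 2 ≤ M) (hR : R.PosDef) {lam : ℕ → ℝ}
    (hlam : StrictMonoOn lam (Set.Icc 1 M))
    (hev : ∀ m ∈ Set.Icc 1 M, Module.End.HasEigenvalue (Matrix.toLin' R) (lam m : ℂ)) :
    ∫⁻ b, ENNReal.ofReal (‖mulE (whitening R) b‖ ^ 2)⁻¹ ∂sphereLaw M =
      ENNReal.ofReal ((M : ℝ) - 1) *
        ∫⁻ s in Set.Ioi (0 : ℝ), ENNReal.ofReal (∏ i : Fin M, (1 + s * (1 / lam (i + 1)))⁻¹) := by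
  obtain ⟨v, hv, hvl⟩ := exists_orthonormal_eigenvectors hR hlam hev
  obtain ⟨U, hU⟩ := exists_unitary_of_orthonormal
    (EuclideanSpace.basisFun (Fin M) ℂ).orthonormal hv
  rw [← lintegral_sphereLaw_inv hM fun i => one_div_pos.2 (hvl i).1]
  have hm : Measurable fun b : EuclideanSpace ℂ (Fin M) =>
      ENNReal.ofReal (‖mulE (whitening R) b‖ ^ 2)⁻¹ :=
    ((continuous_mulE _).measurable.norm.pow_const 2).inv.ennreal_ofReal
  conv_lhs => rw [← sphereLaw_map U, lintegral_map hm U.continuous.measurable]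
  refine lintegral_congr fun b => ?_
  congr 2
  have hUb : U b = ∑ i, b i • v i := by
    have hb : b = ∑ i, b i • EuclideanSpace.basisFun (Fin M) ℂ i := by
      conv_lhs => rw [← (EuclideanSpace.basisFun (Fin M) ℂ).sum_repr b]
      simp
    conv_lhs => rw [hb]
    simp only [map_sum, map_smul, hU]
  have hinv : ∀ i, mulE R⁻¹ (v i) = ((1 / lam (i + 1) : ℝ) : ℂ) • v i := by
    intro i
    have hl : (lam (i + 1) : ℂ) ≠ 0 := by exact_mod_cast (hvl i).1.ne'
    have h1 : mulE R⁻¹ (mulE R (v i)) = v i := by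
      rw [mulE_mulE, Matrix.nonsing_inv_mul _ ((Matrix.isUnit_iff_isUnit_det _).1 hR.isUnit),
        mulE_one]
    rw [(hvl i).2, mulE_smul] at h1
    conv_rhs => rw [← h1, smul_smul]
    push_cast
    rw [one_div, inv_mul_cancel₀ hl, one_smul]
  have hRb : mulE R⁻¹ (U b) = ∑ i, (b i * ((1 / lam (i + 1) : ℝ) : ℂ)) • v i := by
    rw [hUb]
    have hs : ∀ s : Finset (Fin M), mulE R⁻¹ (∑ i ∈ s, b i • v i) =
        ∑ i ∈ s, (b i * ((1 / lam (i + 1) : ℝ) : ℂ)) • v i := by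
      intro s
      induction s using Finset.induction_on with
      | empty => simp [mulE_zero]
      | insert i s hi ih =>
        rw [Finset.sum_insert hi, Finset.sum_insert hi, mulE_add, ih, mulE_smul, hinv, smul_smul]
    exact hs _
  rw [norm_mulE_sq, whitening_sq hR, hRb, hUb, hv.inner_sum, Complex.re_sum]
  refine Finset.sum_congr rfl fun i _ => ?_
  rw [← mul_assoc, Complex.conj_mul', mul_comm, Complex.re_ofReal_mul]
  norm_cast

/-- Nonnegativity is recorded with the value because `ENNReal.ofReal` would truncate a negative
closed form. -/
theorem lintegral_meanGain_eq {m : ℕ} (hM : 2 ≤ M) (hm : m ≠ 0) (hR : R.PosDef) {lam : ℕ → ℝ}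
    (hlam : StrictMonoOn lam (Set.Icc 1 M))
    (hev : ∀ m ∈ Set.Icc 1 M, Module.End.HasEigenvalue (Matrix.toLin' R) (lam m : ℂ)) :
    0 ≤ gain (M + m) M (fun n => 1 / lam n) ∧
    ∫⁻ X, meanGain (whitening R) X ∂gaussMatrix M (M + m) =
      ENNReal.ofReal (gain (M + m) M (fun n => 1 / lam n)) := by
  obtain ⟨v, hv, hvl⟩ := exists_orthonormal_eigenvectors hR hlam hev
  have hpos : ∀ i ∈ Finset.Icc 1 M, 0 < 1 / lam i := by
    intro i hi
    rw [Finset.mem_Icc] at hi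
    have := (hvl ⟨i - 1, by omega⟩).1
    simp only [Nat.sub_add_cancel hi.1] at this
    exact one_div_pos.2 this
  have hinj : Set.InjOn (fun n => 1 / lam n) (Finset.Icc 1 M) := by
    intro i hi j hj h
    rw [Finset.coe_Icc] at hi hj
    exact hlam.injOn hi hj (by simpa using h)
  have hint := (integral_prod_inv_one_add hinj hpos (by simpa using hM)).1
  have hM1 : (0 : ℝ) ≤ (M : ℝ) - 1 := by
    have : (2 : ℝ) ≤ M := by exact_mod_cast hM
    linarith
  have hnn : ∀ s ∈ Set.Ioi (0 : ℝ), 0 ≤ ∏ i ∈ Finset.Icc 1 M, (1 + s * (1 / lam i))⁻¹ :=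
    fun s hs => Finset.prod_nonneg fun i hi => inv_nonneg.2 <| by
      have := mul_pos (Set.mem_Ioi.1 hs) (hpos i hi)
      linarith
  rw [lintegral_meanGain (by omega) hm, lintegral_inv_norm_whitening hM hR hlam hev,
    gain_eq _ hM hinj hpos]
  have h0 : ∫⁻ s in Set.Ioi (0 : ℝ), ENNReal.ofReal (∏ i : Fin M, (1 + s * (1 / lam (i + 1)))⁻¹) =
      ENNReal.ofReal (∫ s in Set.Ioi (0 : ℝ), ∏ i ∈ Finset.Icc 1 M, (1 + s * (1 / lam i))⁻¹) := by
    rw [ofReal_integral_eq_lintegral_ofReal hint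
      ((ae_restrict_iff' measurableSet_Ioi).2 (Eventually.of_forall hnn))]
    refine lintegral_congr fun s => ?_
    rw [prod_fin_eq_prod_Icc M fun i => (1 + s * (1 / lam i))⁻¹]
  have hI := setIntegral_nonneg (μ := volume) measurableSet_Ioi hnn
  have hm1 : (((M + m : ℕ) : ℝ) - M + 1) = (m : ℝ) + 1 := by push_cast; ring
  refine ⟨by rw [hm1]; positivity, ?_⟩
  rw [h0, ← ENNReal.ofReal_mul hM1, ← ENNReal.ofReal_mul (by positivity), hm1]

end Whitening

/-- Normalized combined channel that is best aligned with the best codeword. -/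
def combined {M N L : ℕ} (A : Matrix (Fin M) (Fin M) ℂ)
    (ξ : (Fin M → Fin N → ℂ) × (Fin L → EuclideanSpace ℂ (Fin N))) : EuclideanSpace ℂ (Fin N) :=
  ((‖mulE A (coef ξ.1 (best ξ.1 ξ.2))‖⁻¹ : ℝ) : ℂ) • proj ξ.1 (best ξ.1 ξ.2)

section QBC

variable {M N L : ℕ}

theorem norm_combined_sq (A : Matrix (Fin M) (Fin M) ℂ)
    (ξ : (Fin M → Fin N → ℂ) × (Fin L → EuclideanSpace ℂ (Fin N))) :
    ‖combined A ξ‖ ^ 2 = effGain A ξ.1 (best ξ.1 ξ.2) := by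
  rw [combined, effGain, norm_smul, Complex.norm_real, norm_inv, norm_norm, mul_pow, inv_pow,
    div_eq_inv_mul]

theorem measurable_combined (A : Matrix (Fin M) (Fin M) ℂ) :
    Measurable fun ξ : (Fin M → Fin N → ℂ) × (Fin L → EuclideanSpace ℂ (Fin N)) =>
      combined A ξ := by
  have hb : Measurable fun ξ : (Fin M → Fin N → ℂ) × (Fin L → EuclideanSpace ℂ (Fin N)) =>
      (ξ.1, best ξ.1 ξ.2) := measurable_fst.prodMk measurable_best
  have hF : Measurable fun p : (Fin M → Fin N → ℂ) × EuclideanSpace ℂ (Fin N) =>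
      ((‖mulE A (coef p.1 p.2)‖⁻¹ : ℝ) : ℂ) • proj p.1 p.2 := by
    have hn : Measurable fun p : (Fin M → Fin N → ℂ) × EuclideanSpace ℂ (Fin N) =>
        ‖mulE A (coef p.1 p.2)‖⁻¹ :=
      ((continuous_mulE A).measurable.comp measurable_coef).norm.inv
    exact (Complex.measurable_ofReal.comp hn).smul measurable_proj
  have h := hF.comp hb
  exact h

/-- Quantization-based combining selects the best codeword, and the combined channel is
determined up to a phase. -/
theorem IsQBC.eq_best {R : Matrix (Fin M) (Fin M) ℂ} (hR : R.PosDef) {X : Fin M → Fin N → ℂ}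
    (hX : (rowGram X).PosDef) {C : Fin L → EuclideanSpace ℂ (Fin N)} (hC : ∀ i, ‖C i‖ = 1)
    {i : Fin L} (hi : ∀ j, j ≠ i → ‖proj X (C j)‖ < ‖proj X (C i)‖) (h0 : ‖proj X (C i)‖ ≠ 0)
    {c : EuclideanSpace ℂ (Fin M)} {hbar : EuclideanSpace ℂ (Fin N)}
    (h : IsQBC (channel R X) C c hbar) :
    hbar = best X C ∧ ∃ z : ℂ, ‖z‖ = 1 ∧
      effChannel (channel R X) c = z • combined (whitening R) (X, C) := by
  have hcomb : ∀ c, effChannel (channel R X) c = mulE (Matrix.of X)ᴴ (mulE (CFC.sqrt R) c) := by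
    intro c
    rw [effChannel_eq, channel, Matrix.conjTranspose_mul, sqrt_conjTranspose, mulE_mulE]
  have hinj : ∀ b, mulE (Matrix.of X)ᴴ b = 0 → b = 0 := by
    intro b hb
    rw [← mulE_one b, ← Matrix.nonsing_inv_mul _ ((Matrix.isUnit_iff_isUnit_det _).1 hX.isUnit),
      ← mulE_mulE, rowGram, ← mulE_mulE, hb, mulE_zero, mulE_zero]
  have hne : ∀ c : EuclideanSpace ℂ (Fin M), ‖c‖ = 1 → effChannel (channel R X) c ≠ 0 := by
    intro c hc hz
    rw [hcomb] at hz
    have h1 := hinj _ hz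
    have h2 : c = 0 := by
      rw [← mulE_one c, ← whitening_mul_sqrt hR, ← mulE_mulE, h1, mulE_zero]
    rw [h2, norm_zero] at hc
    exact zero_ne_one hc
  have hinner : ∀ c u, inner ℂ (effChannel (channel R X) c) u =
      inner ℂ (effChannel (channel R X) c) (proj X u) := by
    intro c u
    rw [hcomb, inner_mulE_proj hX]
  -- The combined channel lies in the row space, so `u` may be replaced by its projection;
  -- Cauchy–Schwarz then bounds the alignment.
  have hge : ∀ c : EuclideanSpace ℂ (Fin M), ‖c‖ = 1 → ∀ u,
      1 - ‖proj X u‖ ^ 2 ≤ chordalSq (effChannel (channel R X) c) u := by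
    intro c hc u
    have hn : 0 < ‖effChannel (channel R X) c‖ := norm_pos_iff.2 (hne c hc)
    rw [chordalSq, hinner]
    refine sub_le_sub_left ?_ 1
    rw [div_le_iff₀ (by positivity), ← mul_pow, mul_comm]
    exact pow_le_pow_left₀ (norm_nonneg _) (norm_inner_le_norm _ _) 2
  have hle1 : ∀ j, ‖proj X (C j)‖ ^ 2 ≤ 1 := by
    intro j
    have := norm_proj_le hX (C j)
    rw [hC] at this
    exact pow_le_one₀ (norm_nonneg _) this
  set d := coef X (C i) with hd
  have hd0 : d ≠ 0 := fun e => h0 (by rw [norm_eq_zero, ← proj_eq_zero_iff hX]; exact e)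
  set a := mulE (whitening R) d with ha
  have ha0 : a ≠ 0 := fun e => hd0 (mulE_whitening_eq_zero hR e)
  have hsa : mulE (CFC.sqrt R) a = d := by
    rw [ha, mulE_mulE, sqrt_mul_whitening hR, mulE_one]
  have hbest : best X C = C i := best_eq hi
  -- The combiner proportional to `R^{-1/2} (XXᴴ)⁻¹ X u` attains the bound, since its combined
  -- channel is a multiple of the projection.
  have hopt : chordalSq (effChannel (channel R X) (dir a)) (C i) = 1 - ‖proj X (C i)‖ ^ 2 := by
    have e1 : effChannel (channel R X) (dir a) = ((‖a‖ : ℂ)⁻¹) • proj X (C i) := by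
      rw [hcomb, dir, mulE_smul, mulE_smul, hsa]
      rfl
    have hna : ‖a‖ ≠ 0 := norm_ne_zero_iff.2 ha0
    rw [chordalSq, e1, inner_smul_left, inner_proj_self hX, norm_mul, norm_smul]
    simp only [RCLike.norm_conj, norm_inv, Complex.norm_real, norm_norm, norm_pow]
    field_simp
  obtain ⟨j, hj⟩ := h.mem_codebook
  have hmin := h.minimal (dir a) (norm_dir ha0) i
  have hsq : chordalSq (effChannel (channel R X) c) hbar ≤ 1 - ‖proj X (C i)‖ ^ 2 := by
    rw [← hopt]
    unfold chordal at hmin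
    refine (Real.sqrt_le_sqrt_iff ?_).1 hmin
    rw [hopt]
    linarith [hle1 i]
  have hji : j = i := by
    by_contra hne'
    have h1 := hi j hne'
    have h2 := (hge c h.norm_combiner hbar).trans hsq
    rw [hj] at h2
    have := norm_nonneg (proj X (C j))
    nlinarith
  subst hji
  refine ⟨by rw [hbest, hj], ?_⟩
  set e := effChannel (channel R X) c with he
  have hen : 0 < ‖e‖ := norm_pos_iff.2 (hne c h.norm_combiner)
  have hpn : proj X (C j) ≠ 0 := norm_ne_zero_iff.1 h0
  -- Optimality forces equality in Cauchy–Schwarz, so the channel is parallel to the projection. The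
  -- unit norm of the combiner then fixes the modulus of the factor and leaves only a phase.
  have heq : ‖inner ℂ (proj X (C j)) e‖ = ‖proj X (C j)‖ * ‖e‖ := by
    refine le_antisymm (norm_inner_le_norm _ _) ?_
    rw [hj, chordalSq, hinner, ← he] at hsq
    have h1 : ‖proj X (C j)‖ ^ 2 ≤ ‖inner ℂ e (proj X (C j))‖ ^ 2 / ‖e‖ ^ 2 := by linarith
    rw [le_div_iff₀ (by positivity), ← mul_pow] at h1
    rw [← norm_inner_symm] at h1
    exact (sq_le_sq₀ (by positivity) (norm_nonneg _)).1 h1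
  obtain ⟨r, hr0, hr⟩ := (norm_inner_eq_norm_iff hpn (norm_pos_iff.1 hen)).1 heq
  have hsc : mulE (CFC.sqrt R) c = r • d := by
    have h1 : mulE (Matrix.of X)ᴴ (mulE (CFC.sqrt R) c - r • d) = 0 := by
      rw [mulE_sub, ← hcomb, ← he, hr, mulE_smul]
      exact sub_self _
    exact sub_eq_zero.1 (hinj _ h1)
  have hca : c = r • a := by
    rw [← mulE_one c, ← whitening_mul_sqrt hR, ← mulE_mulE, hsc, mulE_smul]
  have hna : ‖a‖ ≠ 0 := norm_ne_zero_iff.2 ha0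
  have hnr : ‖r‖ * ‖a‖ = 1 := by rw [← norm_smul, ← hca, h.norm_combiner]
  refine ⟨r * (‖a‖ : ℂ), by rw [norm_mul, Complex.norm_real, norm_norm, hnr], ?_⟩
  rw [hr, combined, hbest, smul_smul]
  congr 1
  change r = r * (‖a‖ : ℂ) * ((‖a‖⁻¹ : ℝ) : ℂ)
  push_cast
  rw [mul_assoc, mul_inv_cancel₀ (by exact_mod_cast hna), mul_one]

end QBC

end ZFC
end

/-! ### Joint law of the combined channel and its codeword for one user. -/

noncomputable section
open scoped ENNReal
namespace ZFC

/-- Law of the channel and the codebook of a user. -/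
def userLaw (M N L : ℕ) : Measure ((Fin M → Fin N → ℂ) × (Fin L → EuclideanSpace ℂ (Fin N))) :=
  (gaussMatrix M N).prod (codeLaw L N)

instance (M N L : ℕ) : IsProbabilityMeasure (userLaw M N L) := by unfold userLaw; infer_instance

/-- The combined channel of a user and its quantization. -/
def channelPair {M N L : ℕ} (A : Matrix (Fin M) (Fin M) ℂ)
    (ξ : (Fin M → Fin N → ℂ) × (Fin L → EuclideanSpace ℂ (Fin N))) :
    EuclideanSpace ℂ (Fin N) × EuclideanSpace ℂ (Fin N) :=
  (combined A ξ, best ξ.1 ξ.2)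

theorem measurable_channelPair {M N L : ℕ} (A : Matrix (Fin M) (Fin M) ℂ) :
    Measurable fun ξ : (Fin M → Fin N → ℂ) × (Fin L → EuclideanSpace ℂ (Fin N)) =>
      channelPair A ξ :=
  (measurable_combined A).prodMk measurable_best

theorem channelPair_rotate {M N L : ℕ} (A : Matrix (Fin M) (Fin M) ℂ)
    {V : Matrix (Fin N) (Fin N) ℂ} (hV : Vᴴ * V = 1)
    {U : EuclideanSpace ℂ (Fin N) ≃ₗᵢ[ℂ] EuclideanSpace ℂ (Fin N)} (hU : ∀ v, U v = mulE V v)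
    (X : Fin M → Fin N → ℂ) (C : Fin L → EuclideanSpace ℂ (Fin N)) :
    channelPair A (rotR V X, fun i => U (C i)) =
      Prod.map U U (channelPair A (X, C)) := by
  have hb : best (rotR V X) (fun i => U (C i)) = U (best X C) := by
    refine best_equivariant X _ C U fun i => ?_
    rw [hU, proj_rotR X hV, norm_mulE_unitary hV]
  have h1 : coef (rotR V X) (U (best X C)) = coef X (best X C) := by
    rw [hU, coef_rotR X hV]
  have h2 : proj (rotR V X) (U (best X C)) = U (proj X (best X C)) := by
    rw [hU, proj_rotR X hV, hU]
  simp only [channelPair, combined, Prod.map_apply, hb, h1, h2, map_smul]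

/-- Rotating the antenna space simultaneously in the channel and in all codewords preserves their
law and rotates the resulting pair. -/
theorem userLaw_map_channelPair {M N L : ℕ} (A : Matrix (Fin M) (Fin M) ℂ)
    (U : EuclideanSpace ℂ (Fin N) ≃ₗᵢ[ℂ] EuclideanSpace ℂ (Fin N)) :
    ((userLaw M N L).map (channelPair A)).map (Prod.map U U) =
      (userLaw M N L).map (channelPair A) := by
  obtain ⟨V, hV, -, hU⟩ := exists_matrix_unitary U
  have hUm : Measurable fun (C : Fin L → EuclideanSpace ℂ (Fin N)) i => U (C i) :=
    measurable_pi_lambda _ fun i => U.continuous.measurable.comp (measurable_pi_apply i)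
  have hinv : (userLaw M N L).map (Prod.map (rotR V) fun C i => U (C i)) = userLaw M N L := by
    rw [userLaw, ← Measure.map_prod_map _ _ (measurable_rotR V) hUm, gaussMatrix_rotR hV,
      codeLaw_map]
  have hcomp : Prod.map U U ∘ (channelPair A : (Fin M → Fin N → ℂ) × (Fin L → _) → _) =
      channelPair A ∘ Prod.map (rotR V) fun C i => U (C i) := by
    funext ⟨X, C⟩
    exact (channelPair_rotate A hV hU X C).symm
  rw [Measure.map_map (U.continuous.measurable.prodMap U.continuous.measurable)
    (measurable_channelPair A), hcomp, ← Measure.map_map (measurable_channelPair A)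
    ((measurable_rotR V).prodMap hUm), hinv]

section

variable {M m L : ℕ}

theorem ae_userLaw_regular (hM : M ≠ 0) (hm : m ≠ 0) [NeZero L] :
    ∀ᵐ ξ ∂userLaw M (M + m) L, (rowGram ξ.1).PosDef ∧ (∀ i, ‖ξ.2 i‖ = 1) ∧
      ∃ i, (∀ j, j ≠ i → ‖proj ξ.1 (ξ.2 j)‖ < ‖proj ξ.1 (ξ.2 i)‖) ∧
        best ξ.1 ξ.2 = ξ.2 i ∧ ‖proj ξ.1 (ξ.2 i)‖ ≠ 0 := by
  have h1 : ∀ᵐ ξ ∂userLaw M (M + m) L, (rowGram ξ.1).PosDef :=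
    (Measure.quasiMeasurePreserving_fst (μ := gaussMatrix M (M + m))
      (ν := codeLaw L (M + m))).ae (ae_rowGram_posDef (Nat.le_add_right M m))
  have h2 : ∀ᵐ ξ ∂userLaw M (M + m) L, ∀ i, ‖ξ.2 i‖ = 1 :=
    (Measure.quasiMeasurePreserving_snd (μ := gaussMatrix M (M + m))
      (ν := codeLaw L (M + m))).ae (ae_codeLaw (sphereLaw_norm (by omega)))
  have hmp : ∀ j, Measurable fun p : (Fin M → Fin (M + m) → ℂ) × (Fin L → _) =>
      ‖proj p.1 (p.2 j)‖ := fun j =>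
    (measurable_proj.comp (measurable_fst.prodMk
      ((measurable_pi_apply j).comp measurable_snd))).norm
  have h3 : ∀ᵐ ξ ∂userLaw M (M + m) L, ∀ i j, i ≠ j →
      ‖proj ξ.1 (ξ.2 i)‖ ≠ ‖proj ξ.1 (ξ.2 j)‖ := by
    have hms : MeasurableSet {ξ : (Fin M → Fin (M + m) → ℂ) × (Fin L → _) | ∀ i j, i ≠ j →
        ‖proj ξ.1 (ξ.2 i)‖ ≠ ‖proj ξ.1 (ξ.2 j)‖} := by
      simp only [Set.ofPred_forall]
      exact MeasurableSet.iInter fun i => MeasurableSet.iInter fun j =>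
        MeasurableSet.iInter fun _ => (measurableSet_eq_fun (hmp i) (hmp j)).compl
    refine (Measure.ae_prod_iff_ae_ae hms).2 ?_
    filter_upwards [ae_rowGram_posDef (Nat.le_add_right M m)] with X hX
    filter_upwards [ae_injective_norm_proj hM hm hX] with C hC i j hij e
    exact hij (hC e)
  have h4 : ∀ᵐ ξ ∂userLaw M (M + m) L, ∀ i, ‖proj ξ.1 (ξ.2 i)‖ ≠ 0 := by
    have hms : MeasurableSet {ξ : (Fin M → Fin (M + m) → ℂ) × (Fin L → _) | ∀ i,
        ‖proj ξ.1 (ξ.2 i)‖ ≠ 0} := by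
      simp only [Set.ofPred_forall]
      exact MeasurableSet.iInter fun i => (measurableSet_eq_fun (hmp i) measurable_const).compl
    refine (Measure.ae_prod_iff_ae_ae hms).2 ?_
    filter_upwards [ae_rowGram_posDef (Nat.le_add_right M m)] with X hX
    exact ae_codeLaw (ae_norm_proj_ne hM hm hX 0)
  filter_upwards [h1, h2, h3, h4] with ξ e1 e2 e3 e4
  obtain ⟨i, hi⟩ := exists_best (X := ξ.1) (C := ξ.2) fun i j hij => by
    by_contra hne
    exact e3 i j hne hij
  exact ⟨e1, e2, i, hi, best_eq hi, e4 i⟩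

theorem inner_combined_best {N : ℕ} {X : Fin M → Fin N → ℂ} (hX : (rowGram X).PosDef)
    (A : Matrix (Fin M) (Fin M) ℂ) (C : Fin L → EuclideanSpace ℂ (Fin N)) :
    ‖inner ℂ (combined A (X, C)) (best X C)‖ ^ 2 =
      ‖combined A (X, C)‖ ^ 2 * ‖proj X (best X C)‖ ^ 2 := by
  simp only [combined]
  rw [inner_smul_left, inner_proj_self hX, norm_smul, norm_mul]
  simp only [RCLike.norm_conj, Complex.norm_real, norm_inv, norm_norm, norm_pow]
  ring

/-- Law of the combined channel and its quantization: what the rate analysis uses. -/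
structure IsPairLaw {N : ℕ} (τ : Measure (EuclideanSpace ℂ (Fin N) × EuclideanSpace ℂ (Fin N))) :
    Prop where
  isProbabilityMeasure : IsProbabilityMeasure τ
  map_unitary : ∀ U : EuclideanSpace ℂ (Fin N) ≃ₗᵢ[ℂ] EuclideanSpace ℂ (Fin N),
    τ.map (Prod.map U U) = τ
  ae_ne_zero : ∀ᵐ p ∂τ, p.1 ≠ 0
  ae_norm_eq_one : ∀ᵐ p ∂τ, ‖p.2‖ = 1

variable {R : Matrix (Fin M) (Fin M) ℂ}

theorem ae_combined (hM : M ≠ 0) (hm : m ≠ 0) [NeZero L] (hR : R.PosDef) :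
    ∀ᵐ ξ ∂userLaw M (M + m) L, combined (whitening R) ξ ≠ 0 ∧ ‖best ξ.1 ξ.2‖ = 1 ∧
      chordalSq (combined (whitening R) ξ) (best ξ.1 ξ.2) = 1 - ‖proj ξ.1 (best ξ.1 ξ.2)‖ ^ 2 := by
  filter_upwards [ae_userLaw_regular (L := L) hM hm] with ξ ⟨hX, hC, i, hi, hb, h0⟩
  have hp : proj ξ.1 (best ξ.1 ξ.2) ≠ 0 := by rw [hb]; exact norm_ne_zero_iff.1 h0
  have hd : mulE (whitening R) (coef ξ.1 (best ξ.1 ξ.2)) ≠ 0 := fun h =>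
    hp ((proj_eq_zero_iff hX _).1 (mulE_whitening_eq_zero hR h))
  have hne : combined (whitening R) ξ ≠ 0 := by
    rw [combined]
    refine smul_ne_zero ?_ hp
    exact_mod_cast inv_ne_zero (norm_ne_zero_iff.2 hd)
  refine ⟨hne, by rw [hb, hC], ?_⟩
  rw [chordalSq]
  have h := inner_combined_best hX (whitening R) ξ.2
  change ‖inner ℂ (combined (whitening R) ξ) (best ξ.1 ξ.2)‖ ^ 2 = _ at h
  rw [h]
  have : ‖combined (whitening R) ξ‖ ^ 2 ≠ 0 := pow_ne_zero 2 (norm_ne_zero_iff.2 hne)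
  change 1 - ‖combined (whitening R) ξ‖ ^ 2 * _ / _ = _
  rw [mul_div_cancel_left₀ _ this]

theorem isPairLaw_userLaw (hM : M ≠ 0) (hm : m ≠ 0) [NeZero L] (hR : R.PosDef) :
    IsPairLaw ((userLaw M (M + m) L).map (channelPair (whitening R))) where
  isProbabilityMeasure :=
    Measure.isProbabilityMeasure_map (measurable_channelPair _).aemeasurable
  map_unitary := userLaw_map_channelPair _
  ae_ne_zero := by
    refine (ae_map_iff (p := fun p => p.1 ≠ 0) (measurable_channelPair _).aemeasurable
      (measurable_fst (measurableSet_singleton 0).compl)).2 ?_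
    filter_upwards [ae_combined (L := L) hM hm hR] with ξ h using h.1
  ae_norm_eq_one := by
    rw [ae_map_iff (measurable_channelPair _).aemeasurable
      (measurableSet_eq_fun measurable_snd.norm measurable_const)]
    filter_upwards [ae_combined (L := L) hM hm hR] with ξ h using h.2.1

theorem measurable_chordalSq {N : ℕ} :
    Measurable fun p : EuclideanSpace ℂ (Fin N) × EuclideanSpace ℂ (Fin N) =>
      chordalSq p.1 p.2 := by
  unfold chordalSq
  exact measurable_const.sub (((measurable_fst.inner measurable_snd).norm.pow_const 2).div
    (measurable_fst.norm.pow_const 2))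

/-- Given the channel, error and gain factorize by `lintegral_best`. The mean of the error factor is
the same for every full-rank channel, so it leaves the average over channels. -/
theorem lintegral_userLaw {φ : ℝ → ℝ≥0∞} (hφ : Measurable φ) (hM : M ≠ 0) (hm : m ≠ 0) [NeZero L]
    (A : Matrix (Fin M) (Fin M) ℂ) {d : ℝ≥0∞}
    (hd : ∀ X : Fin M → Fin (M + m) → ℂ, (rowGram X).PosDef →
      ∫⁻ C, φ ‖proj X (best X C)‖ ∂codeLaw L (M + m) = d) :
    ∫⁻ ξ, φ ‖proj ξ.1 (best ξ.1 ξ.2)‖ * ENNReal.ofReal (effGain A ξ.1 (best ξ.1 ξ.2))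
        ∂userLaw M (M + m) L = d * ∫⁻ X, meanGain A X ∂gaussMatrix M (M + m) := by
  have hb : Measurable fun ξ : (Fin M → Fin (M + m) → ℂ) × (Fin L → EuclideanSpace ℂ _) =>
      (ξ.1, best ξ.1 ξ.2) := measurable_fst.prodMk measurable_best
  have hF : Measurable fun p : (Fin M → Fin (M + m) → ℂ) × EuclideanSpace ℂ (Fin (M + m)) =>
      φ ‖proj p.1 p.2‖ * ENNReal.ofReal (effGain A p.1 p.2) :=
    (hφ.comp measurable_proj.norm).mul (measurable_effGain A).ennreal_ofReal
  have hFb := hF.comp hb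
  have hmg : Measurable fun X : Fin M → Fin (M + m) → ℂ => meanGain A X :=
    (measurable_effGain A).ennreal_ofReal.lintegral_prod_right'
  rw [userLaw]
  refine (lintegral_prod _ hFb.aemeasurable).trans ?_
  rw [← lintegral_const_mul _ hmg]
  refine lintegral_congr_ae ?_
  filter_upwards [ae_rowGram_posDef (Nat.le_add_right M m)] with X hX
  refine (lintegral_best (L := L) hM hm hX A hφ).trans ?_
  rw [hd X hX]

theorem minBetaMean_nonneg (M m n : ℕ) : 0 ≤ minBetaMean M m n :=
  integral_nonneg fun _ => pow_nonneg measureReal_nonneg n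

/-- Distortion and gain are uncorrelated. This product moment is what the mean interference reduces
to. -/
theorem lintegral_chordalSq_mul (hM : M ≠ 0) (hm : m ≠ 0) [NeZero L] (hR : R.PosDef) :
    ∫⁻ p, ENNReal.ofReal (chordalSq p.1 p.2) * ENNReal.ofReal (‖p.1‖ ^ 2)
        ∂((userLaw M (M + m) L).map (channelPair (whitening R))) =
      ENNReal.ofReal (minBetaMean M m L) *
        ∫⁻ X, meanGain (whitening R) X ∂gaussMatrix M (M + m) := by
  have hφ : Measurable fun r : ℝ => ENNReal.ofReal (1 - r ^ 2) := by fun_prop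
  rw [← lintegral_userLaw hφ hM hm (whitening R)
    fun X hX => lintegral_one_sub_proj_best (L := L) hM hm hX]
  refine (lintegral_map (measurable_chordalSq.ennreal_ofReal.mul
    (measurable_fst.norm.pow_const 2).ennreal_ofReal) (measurable_channelPair _)).trans ?_
  refine lintegral_congr_ae ?_
  filter_upwards [ae_combined (L := L) hM hm hR] with ξ h
  simp only [channelPair, Pi.mul_apply, h.2.2, norm_combined_sq]

theorem lintegral_norm_sq (hM : M ≠ 0) (hm : m ≠ 0) [NeZero L] :
    ∫⁻ p, ENNReal.ofReal (‖p.1‖ ^ 2)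
        ∂((userLaw M (M + m) L).map (channelPair (whitening R))) =
      ∫⁻ X, meanGain (whitening R) X ∂gaussMatrix M (M + m) := by
  have h := lintegral_userLaw (L := L) (φ := fun _ => 1) measurable_const hM hm (whitening R)
    (d := 1) fun X _ => by simp
  simp only [one_mul] at h
  rw [← h, lintegral_map (measurable_fst.norm.pow_const 2).ennreal_ofReal
    (measurable_channelPair _)]
  simp only [channelPair, norm_combined_sq]

theorem lintegral_chordalSq (hM : M ≠ 0) (hm : m ≠ 0) [NeZero L] (hR : R.PosDef) :
    ∫⁻ p, ENNReal.ofReal (chordalSq p.1 p.2)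
        ∂((userLaw M (M + m) L).map (channelPair (whitening R))) =
      ENNReal.ofReal (minBetaMean M m L) := by
  have hb : Measurable fun ξ : (Fin M → Fin (M + m) → ℂ) × (Fin L → EuclideanSpace ℂ _) =>
      (ξ.1, best ξ.1 ξ.2) := measurable_fst.prodMk measurable_best
  have hF : Measurable fun p : (Fin M → Fin (M + m) → ℂ) × EuclideanSpace ℂ (Fin (M + m)) =>
      ENNReal.ofReal (1 - ‖proj p.1 p.2‖ ^ 2) :=
    (measurable_const.sub (measurable_proj.norm.pow_const 2)).ennreal_ofReal
  have hFb := hF.comp hb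
  rw [lintegral_map measurable_chordalSq.ennreal_ofReal (measurable_channelPair _)]
  have h1 : ∫⁻ ξ, ENNReal.ofReal (chordalSq (channelPair (whitening R) ξ).1
      (channelPair (whitening R) ξ).2) ∂userLaw M (M + m) L =
      ∫⁻ ξ, ENNReal.ofReal (1 - ‖proj ξ.1 (best ξ.1 ξ.2)‖ ^ 2) ∂userLaw M (M + m) L := by
    refine lintegral_congr_ae ?_
    filter_upwards [ae_combined (L := L) hM hm hR] with ξ h
    simp only [channelPair, h.2.2]
  rw [h1, userLaw]
  refine (lintegral_prod _ hFb.aemeasurable).trans ?_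
  have h2 : ∀ᵐ X ∂gaussMatrix M (M + m),
      ∫⁻ C, ENNReal.ofReal (1 - ‖proj X (best X C)‖ ^ 2) ∂codeLaw L (M + m) =
        ENNReal.ofReal (minBetaMean M m L) := by
    filter_upwards [ae_rowGram_posDef (Nat.le_add_right M m)] with X hX
    exact lintegral_one_sub_proj_best hM hm hX
  refine (lintegral_congr_ae h2).trans ?_
  simp

end

end ZFC
end

/-! ### Signal and interference under zero forcing as distances to spans. -/

noncomputable section
open scoped ENNReal
namespace ZFC

section PairLaw

variable {n : ℕ} {τ : Measure (EuclideanSpace ℂ (Fin n) × EuclideanSpace ℂ (Fin n))}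

theorem IsPairLaw.fst_submodule (h : IsPairLaw τ) (hn : n ≠ 0)
    (W : Submodule ℂ (EuclideanSpace ℂ (Fin n))) (hW : W ≠ ⊤) : τ.map Prod.fst W = 0 := by
  have := h.isProbabilityMeasure
  have : IsProbabilityMeasure (τ.map Prod.fst) :=
    Measure.isProbabilityMeasure_map measurable_fst.aemeasurable
  refine submodule_null_of_invariant hn _ (fun U => ?_) ?_ W hW
  · conv_rhs => rw [← h.map_unitary U]
    rw [Measure.map_map U.continuous.measurable measurable_fst, Measure.map_map measurable_fst
      (U.continuous.measurable.prodMap U.continuous.measurable)]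
    rfl
  · exact (ae_map_iff (p := fun y => y ≠ 0) measurable_fst.aemeasurable
      (measurableSet_singleton 0).compl).2 h.ae_ne_zero

theorem IsPairLaw.snd_submodule (h : IsPairLaw τ) (hn : n ≠ 0)
    (W : Submodule ℂ (EuclideanSpace ℂ (Fin n))) (hW : W ≠ ⊤) : τ.map Prod.snd W = 0 := by
  have := h.isProbabilityMeasure
  have : IsProbabilityMeasure (τ.map Prod.snd) :=
    Measure.isProbabilityMeasure_map measurable_snd.aemeasurable
  refine submodule_null_of_invariant hn _ (fun U => ?_) ?_ W hW
  · conv_rhs => rw [← h.map_unitary U]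
    rw [Measure.map_map U.continuous.measurable measurable_snd, Measure.map_map measurable_snd
      (U.continuous.measurable.prodMap U.continuous.measurable)]
    rfl
  · refine (ae_map_iff (p := fun y => y ≠ 0) measurable_snd.aemeasurable
      (measurableSet_singleton 0).compl).2 ?_
    filter_upwards [h.ae_norm_eq_one] with p hp h0
    rw [h0, norm_zero] at hp
    exact zero_ne_one hp

theorem IsPairLaw.lintegral_inner (h : IsPairLaw τ) {φ : ℝ → ℝ≥0∞} (hφ : Measurable φ)
    {v w : EuclideanSpace ℂ (Fin n)} (hv : ‖v‖ = 1) (hw : ‖w‖ = 1) :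
    ∫⁻ p, φ ‖inner ℂ p.1 v‖ ∂τ = ∫⁻ p, φ ‖inner ℂ p.1 w‖ ∂τ := by
  obtain ⟨U, hU⟩ := exists_unitary_of_norm_eq (hv.trans hw.symm)
  have hm : Measurable fun p : EuclideanSpace ℂ (Fin n) × EuclideanSpace ℂ (Fin n) =>
      φ ‖inner ℂ p.1 w‖ := hφ.comp (measurable_fst.inner measurable_const).norm
  conv_rhs => rw [← h.map_unitary U,
    lintegral_map hm (U.continuous.measurable.prodMap U.continuous.measurable)]
  refine lintegral_congr fun p => ?_
  rw [Prod.map_fst, ← hU, U.inner_map_map]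

end PairLaw

theorem spanDist_congr {ι : Type*} {n : ℕ} {t : Finset ι} {z z' : ι → EuclideanSpace ℂ (Fin n)}
    (h : ∀ j ∈ t, z j = z' j) (x : EuclideanSpace ℂ (Fin n)) :
    spanDist t z x = spanDist t z' x := by
  unfold spanDist
  congr 1
  funext q
  rw [Finset.sum_congr rfl fun j hj => by rw [h j hj]]

theorem spanDist_map {ι : Type*} {n : ℕ} (t : Finset ι) (z : ι → EuclideanSpace ℂ (Fin n))
    (U : EuclideanSpace ℂ (Fin n) ≃ₗᵢ[ℂ] EuclideanSpace ℂ (Fin n))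
    (x : EuclideanSpace ℂ (Fin n)) :
    spanDist t (fun j => U (z j)) (U x) = spanDist t z x := by
  unfold spanDist
  congr 1
  funext q
  rw [← U.norm_map (x - _), map_sub, map_sum]
  simp

theorem pi_map_unitary {ι : Type*} [Fintype ι] {n : ℕ}
    {τ : ι → Measure (EuclideanSpace ℂ (Fin n) × EuclideanSpace ℂ (Fin n))} [∀ l, IsProbabilityMeasure (τ l)] (hτ : ∀ l, IsPairLaw (τ l))
    (U : EuclideanSpace ℂ (Fin n) ≃ₗᵢ[ℂ] EuclideanSpace ℂ (Fin n)) :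
    (Measure.pi τ).map (fun z l => Prod.map U U (z l)) = Measure.pi τ := by
  have hU : Measurable (Prod.map U U) := U.continuous.measurable.prodMap U.continuous.measurable
  have : ∀ l, IsProbabilityMeasure ((τ l).map (Prod.map U U)) := fun l =>
    Measure.isProbabilityMeasure_map hU.aemeasurable
  rw [Measure.pi_map_pi fun _ => hU.aemeasurable]
  congr 1
  funext l
  exact (hτ l).map_unitary U

section Users

variable {ι : Type*} [Fintype ι] [DecidableEq ι] {n : ℕ}
  {τ : ι → Measure (EuclideanSpace ℂ (Fin n) × EuclideanSpace ℂ (Fin n))}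

theorem ae_linearIndepOn_comp [∀ l, IsProbabilityMeasure (τ l)]
    {π : EuclideanSpace ℂ (Fin n) × EuclideanSpace ℂ (Fin n) → EuclideanSpace ℂ (Fin n)}
    (hπ : Measurable π)
    (hW : ∀ l, ∀ W : Submodule ℂ (EuclideanSpace ℂ (Fin n)), W ≠ ⊤ → (τ l).map π W = 0)
    (t : Finset ι) (ht : t.card ≤ n) :
    ∀ᵐ z ∂Measure.pi τ, LinearIndepOn ℂ (fun j => π (z j)) (t : Set ι) := by
  have : ∀ l, IsProbabilityMeasure ((τ l).map π) := fun l =>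
    Measure.isProbabilityMeasure_map hπ.aemeasurable
  have h := ae_linearIndepOn (fun l => (τ l).map π) hW t ht
  rw [← Measure.pi_map_pi fun _ => hπ.aemeasurable] at h
  exact ae_of_ae_map (Measurable.aemeasurable (measurable_pi_lambda _ fun l =>
    hπ.comp (measurable_pi_apply l))) h

/-- The span does not involve user `k`. Given the span, the distance is the modulus of an inner
product with a unit normal, and isotropy of the channel makes the choice of normal irrelevant. Since
`π` may be either component of the pair, exact and quantized beamforming deliver the same signal
law. -/
theorem lintegral_spanDist [∀ l, IsProbabilityMeasure (τ l)] {k : ι} (hk : IsPairLaw (τ k))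
    {π : EuclideanSpace ℂ (Fin n) × EuclideanSpace ℂ (Fin n) → EuclideanSpace ℂ (Fin n)}
    (hπ : Measurable π)
    {t : Finset ι} (ht : t.card + 1 = n) (hkt : k ∉ t)
    (hind : ∀ᵐ z ∂Measure.pi τ, LinearIndepOn ℂ (fun j => π (z j)) (t : Set ι))
    {φ : ℝ → ℝ≥0∞} (hφ : Measurable φ) {w : EuclideanSpace ℂ (Fin n)} (hw : ‖w‖ = 1) :
    ∫⁻ z, φ (spanDist t (fun j => π (z j)) (z k).1) ∂Measure.pi τ =
      ∫⁻ p, φ ‖inner ℂ p.1 w‖ ∂τ k := by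
  have hmp := measurePreserving_update τ k
  have hm : Measurable fun z : ι → EuclideanSpace ℂ (Fin n) × EuclideanSpace ℂ (Fin n) =>
      φ (spanDist t (fun j => π (z j)) (z k).1) := by
    have h1 : Measurable fun z : ι → EuclideanSpace ℂ (Fin n) × EuclideanSpace ℂ (Fin n) =>
        ((fun j => π (z j)), (z k).1) :=
      (measurable_pi_lambda _ fun j => hπ.comp (measurable_pi_apply j)).prodMk
        (measurable_fst.comp (measurable_pi_apply k))
    have h2 := (measurable_spanDist t).comp h1
    exact hφ.comp h2
  rw [← hmp.lintegral_comp hm]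
  refine (lintegral_prod _ (hm.comp hmp.measurable).aemeasurable).trans ?_
  have h : ∀ᵐ z ∂Measure.pi τ, ∫⁻ p, φ (spanDist t
      (fun j => π (Function.update z k p j)) (Function.update z k p k).1) ∂τ k =
      ∫⁻ p, φ ‖inner ℂ p.1 w‖ ∂τ k := by
    filter_upwards [hind] with z hz
    obtain ⟨w', hw', horth⟩ := exists_unit_orthogonal (t := t) (fun j => π (z j)) (by omega)
    rw [← hk.lintegral_inner hφ hw' hw]
    refine lintegral_congr fun p => ?_
    rw [Function.update_self, ← spanDist_eq ht hz hw' horth]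
    congr 1
    refine spanDist_congr (fun j hj => ?_) _
    rw [Function.update_of_ne (by rintro rfl; exact hkt hj)]
  refine (lintegral_congr_ae h).trans ?_
  simp

/-- The stabilizer of `v` acts transitively on the unit vectors orthogonal to `v`: this expresses
isotropy inside that complement. -/
theorem exists_unitary_of_orthogonal {v e e' : EuclideanSpace ℂ (Fin n)} (hv : ‖v‖ = 1)
    (he : ‖e‖ = 1) (he' : ‖e'‖ = 1) (h : inner ℂ v e = 0) (h' : inner ℂ v e' = 0) :
    ∃ U : EuclideanSpace ℂ (Fin n) ≃ₗᵢ[ℂ] EuclideanSpace ℂ (Fin n), U v = v ∧ U e = e' := by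
  have hon : ∀ e : EuclideanSpace ℂ (Fin n), ‖e‖ = 1 → inner ℂ v e = 0 →
      Orthonormal ℂ ![v, e] := by
    intro e he h
    refine ⟨fun i => by fin_cases i <;> simp [hv, he], fun i j hij => ?_⟩
    fin_cases i <;> fin_cases j <;> simp_all [inner_eq_zero_symm]
  obtain ⟨U, hU⟩ := exists_unitary_of_orthonormal (hon e he h) (hon e' he' h')
  exact ⟨U, hU 0, hU 1⟩

theorem norm_sub_inner_smul_sq {v : EuclideanSpace ℂ (Fin n)} (hv : ‖v‖ = 1)
    (x : EuclideanSpace ℂ (Fin n)) :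
    ‖x - (inner ℂ v x) • v‖ ^ 2 = ‖x‖ ^ 2 - ‖inner ℂ x v‖ ^ 2 := by
  have h := norm_sub_sq (𝕜 := ℂ) x ((inner ℂ v x) • v)
  rw [h, inner_smul_right, norm_smul, hv, mul_one, ← norm_inner_symm x v]
  have : inner ℂ v x * inner ℂ x v = ((‖inner ℂ x v‖ ^ 2 : ℝ) : ℂ) := by
    rw [← inner_conj_symm v x, mul_comm, Complex.mul_conj']
    push_cast; rfl
  rw [this]
  have h2 : RCLike.re (((‖inner ℂ x v‖ ^ 2 : ℝ) : ℂ)) = ‖inner ℂ x v‖ ^ 2 := Complex.ofReal_re _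
  rw [h2]; ring

/-- Mean squared distance of `x` to the span of `v` and `n - 2` independent isotropic vectors. -/
theorem lintegral_spanDist_update [∀ l, IsProbabilityMeasure (τ l)] (hτ : ∀ l, IsPairLaw (τ l))
    {k : ι} {t : Finset ι} (ht : t.card + 1 = n) (hkt : k ∈ t)
    {v : EuclideanSpace ℂ (Fin n)} (hv : ‖v‖ = 1)
    (hind : ∀ᵐ z ∂Measure.pi τ,
      LinearIndepOn ℂ (Function.update (fun j => (z j).2) k v) (t : Set ι))
    (x : EuclideanSpace ℂ (Fin n)) :
    ((n - 1 : ℕ) : ℝ≥0∞) * ∫⁻ z, ENNReal.ofReal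
        (spanDist t (Function.update (fun j => (z j).2) k v) x ^ 2) ∂Measure.pi τ =
      ENNReal.ofReal (‖x‖ ^ 2 - ‖inner ℂ x v‖ ^ 2) := by
  set Z : (ι → EuclideanSpace ℂ (Fin n) × EuclideanSpace ℂ (Fin n)) →
    ι → EuclideanSpace ℂ (Fin n) := fun z => Function.update (fun j => (z j).2) k v with hZ
  have hZm : Measurable Z := by
    refine measurable_pi_lambda _ fun j => ?_
    by_cases hj : j = k
    · subst hj; simp only [hZ, Function.update_self]; exact measurable_const
    · simp only [hZ, Function.update_of_ne hj]
      exact measurable_snd.comp (measurable_pi_apply j)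
  have hsm : ∀ y, Measurable fun z => ENNReal.ofReal (spanDist t (Z z) y ^ 2) := by
    intro y
    have h1 := (measurable_spanDist t).comp (hZm.prodMk (measurable_const (a := y)))
    exact (h1.pow_const 2).ennreal_ofReal
  set g : EuclideanSpace ℂ (Fin n) → ℝ≥0∞ := fun y =>
    ∫⁻ z, ENNReal.ofReal (spanDist t (Z z) y ^ 2) ∂Measure.pi τ with hg
  have hnormal : ∀ᵐ z ∂Measure.pi τ, ∃ w : EuclideanSpace ℂ (Fin n), ‖w‖ = 1 ∧
      inner ℂ v w = 0 ∧ ∀ y, spanDist t (Z z) y = ‖inner ℂ y w‖ := by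
    filter_upwards [hind] with z hz
    obtain ⟨w, hw, horth⟩ := exists_unit_orthogonal (t := t) (Z z) (by omega)
    refine ⟨w, hw, ?_, fun y => spanDist_eq ht hz hw horth y⟩
    have := horth k hkt
    simpa [hZ] using this
  have hinv : ∀ U : EuclideanSpace ℂ (Fin n) ≃ₗᵢ[ℂ] EuclideanSpace ℂ (Fin n), U v = v →
      ∀ y, g (U y) = g y := by
    intro U hU y
    have hUm : Measurable fun (z : ι → EuclideanSpace ℂ (Fin n) × EuclideanSpace ℂ (Fin n)) l =>
        Prod.map U U (z l) := measurable_pi_lambda _ fun l =>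
      (U.continuous.measurable.prodMap U.continuous.measurable).comp (measurable_pi_apply l)
    simp only [hg]
    conv_lhs => rw [← pi_map_unitary hτ U, lintegral_map (hsm _) hUm]
    refine lintegral_congr fun z => ?_
    have : Z (fun l => Prod.map U U (z l)) = fun j => U (Z z j) := by
      funext j
      by_cases hj : j = k
      · subst hj; simp [hZ, hU]
      · simp [hZ, Function.update_of_ne hj]
    rw [this, spanDist_map]
  let i0 : Fin n := ⟨0, by omega⟩
  obtain ⟨V, hV⟩ := exists_unitary_of_norm_eq (x := EuclideanSpace.basisFun (Fin n) ℂ i0) (y := v)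
    (by rw [hv]; exact (EuclideanSpace.basisFun (Fin n) ℂ).orthonormal.norm_eq_one i0)
  let b := (EuclideanSpace.basisFun (Fin n) ℂ).map V
  have hb0 : b i0 = v := by rw [← hV]; exact OrthonormalBasis.map_apply _ _ _
  have hbv : ∀ i ∈ Finset.univ.erase i0, inner ℂ v (b i) = 0 := by
    intro i hi
    rw [← hb0]
    exact b.orthonormal.2 (Finset.ne_of_mem_erase hi).symm
  have hunit : ∀ e e' : EuclideanSpace ℂ (Fin n), ‖e‖ = 1 → ‖e'‖ = 1 → inner ℂ v e = 0 →
      inner ℂ v e' = 0 → g e = g e' := by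
    intro e e' he he' h h'
    obtain ⟨U, hUv, hUe⟩ := exists_unitary_of_orthogonal hv he he' h h'
    rw [← hUe, hinv U hUv]
  -- The unit normal `w` is orthogonal to `v`, so its squared components along the `n - 1` remaining
  -- basis vectors sum to 1; by symmetry their means are equal.
  have hsum : ∑ i ∈ Finset.univ.erase i0, g (b i) = 1 := by
    simp only [hg]
    rw [← lintegral_finsetSum _ fun i _ => hsm _]
    have h1 : ∀ᵐ z ∂Measure.pi τ,
        ∑ i ∈ Finset.univ.erase i0, ENNReal.ofReal (spanDist t (Z z) (b i) ^ 2) = 1 := by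
      filter_upwards [hnormal] with z ⟨w, hw, hvw, hsp⟩
      rw [← ENNReal.ofReal_sum_of_nonneg fun i _ => by positivity]
      simp only [hsp]
      have h2 := b.sum_sq_norm_inner_right w
      rw [← Finset.add_sum_erase _ _ (Finset.mem_univ i0), hb0, hvw, hw] at h2
      simp only [norm_zero, ne_eq, OfNat.ofNat_ne_zero, not_false_eq_true, zero_pow, zero_add,
        one_pow] at h2
      rw [h2, ENNReal.ofReal_one]
    rw [lintegral_congr_ae h1]
    simp
  have hone : ∀ e : EuclideanSpace ℂ (Fin n), ‖e‖ = 1 → inner ℂ v e = 0 →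
      ((n - 1 : ℕ) : ℝ≥0∞) * g e = 1 := by
    intro e he hve
    rw [← hsum, Finset.sum_congr rfl fun i hi =>
      hunit (b i) e (b.orthonormal.norm_eq_one i) he (hbv i hi) hve]
    simp
  rw [← norm_sub_inner_smul_sq hv]
  set y := x - (inner ℂ v x) • v with hy
  have hvv : inner ℂ v v = 1 := by rw [inner_self_eq_norm_sq_to_K, hv]; simp
  have hvy : inner ℂ v y = 0 := by
    rw [hy, inner_sub_right, inner_smul_right, hvv, mul_one, sub_self]
  -- The component of `x` along `v` does not contribute, because `v` belongs to the span.
  have hgx : g x = ENNReal.ofReal (‖y‖ ^ 2) * g (dir y) := by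
    simp only [hg]
    rw [← lintegral_const_mul _ (hsm _)]
    refine lintegral_congr_ae ?_
    filter_upwards [hnormal] with z ⟨w, hw, hvw, hsp⟩
    rw [hsp, hsp, ← ENNReal.ofReal_mul (by positivity), ← mul_pow]
    have e1 : inner ℂ x w = inner ℂ y w := by
      rw [hy, inner_sub_left, inner_smul_left, hvw, mul_zero, sub_zero]
    have e2 : ‖y‖ * ‖inner ℂ (dir y) w‖ = ‖inner ℂ y w‖ := by
      conv_rhs => rw [← norm_smul_dir y, inner_smul_left, norm_mul]
      simp
    rw [e1, e2]
  change ((n - 1 : ℕ) : ℝ≥0∞) * g x = _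
  by_cases hy0 : y = 0
  · rw [hgx, hy0]; simp
  · rw [hgx, mul_left_comm, hone _ (norm_dir hy0) ?_, mul_one]
    rw [dir, inner_smul_right, hvy, mul_zero]

/-- Condition on the pair of user `k`. Its codeword is one of the spanning vectors and the others
are independent and isotropic, so the conditional mean is `(‖h‖² - |hᴴ hbar|²) / (n - 1)`, where the
numerator is `δ² ‖h‖²`. -/
theorem lintegral_interference [∀ l, IsProbabilityMeasure (τ l)] (hτ : ∀ l, IsPairLaw (τ l))
    {k : ι} {t : Finset ι} (ht : t.card + 1 = n) (hkt : k ∈ t) :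
    ((n - 1 : ℕ) : ℝ≥0∞) * ∫⁻ z, ENNReal.ofReal
        (spanDist t (fun j => (z j).2) (z k).1 ^ 2) ∂Measure.pi τ =
      ∫⁻ p, ENNReal.ofReal (chordalSq p.1 p.2) * ENNReal.ofReal (‖p.1‖ ^ 2) ∂τ k := by
  have hmp : MeasurePreserving (fun p : (EuclideanSpace ℂ (Fin n) × EuclideanSpace ℂ (Fin n)) ×
      (ι → EuclideanSpace ℂ (Fin n) × EuclideanSpace ℂ (Fin n)) => Function.update p.2 k p.1)
      ((τ k).prod (Measure.pi τ)) (Measure.pi τ) :=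
    (measurePreserving_update τ k).comp Measure.measurePreserving_swap
  have hm : Measurable fun z : ι → EuclideanSpace ℂ (Fin n) × EuclideanSpace ℂ (Fin n) =>
      ENNReal.ofReal (spanDist t (fun j => (z j).2) (z k).1 ^ 2) := by
    have h1 : Measurable fun z : ι → EuclideanSpace ℂ (Fin n) × EuclideanSpace ℂ (Fin n) =>
        ((fun j => (z j).2), (z k).1) :=
      (measurable_pi_lambda _ fun j => measurable_snd.comp (measurable_pi_apply j)).prodMk
        (measurable_fst.comp (measurable_pi_apply k))
    have h2 := (measurable_spanDist t).comp h1
    exact (h2.pow_const 2).ennreal_ofReal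
  have hcm := hm.comp hmp.measurable
  rw [← hmp.lintegral_comp hm]
  refine (congrArg _ (lintegral_prod _ hcm.aemeasurable)).trans ?_
  rw [← lintegral_const_mul _ hcm.lintegral_prod_right']
  have hind := Measure.ae_ae_of_ae_prod (hmp.quasiMeasurePreserving.ae
    (ae_linearIndepOn_comp measurable_snd (fun l => (hτ l).snd_submodule (by omega)) t (by omega)))
  refine lintegral_congr_ae ?_
  filter_upwards [hind, (hτ k).ae_ne_zero, (hτ k).ae_norm_eq_one] with p hp h0 h1
  have hupd : ∀ z : ι → EuclideanSpace ℂ (Fin n) × EuclideanSpace ℂ (Fin n),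
      (fun j => (Function.update z k p j).2) = Function.update (fun j => (z j).2) k p.2 := by
    intro z
    funext j
    by_cases hj : j = k
    · subst hj; simp
    · simp [Function.update_of_ne hj]
  have h := lintegral_spanDist_update hτ ht hkt h1 (by
    filter_upwards [hp] with z hz
    rw [← hupd]; exact hz) p.1
  have hchord : ENNReal.ofReal (chordalSq p.1 p.2) * ENNReal.ofReal (‖p.1‖ ^ 2) =
      ENNReal.ofReal (‖p.1‖ ^ 2 - ‖inner ℂ p.1 p.2‖ ^ 2) := by
    rw [← ENNReal.ofReal_mul' (by positivity)]
    congr 1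
    have : ‖p.1‖ ^ 2 ≠ 0 := pow_ne_zero 2 (norm_ne_zero_iff.2 h0)
    rw [chordalSq]
    field_simp
  rw [hchord, ← h]
  congr 1
  refine lintegral_congr fun z => ?_
  simp only [Function.comp_apply, Function.update_self]
  rw [hupd]

end Users

end ZFC
end

/-! ### Independence of users and random scheduling. -/

noncomputable section
open scoped ENNReal
namespace ZFC

/-- Coordinatewise images of independent pairs. -/
theorem map_pi_prod_pi {ι α β γ : Type*} [Fintype ι] [MeasurableSpace α] [MeasurableSpace β]
    [MeasurableSpace γ] (μ : ι → Measure α) (ν : ι → Measure β) [∀ i, IsProbabilityMeasure (μ i)]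
    [∀ i, IsProbabilityMeasure (ν i)] {f : ι → α × β → γ} (hf : ∀ i, Measurable (f i)) :
    ((Measure.pi μ).prod (Measure.pi ν)).map (fun p i => f i (p.1 i, p.2 i)) =
      Measure.pi fun i => ((μ i).prod (ν i)).map (f i) := by
  have : ∀ i, IsProbabilityMeasure (((μ i).prod (ν i)).map (f i)) := fun i =>
    Measure.isProbabilityMeasure_map (hf i).aemeasurable
  have hm : Measurable fun (p : (ι → α) × (ι → β)) i => f i (p.1 i, p.2 i) :=
    measurable_pi_lambda _ fun i => (hf i).comp
      (((measurable_pi_apply i).comp measurable_fst).prodMk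
        ((measurable_pi_apply i).comp measurable_snd))
  rw [← (measurePreserving_arrowProdEquivProdArrow α β ι μ ν).map_eq, Measure.map_map hm
    (MeasurableEquiv.measurable _), ← Measure.pi_map_pi fun i => (hf i).aemeasurable]
  rfl

/-- Real form of the evaluation of a lower Lebesgue integral. -/
theorem integrable_of_lintegral_eq {Ω : Type*} [MeasurableSpace Ω] {μ : Measure Ω} {f : Ω → ℝ}
    (hf : AEMeasurable f μ) (h0 : 0 ≤ᵐ[μ] f) {c : ℝ} (hc : 0 ≤ c)
    (h : ∫⁻ ω, ENNReal.ofReal (f ω) ∂μ = ENNReal.ofReal c) :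
    Integrable f μ ∧ ∫ ω, f ω ∂μ = c := by
  refine ⟨⟨hf.aestronglyMeasurable, ?_⟩, ?_⟩
  · rw [hasFiniteIntegral_iff_ofReal h0, h]
    exact ENNReal.ofReal_lt_top
  · rw [integral_eq_lintegral_of_nonneg_ae h0 hf.aestronglyMeasurable, h,
      ENNReal.toReal_ofReal hc]

namespace System

variable {N M B K : ℕ} {Ω : Type*} [MeasurableSpace Ω] {μ : Measure Ω}

/-- Normalized combined channels and best codewords of all users. -/
def pairs (sys : System N M B K μ) (ω : Ω) (l : Fin K) :
    EuclideanSpace ℂ (Fin N) × EuclideanSpace ℂ (Fin N) :=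
  channelPair (whitening (sys.R l)) (sys.Htilde ω l, sys.codebook ω l)

/-- Law of the combined channel and the best codeword of one user. -/
def pairLaw (sys : System N M B K μ) (l : Fin K) :
    Measure (EuclideanSpace ℂ (Fin N) × EuclideanSpace ℂ (Fin N)) :=
  (userLaw M N (2 ^ B)).map (channelPair (whitening (sys.R l)))

instance (sys : System N M B K μ) (l : Fin K) : IsProbabilityMeasure (sys.pairLaw l) :=
  Measure.isProbabilityMeasure_map (measurable_channelPair _).aemeasurable

variable (sys : System N M B K μ)

theorem measurable_toPairs :
    Measurable fun (p : (Fin K → Fin M → Fin N → ℂ) ×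
      (Fin K → Fin (2 ^ B) → EuclideanSpace ℂ (Fin N))) l =>
      channelPair (whitening (sys.R l)) (p.1 l, p.2 l) := by
  refine measurable_pi_lambda _ fun l => ?_
  have h := (measurable_channelPair (M := M) (N := N) (L := 2 ^ B) (whitening (sys.R l))).comp
    (((measurable_pi_apply l).comp measurable_fst).prodMk
      ((measurable_pi_apply l).comp measurable_snd) :
      Measurable fun p : (Fin K → Fin M → Fin N → ℂ) ×
        (Fin K → Fin (2 ^ B) → EuclideanSpace ℂ (Fin N)) => (p.1 l, p.2 l))
  exact h

theorem aemeasurable_pairs : AEMeasurable sys.pairs μ := by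
  have h := sys.measurable_toPairs.comp_aemeasurable sys.law.aemeasurable
  exact h

theorem map_pairs (hN : N ≠ 0) : μ.map sys.pairs = Measure.pi sys.pairLaw := by
  have h1 : μ.map sys.pairs = (μ.map fun ω => (sys.Htilde ω, sys.codebook ω)).map
      (fun p l => channelPair (whitening (sys.R l)) (p.1 l, p.2 l)) :=
    (AEMeasurable.map_map_of_aemeasurable sys.measurable_toPairs.aemeasurable
      sys.law.aemeasurable).symm
  rw [h1, sys.law.map_eq, sys.ν_isotropic.eq_sphereLaw hN]
  exact map_pi_prod_pi (fun _ : Fin K => gaussMatrix M N) (fun _ : Fin K => codeLaw (2 ^ B) N)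
    (f := fun l => channelPair (whitening (sys.R l))) fun l => measurable_channelPair _

theorem measurableSet_selected (k : Fin K) : MeasurableSet (sys.selected k) :=
  sys.S_measurable (measurableSet_eq_fun (measurable_pi_apply k)
    (measurable_const (a := True)) |>.congr (by ext f; simp) :
      MeasurableSet {f : Fin K → Prop | f k})

theorem ae_pairs (hN : N ≠ 0) {k : Fin K}
    {p : (Fin K → EuclideanSpace ℂ (Fin N) × EuclideanSpace ℂ (Fin N)) → Prop}
    (h : ∀ᵐ z ∂Measure.pi sys.pairLaw, p z) : ∀ᵐ ω ∂(μ[|sys.selected k]), p (sys.pairs ω) := by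
  rw [← sys.map_pairs hN] at h
  exact cond_absolutelyContinuous.ae_le (ae_of_ae_map sys.aemeasurable_pairs h)

/-- Only finitely many selections exist, so measurability for each fixed set suffices once the
random set is encoded by its membership predicate. -/
theorem aemeasurable_selection {k : Fin K} {γ : Type*} [MeasurableSpace γ]
    {Φ : Finset (Fin K) → (Fin K → EuclideanSpace ℂ (Fin N) × EuclideanSpace ℂ (Fin N)) → γ}
    (hΦ : ∀ s, Measurable (Φ s)) :
    AEMeasurable (fun ω => Φ (sys.S ω) (sys.pairs ω)) (μ[|sys.selected k]) := by
  classical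
  have hm : Measurable fun q : (Fin K → Prop) ×
      (Fin K → EuclideanSpace ℂ (Fin N) × EuclideanSpace ℂ (Fin N)) =>
      Φ (Finset.univ.filter fun l => q.1 l) q.2 := by
    refine measurable_from_prod_countable_right fun f => ?_
    exact hΦ (Finset.univ.filter fun l => f l)
  have h := hm.comp_aemeasurable (sys.S_measurable.aemeasurable.prodMk sys.aemeasurable_pairs)
  refine (h.mono_ac cond_absolutelyContinuous).congr (Eventually.of_forall fun ω => ?_)
  simp only [Function.comp_apply]
  congr 2
  ext l
  simp

/-- Selection is independent of channels and codebooks: a mean that is the same for all admissible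
selections is the conditional mean. -/
theorem lintegral_selection [IsProbabilityMeasure μ] (hN : N ≠ 0) {k : Fin K}
    (hk : μ (sys.selected k) ≠ 0)
    {Φ : Finset (Fin K) → (Fin K → EuclideanSpace ℂ (Fin N) × EuclideanSpace ℂ (Fin N)) → ℝ≥0∞}
    (hΦ : ∀ s, Measurable (Φ s)) {c : ℝ≥0∞}
    (hc : ∀ s, k ∈ s → s.card = N → ∫⁻ z, Φ s z ∂Measure.pi sys.pairLaw = c) :
    ∫⁻ ω, Φ (sys.S ω) (sys.pairs ω) ∂(μ[|sys.selected k]) = c := by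
  classical
  set T := Measure.pi sys.pairLaw with hT
  set σ : Ω → Fin K → Prop := fun ω l => l ∈ sys.S ω with hσ
  have hσm : Measurable σ := sys.S_measurable
  set A : Set (Fin K → Prop) := {f | f k} with hA
  have hAm : MeasurableSet A := Set.Finite.measurableSet (Set.toFinite A)
  have hsel : sys.selected k = σ ⁻¹' A := rfl
  have hind : IndepFun σ sys.pairs μ :=
    sys.S_indep.comp measurable_id sys.measurable_toPairs
  have hF : AEMeasurable (fun ω => (σ ω, sys.pairs ω)) μ :=
    hσm.aemeasurable.prodMk sys.aemeasurable_pairs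
  have hjoint := (indepFun_iff_map_prod_eq_prod_map_map hσm.aemeasurable
    sys.aemeasurable_pairs).1 hind
  rw [sys.map_pairs hN] at hjoint
  have hpμ : IsProbabilityMeasure (μ.map σ) := Measure.isProbabilityMeasure_map hσm.aemeasurable
  have hAμ : (μ.map σ) A = μ (sys.selected k) := by rw [Measure.map_apply hσm hAm, hsel]
  -- The conditioning event concerns only the first of two independent components, so the joint law
  -- remains a product and the law of the pairs is unchanged.
  have hlaw : (μ[|sys.selected k]).map (fun ω => (σ ω, sys.pairs ω)) = ((μ.map σ)[|A]).prod T := by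
    unfold ProbabilityTheory.cond
    rw [Measure.map_smul, hAμ, Measure.prod_smul_left]
    congr 1
    have h1 : sys.selected k = (fun ω => (σ ω, sys.pairs ω)) ⁻¹' (A ×ˢ Set.univ) := by
      rw [hsel]; ext ω; simp
    rw [h1, ← Measure.restrict_map_of_aemeasurable hF (hAm.prod MeasurableSet.univ), hjoint,
      ← Measure.prod_restrict, Measure.restrict_univ]
  have hρ : IsProbabilityMeasure ((μ.map σ)[|A]) :=
    cond_isProbabilityMeasure (by rw [hAμ]; exact hk)
  have hm : Measurable fun q : (Fin K → Prop) ×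
      (Fin K → EuclideanSpace ℂ (Fin N) × EuclideanSpace ℂ (Fin N)) =>
      Φ (Finset.univ.filter fun l => q.1 l) q.2 := by
    refine measurable_from_prod_countable_right fun f => ?_
    exact hΦ (Finset.univ.filter fun l => f l)
  have hfilter : ∀ ω, (Finset.univ.filter fun l => σ ω l) = sys.S ω := by
    intro ω; ext l; simp [hσ]
  have h1 : ∫⁻ ω, Φ (sys.S ω) (sys.pairs ω) ∂(μ[|sys.selected k]) =
      ∫⁻ q, Φ (Finset.univ.filter fun l => q.1 l) q.2 ∂(((μ.map σ)[|A]).prod T) := by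
    rw [← hlaw, lintegral_map' hm.aemeasurable (hF.mono_ac cond_absolutelyContinuous)]
    refine lintegral_congr fun ω => ?_
    simp only [hfilter]
  have hcard : ∀ᵐ f ∂((μ.map σ)[|A]), (Finset.univ.filter fun l => f l).card = N := by
    refine cond_absolutelyContinuous.ae_le ?_
    refine (ae_map_iff (p := fun f : Fin K → Prop => (Finset.univ.filter fun l => f l).card = N)
      hσm.aemeasurable (Set.toFinite _).measurableSet).2 ?_
    filter_upwards [sys.S_card] with ω hω
    convert (congrArg Finset.card (hfilter ω)).trans hω
  rw [h1, lintegral_prod _ hm.aemeasurable]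
  have h2 : ∀ᵐ f ∂((μ.map σ)[|A]),
      ∫⁻ z, Φ (Finset.univ.filter fun l => f l) z ∂T = c := by
    filter_upwards [hcard, ae_cond_mem hAm] with f hf hfA
    have hfk : f k := hfA
    exact hc _ (by simpa using hfk) hf
  rw [lintegral_congr_ae h2]
  simp

end System

end ZFC
end

/-! ### Rates, Jensen's inequality and the reduction to normalized pairs. -/

noncomputable section
open scoped ENNReal
namespace ZFC

/-- Rate through a zero-forcing beamformer for the vectors `z j`, `j ≠ k`. -/
def spanRate {ι : Type*} [DecidableEq ι] {n : ℕ} (c : ℝ) (k : ι) (s : Finset ι)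
    (z : ι → EuclideanSpace ℂ (Fin n)) (x : EuclideanSpace ℂ (Fin n)) : ℝ :=
  Real.logb 2 (1 + c * spanDist (s.erase k) z x ^ 2)

/-- Interference power. -/
def spanInterf {ι : Type*} [DecidableEq ι] {n : ℕ} (c : ℝ) (k : ι) (s : Finset ι)
    (z : ι → EuclideanSpace ℂ (Fin n)) (x : EuclideanSpace ℂ (Fin n)) : ℝ :=
  ∑ l ∈ s.erase k, c * spanDist (s.erase l) z x ^ 2

theorem chordalSq_nonneg {n : ℕ} (h : EuclideanSpace ℂ (Fin n)) {u : EuclideanSpace ℂ (Fin n)}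
    (hu : ‖u‖ = 1) : 0 ≤ chordalSq h u := by
  have h1 := norm_inner_le_norm (𝕜 := ℂ) h u
  rw [hu, mul_one] at h1
  rw [chordalSq, sub_nonneg]
  refine div_le_one_of_le₀ ?_ (by positivity)
  exact pow_le_pow_left₀ (norm_nonneg _) h1 2

theorem logb_two_mono {x y : ℝ} (hx : 0 < x) (h : x ≤ y) : Real.logb 2 x ≤ Real.logb 2 y :=
  Real.logb_le_logb_of_le one_lt_two hx h

theorem logb_two_one_add_nonneg {x : ℝ} (hx : 0 ≤ x) : 0 ≤ Real.logb 2 (1 + x) :=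
  Real.logb_nonneg one_lt_two (by linarith)

/-- Concavity: the tangent at `a`. The mean as base point gives Jensen's inequality, and `a = 0`
gives the linear bound behind integrability. -/
theorem logb_two_one_add_le_tangent {a x : ℝ} (ha : 0 ≤ a) (hx : 0 ≤ x) :
    Real.logb 2 (1 + x) ≤ Real.logb 2 (1 + a) + (x - a) / ((1 + a) * Real.log 2) := by
  have h2 : 0 < Real.log 2 := Real.log_pos one_lt_two
  have ha1 : 0 < 1 + a := by linarith
  have hx1 : 0 < 1 + x := by linarith
  have h := Real.log_le_sub_one_of_pos (div_pos hx1 ha1)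
  rw [Real.log_div hx1.ne' ha1.ne'] at h
  have e : (1 + x) / (1 + a) - 1 = (x - a) / (1 + a) := by field_simp; ring
  rw [e] at h
  rw [Real.logb, Real.logb, ← div_div, ← add_div]
  exact div_le_div_of_nonneg_right (by linarith) h2.le

/-- Jensen's inequality for the logarithm. -/
theorem integral_logb_le {Ω : Type*} [MeasurableSpace Ω] {μ : Measure Ω} [IsProbabilityMeasure μ]
    {f : Ω → ℝ} (hf : Integrable f μ) (h0 : ∀ ω, 0 ≤ f ω) :
    Integrable (fun ω => Real.logb 2 (1 + f ω)) μ ∧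
      ∫ ω, Real.logb 2 (1 + f ω) ∂μ ≤ Real.logb 2 (1 + ∫ ω, f ω ∂μ) := by
  have h2 : 0 < Real.log 2 := Real.log_pos one_lt_two
  have hm : AEStronglyMeasurable (fun ω => Real.logb 2 (1 + f ω)) μ :=
    ((Real.measurable_log.comp_aemeasurable
      (hf.aemeasurable.const_add 1)).div_const _).aestronglyMeasurable
  have hint : Integrable (fun ω => Real.logb 2 (1 + f ω)) μ := by
    refine (hf.div_const (Real.log 2)).mono' hm (Eventually.of_forall fun ω => ?_)
    rw [Real.norm_of_nonneg (logb_two_one_add_nonneg (h0 ω))]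
    have := logb_two_one_add_le_tangent le_rfl (h0 ω)
    simpa using this
  refine ⟨hint, ?_⟩
  set a := ∫ ω, f ω ∂μ with ha
  have ha0 : 0 ≤ a := integral_nonneg h0
  have hi2 : Integrable (fun ω => (f ω - a) / ((1 + a) * Real.log 2)) μ :=
    (hf.sub (integrable_const a)).div_const _
  calc ∫ ω, Real.logb 2 (1 + f ω) ∂μ
      ≤ ∫ ω, (Real.logb 2 (1 + a) + (f ω - a) / ((1 + a) * Real.log 2)) ∂μ :=
        integral_mono hint ((integrable_const _).add hi2)
          fun ω => logb_two_one_add_le_tangent ha0 (h0 ω)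
    _ = Real.logb 2 (1 + a) := by
        rw [integral_add (integrable_const _) hi2, integral_div,
          integral_sub hf (integrable_const a)]
        simp [← ha]

namespace System

variable {N M B K : ℕ} {Ω : Type*} [MeasurableSpace Ω] {μ : Measure Ω}

/-- Zero forcing in terms of the normalized channel pairs. -/
theorem ae_zeroForcing {m : ℕ} (sys : System (M + m) M B K μ) (hM : M ≠ 0) (hm : m ≠ 0)
    (k : Fin K) :
    ∀ᵐ ω ∂(μ[|sys.selected k]), k ∈ sys.S ω ∧ ‖(sys.pairs ω k).2‖ = 1 ∧
      ‖sys.h k ω‖ = ‖(sys.pairs ω k).1‖ ∧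
      sys.distortion k ω = chordalSq (sys.pairs ω k).1 (sys.pairs ω k).2 ∧
      ‖inner ℂ (sys.h k ω) (sys.w ω k)‖ =
        spanDist ((sys.S ω).erase k) (fun j => (sys.pairs ω j).1) (sys.pairs ω k).1 ∧
      ∀ l ∈ sys.S ω, ‖inner ℂ (sys.h k ω) (sys.wbar ω l)‖ =
        spanDist ((sys.S ω).erase l) (fun j => (sys.pairs ω j).2) (sys.pairs ω k).1 := by
  have hN : M + m ≠ 0 := by omega
  have hpl : ∀ l, IsPairLaw (sys.pairLaw l) := fun l =>
    isPairLaw_userLaw hM hm (sys.R_posDef l)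
  have hcond : μ[|sys.selected k] ≪ μ := cond_absolutelyContinuous
  have h1 : ∀ s : Finset (Fin K), ∀ᵐ z ∂Measure.pi sys.pairLaw, s.card ≤ M + m →
      LinearIndepOn ℂ (fun j => (z j).1) (s : Set (Fin K)) ∧
        LinearIndepOn ℂ (fun j => (z j).2) (s : Set (Fin K)) := by
    intro s
    by_cases hs : s.card ≤ M + m
    · filter_upwards [ae_linearIndepOn_comp measurable_fst (fun l => (hpl l).fst_submodule hN) s hs,
        ae_linearIndepOn_comp measurable_snd (fun l => (hpl l).snd_submodule hN) s hs] with z e1 e2 _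
      exact ⟨e1, e2⟩
    · exact Eventually.of_forall fun z h => absurd h hs
  have h2 := sys.ae_pairs hN (k := k) (ae_all_iff.2 h1)
  have hlaw : ∀ᵐ ω ∂μ, ∀ l, (rowGram (sys.Htilde ω l)).PosDef ∧
      (∀ i, ‖sys.codebook ω l i‖ = 1) ∧
      ∃ i, (∀ j, j ≠ i → ‖proj (sys.Htilde ω l) (sys.codebook ω l j)‖ <
        ‖proj (sys.Htilde ω l) (sys.codebook ω l i)‖) ∧
        best (sys.Htilde ω l) (sys.codebook ω l) = sys.codebook ω l i ∧
        ‖proj (sys.Htilde ω l) (sys.codebook ω l i)‖ ≠ 0 := by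
    have hmap : μ.map (fun ω l => (sys.Htilde ω l, sys.codebook ω l)) =
        Measure.pi fun _ : Fin K => userLaw M (M + m) (2 ^ B) := by
      have hid : Measurable fun (p : (Fin K → Fin M → Fin (M + m) → ℂ) ×
          (Fin K → Fin (2 ^ B) → EuclideanSpace ℂ (Fin (M + m)))) l => (p.1 l, p.2 l) :=
        measurable_pi_lambda _ fun l => ((measurable_pi_apply l).comp measurable_fst).prodMk
          ((measurable_pi_apply l).comp measurable_snd)
      have e := AEMeasurable.map_map_of_aemeasurable hid.aemeasurable sys.law.aemeasurable
      rw [sys.law.map_eq, sys.ν_isotropic.eq_sphereLaw hN] at e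
      refine e.symm.trans ?_
      have e2 := map_pi_prod_pi (fun _ : Fin K => gaussMatrix M (M + m))
        (fun _ : Fin K => codeLaw (2 ^ B) (M + m)) (f := fun _ => id) fun _ => measurable_id
      simp only [Measure.map_id] at e2
      exact e2
    rw [ae_all_iff]
    intro l
    have e3 := (measurePreserving_eval (fun _ : Fin K => userLaw M (M + m) (2 ^ B))
      l).quasiMeasurePreserving.ae (ae_userLaw_regular (L := 2 ^ B) hM hm)
    rw [← hmap] at e3
    have hae : AEMeasurable (fun ω l => (sys.Htilde ω l, sys.codebook ω l)) μ := by
      have hid : Measurable fun (p : (Fin K → Fin M → Fin (M + m) → ℂ) ×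
          (Fin K → Fin (2 ^ B) → EuclideanSpace ℂ (Fin (M + m)))) l => (p.1 l, p.2 l) :=
        measurable_pi_lambda _ fun l => ((measurable_pi_apply l).comp measurable_fst).prodMk
          ((measurable_pi_apply l).comp measurable_snd)
      have e := hid.comp_aemeasurable sys.law.aemeasurable
      exact e
    exact ae_of_ae_map hae e3
  filter_upwards [ae_cond_mem (sys.measurableSet_selected k), h2, hcond.ae_le hlaw,
    hcond.ae_le sys.qbc, hcond.ae_le sys.w_zeroForcing, hcond.ae_le sys.wbar_zeroForcing,
    hcond.ae_le sys.S_card] with ω hkS hli hreg hqbc hw hwbar hcard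
  have hk : k ∈ sys.S ω := hkS
  -- The unknown phase of each channel disappears from norms, from moduli of inner products and from
  -- orthogonality relations.
  have hQ : ∀ l ∈ sys.S ω, sys.hbar ω l = (sys.pairs ω l).2 ∧ ∃ z : ℂ, ‖z‖ = 1 ∧
      sys.h l ω = z • (sys.pairs ω l).1 := by
    intro l hl
    obtain ⟨hX, hC, i, hi, -, h0⟩ := hreg l
    exact IsQBC.eq_best (sys.R_posDef l) hX hC hi h0 (hqbc l hl)
  obtain ⟨hbk, z, hz, hzk⟩ := hQ k hk
  have hu : ‖(sys.pairs ω k).2‖ = 1 := by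
    obtain ⟨-, hC, i, -, hb, -⟩ := hreg k
    change ‖best _ _‖ = 1
    rw [hb, hC]
  have hnorm : ‖sys.h k ω‖ = ‖(sys.pairs ω k).1‖ := by rw [hzk, norm_smul, hz, one_mul]
  have hinner : ∀ w, ‖inner ℂ (sys.h k ω) w‖ = ‖inner ℂ (sys.pairs ω k).1 w‖ := by
    intro w
    rw [hzk, inner_smul_left, norm_mul, RCLike.norm_conj, hz, one_mul]
  obtain ⟨hl1, hl2⟩ := hli (sys.S ω) hcard.le
  have hc1 : ∀ l ∈ sys.S ω, ((sys.S ω).erase l).card + 1 = M + m := fun l hl => by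
    rw [Finset.card_erase_add_one hl, hcard]
  refine ⟨hk, hu, hnorm, ?_, ?_, fun l hl => ?_⟩
  · rw [distortion, chordal, hbk]
    have : chordalSq (sys.h k ω) (sys.pairs ω k).2 =
        chordalSq (sys.pairs ω k).1 (sys.pairs ω k).2 := by
      rw [chordalSq, chordalSq, hinner, hnorm]
    rw [this, Real.sq_sqrt (chordalSq_nonneg _ hu)]
  · rw [hinner]
    refine (spanDist_eq (hc1 k hk) (hl1.mono (Finset.coe_subset.2 (Finset.erase_subset _ _)))
      (hw k hk).1 (fun j hj => ?_) _).symm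
    obtain ⟨-, z', hz', hzj⟩ := hQ j (Finset.mem_of_mem_erase hj)
    have h := (hw k hk).2 j (Finset.mem_of_mem_erase hj) (Finset.ne_of_mem_erase hj)
    change inner ℂ (sys.h j ω) _ = 0 at h
    rw [hzj, inner_smul_left] at h
    refine (mul_eq_zero.1 h).resolve_left fun h0 => ?_
    rw [map_eq_zero] at h0
    rw [h0, norm_zero] at hz'
    exact zero_ne_one hz'
  · rw [hinner]
    refine (spanDist_eq (hc1 l hl) (hl2.mono (Finset.coe_subset.2 (Finset.erase_subset _ _)))
      (hwbar l hl).1 (fun j hj => ?_) _).symm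
    have h := (hwbar l hl).2 j (Finset.mem_of_mem_erase hj) (Finset.ne_of_mem_erase hj)
    rw [(hQ j (Finset.mem_of_mem_erase hj)).1] at h
    exact h

end System

end ZFC
end

/-! ### Mean interference and the final bounds. -/

noncomputable section
open scoped ENNReal
namespace ZFC

section Measurability

variable {ι : Type*} [Fintype ι] {n : ℕ}

theorem measurable_spanDist_comp
    {π : EuclideanSpace ℂ (Fin n) × EuclideanSpace ℂ (Fin n) → EuclideanSpace ℂ (Fin n)}
    (hπ : Measurable π) (t : Finset ι) (k : ι) :
    Measurable fun z : ι → EuclideanSpace ℂ (Fin n) × EuclideanSpace ℂ (Fin n) =>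
      spanDist t (fun j => π (z j)) (z k).1 := by
  have h1 : Measurable fun z : ι → EuclideanSpace ℂ (Fin n) × EuclideanSpace ℂ (Fin n) =>
      ((fun j => π (z j)), (z k).1) :=
    (measurable_pi_lambda _ fun j => hπ.comp (measurable_pi_apply j)).prodMk
      (measurable_fst.comp (measurable_pi_apply k))
  have h2 := (measurable_spanDist t).comp h1
  exact h2

theorem measurable_spanRate [DecidableEq ι]
    {π : EuclideanSpace ℂ (Fin n) × EuclideanSpace ℂ (Fin n) → EuclideanSpace ℂ (Fin n)}
    (hπ : Measurable π) (c : ℝ) (k : ι) (s : Finset ι) :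
    Measurable fun z : ι → EuclideanSpace ℂ (Fin n) × EuclideanSpace ℂ (Fin n) =>
      spanRate c k s (fun j => π (z j)) (z k).1 := by
  unfold spanRate
  exact (Real.measurable_log.comp
    ((((measurable_spanDist_comp hπ _ k).pow_const 2).const_mul c).const_add 1)).div_const _

theorem measurable_spanInterf [DecidableEq ι]
    {π : EuclideanSpace ℂ (Fin n) × EuclideanSpace ℂ (Fin n) → EuclideanSpace ℂ (Fin n)}
    (hπ : Measurable π) (c : ℝ) (k : ι) (s : Finset ι) :
    Measurable fun z : ι → EuclideanSpace ℂ (Fin n) × EuclideanSpace ℂ (Fin n) =>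
      spanInterf c k s (fun j => π (z j)) (z k).1 := by
  unfold spanInterf
  exact Finset.measurable_sum _ fun l _ =>
    ((measurable_spanDist_comp hπ _ k).pow_const 2).const_mul c

end Measurability

section Bounds

variable {ι : Type*} [DecidableEq ι] {n : ℕ} {c : ℝ} (k : ι) (s : Finset ι)
  (z : ι → EuclideanSpace ℂ (Fin n)) (x : EuclideanSpace ℂ (Fin n))

theorem spanRate_nonneg (hc : 0 ≤ c) : 0 ≤ spanRate c k s z x :=
  logb_two_one_add_nonneg (mul_nonneg hc (sq_nonneg _))

theorem spanRate_le (hc : 0 ≤ c) : spanRate c k s z x ≤ c / Real.log 2 * ‖x‖ ^ 2 := by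
  have h2 : 0 < Real.log 2 := Real.log_pos one_lt_two
  have h := logb_two_one_add_le_tangent (a := 0) le_rfl
    (mul_nonneg hc (sq_nonneg (spanDist (s.erase k) z x)))
  simp only [add_zero, Real.logb_one, zero_add, sub_zero, one_mul] at h
  refine h.trans ?_
  rw [div_mul_eq_mul_div]
  refine div_le_div_of_nonneg_right (mul_le_mul_of_nonneg_left ?_ hc) h2.le
  exact pow_le_pow_left₀ (spanDist_nonneg _ _ _) (spanDist_le _ _ _) 2

theorem spanInterf_nonneg (hc : 0 ≤ c) : 0 ≤ spanInterf c k s z x :=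
  Finset.sum_nonneg fun _ _ => mul_nonneg hc (sq_nonneg _)

end Bounds

/-- The last bound is `1 + a / (1 + i) ≥ (1 + a) / (1 + i)`: interference costs at most `log₂ (1 +
i)`. -/
theorem logb_sinr_bounds {a i : ℝ} (ha : 0 ≤ a) (hi : 0 ≤ i) :
    0 ≤ Real.logb 2 (1 + a / (1 + i)) ∧
      Real.logb 2 (1 + a / (1 + i)) ≤ Real.logb 2 (1 + a) ∧
      Real.logb 2 (1 + a) - Real.logb 2 (1 + i) ≤ Real.logb 2 (1 + a / (1 + i)) := by
  have hi1 : 0 < 1 + i := by linarith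
  have hai : 0 ≤ a / (1 + i) := by positivity
  refine ⟨logb_two_one_add_nonneg hai, logb_two_mono (by linarith) ?_, ?_⟩
  · have := div_le_self ha (by linarith : (1 : ℝ) ≤ 1 + i)
    linarith
  · rw [← Real.logb_div (by linarith) hi1.ne']
    refine logb_two_mono (by positivity) ?_
    rw [add_div]
    have : 1 / (1 + i) ≤ 1 := div_le_one_of_le₀ (by linarith) hi1.le
    linarith

/-- There are `n - 1` interferers, each with mean `c / (n - 1)` times the product moment, so their
number cancels. -/
theorem lintegral_spanInterf {ι : Type*} [Fintype ι] [DecidableEq ι] {n : ℕ} (hn : 2 ≤ n)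
    {τ : ι → Measure (EuclideanSpace ℂ (Fin n) × EuclideanSpace ℂ (Fin n))}
    [∀ l, IsProbabilityMeasure (τ l)] (hτ : ∀ l, IsPairLaw (τ l)) {c : ℝ} (hc : 0 ≤ c)
    {k : ι} {s : Finset ι} (hks : k ∈ s) (hs : s.card = n) :
    ∫⁻ z, ENNReal.ofReal (spanInterf c k s (fun j => (z j).2) (z k).1) ∂Measure.pi τ =
      ENNReal.ofReal c *
        ∫⁻ p, ENNReal.ofReal (chordalSq p.1 p.2) * ENNReal.ofReal (‖p.1‖ ^ 2) ∂τ k := by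
  set X := ∫⁻ p, ENNReal.ofReal (chordalSq p.1 p.2) * ENNReal.ofReal (‖p.1‖ ^ 2) ∂τ k
  have hn0 : ((n - 1 : ℕ) : ℝ≥0∞) ≠ 0 := by
    rw [Nat.cast_ne_zero]; omega
  have hnt : ((n - 1 : ℕ) : ℝ≥0∞) ≠ ⊤ := ENNReal.natCast_ne_top _
  have hm : ∀ t : Finset ι, Measurable
      fun z : ι → EuclideanSpace ℂ (Fin n) × EuclideanSpace ℂ (Fin n) =>
        ENNReal.ofReal (spanDist t (fun j => (z j).2) (z k).1 ^ 2) := fun t =>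
    ((measurable_spanDist_comp measurable_snd t k).pow_const 2).ennreal_ofReal
  have h1 : ∀ z : ι → EuclideanSpace ℂ (Fin n) × EuclideanSpace ℂ (Fin n),
      ENNReal.ofReal (spanInterf c k s (fun j => (z j).2) (z k).1) =
        ∑ l ∈ s.erase k, ENNReal.ofReal c *
          ENNReal.ofReal (spanDist (s.erase l) (fun j => (z j).2) (z k).1 ^ 2) := by
    intro z
    rw [spanInterf, ENNReal.ofReal_sum_of_nonneg fun _ _ => mul_nonneg hc (sq_nonneg _)]
    exact Finset.sum_congr rfl fun l _ => ENNReal.ofReal_mul hc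
  simp_rw [h1]
  rw [lintegral_finsetSum _ fun l _ => (hm _).const_mul _]
  have h2 : ∀ l ∈ s.erase k, ∫⁻ z, ENNReal.ofReal c *
      ENNReal.ofReal (spanDist (s.erase l) (fun j => (z j).2) (z k).1 ^ 2) ∂Measure.pi τ =
        ENNReal.ofReal c * (X / ((n - 1 : ℕ) : ℝ≥0∞)) := by
    intro l hl
    rw [lintegral_const_mul _ (hm _)]
    congr 1
    rw [ENNReal.eq_div_iff hn0 hnt]
    refine lintegral_interference hτ ?_ ?_
    · rw [Finset.card_erase_add_one (Finset.mem_of_mem_erase hl), hs]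
    · exact Finset.mem_erase.2 ⟨(Finset.ne_of_mem_erase hl).symm, hks⟩
  rw [Finset.sum_congr rfl h2, Finset.sum_const, Finset.card_erase_of_mem hks, hs, nsmul_eq_mul,
    mul_left_comm, ENNReal.mul_div_cancel hn0 hnt]

namespace System

variable {M m B K : ℕ} {Ω : Type*} [MeasurableSpace Ω] {μ : Measure Ω} [IsProbabilityMeasure μ]

/-- Let `a` and `b` be the interference-free rates with exact and quantized information and `I` the
interference. Almost surely the loss is at most `(a - b) + log₂ (1 + I)`. The means of `a` and `b`
agree, and Jensen's inequality bounds the last term through `E I = c * D * G`. -/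
theorem performance (sys : System (M + m) M B K μ) (hM : 2 ≤ M) (hm : m ≠ 0) {k : Fin K}
    {lam : ℕ → ℝ} {P : ℝ} (hP : 0 ≤ P) (hk : μ (sys.selected k) ≠ 0)
    (hlam : StrictMonoOn lam (Set.Icc 1 M))
    (hev : ∀ m ∈ Set.Icc 1 M, Module.End.HasEigenvalue (Matrix.toLin' (sys.R k)) (lam m : ℂ)) :
    Integrable (sys.distortion k) (μ[|sys.selected k]) ∧
    ∫ ω, sys.distortion k ω ∂(μ[|sys.selected k]) = minBetaMean M m (2 ^ B) ∧
    Integrable (fun ω => ‖sys.h k ω‖ ^ 2) (μ[|sys.selected k]) ∧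
    ∫ ω, ‖sys.h k ω‖ ^ 2 ∂(μ[|sys.selected k]) = gain (M + m) M (fun n => 1 / lam n) ∧
    Integrable (sys.rate P k) (μ[|sys.selected k]) ∧
    Integrable (sys.rateQ P k) (μ[|sys.selected k]) ∧
    ∫ ω, (sys.rate P k ω - sys.rateQ P k ω) ∂(μ[|sys.selected k]) ≤
      Real.logb 2 (1 + P / (M + m : ℕ) * minBetaMean M m (2 ^ B) *
        gain (M + m) M (fun n => 1 / lam n)) := by
  have hM0 : M ≠ 0 := by omega
  have hN0 : M + m ≠ 0 := by omega
  set D := minBetaMean M m (2 ^ B) with hD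
  set G := gain (M + m) M (fun n => 1 / lam n) with hG
  have hD0 : 0 ≤ D := minBetaMean_nonneg _ _ _
  obtain ⟨hG0, hmean⟩ := lintegral_meanGain_eq (m := m) hM hm (sys.R_posDef k) hlam hev
  have hprob : IsProbabilityMeasure (μ[|sys.selected k]) := cond_isProbabilityMeasure hk
  set c : ℝ := P / (M + m : ℕ) with hc
  have hc0 : 0 ≤ c := by positivity
  have hτ : ∀ l, IsPairLaw (sys.pairLaw l) := fun l =>
    isPairLaw_userLaw hM0 hm (sys.R_posDef l)
  have hτ1 : ∫⁻ p, ENNReal.ofReal (chordalSq p.1 p.2) ∂sys.pairLaw k = ENNReal.ofReal D :=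
    lintegral_chordalSq hM0 hm (sys.R_posDef k)
  have hτ2 : ∫⁻ p, ENNReal.ofReal (‖p.1‖ ^ 2) ∂sys.pairLaw k = ENNReal.ofReal G :=
    (lintegral_norm_sq hM0 hm).trans hmean
  have hτ3 : ∫⁻ p, ENNReal.ofReal (chordalSq p.1 p.2) * ENNReal.ofReal (‖p.1‖ ^ 2)
      ∂sys.pairLaw k = ENNReal.ofReal D * ENNReal.ofReal G := by
    rw [← hmean]
    exact lintegral_chordalSq_mul hM0 hm (sys.R_posDef k)
  have hzf := sys.ae_zeroForcing hM0 hm k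
  have heval : ∀ {φ : EuclideanSpace ℂ (Fin (M + m)) × EuclideanSpace ℂ (Fin (M + m)) → ℝ≥0∞},
      Measurable φ → ∫⁻ ω, φ (sys.pairs ω k) ∂(μ[|sys.selected k]) =
        ∫⁻ p, φ p ∂sys.pairLaw k := by
    intro φ hφ
    exact sys.lintegral_selection hN0 hk (Φ := fun _ z => φ (z k))
      (fun _ => hφ.comp (measurable_pi_apply k)) fun s _ _ =>
        (measurePreserving_eval sys.pairLaw k).lintegral_comp hφ
  have hdist : Integrable (sys.distortion k) (μ[|sys.selected k]) ∧
      ∫ ω, sys.distortion k ω ∂(μ[|sys.selected k]) = D := by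
    have hae : sys.distortion k =ᵐ[μ[|sys.selected k]]
        fun ω => chordalSq (sys.pairs ω k).1 (sys.pairs ω k).2 := by
      filter_upwards [hzf] with ω h using h.2.2.2.1
    have hmeas := sys.aemeasurable_selection (k := k) (Φ := fun _ z => chordalSq (z k).1 (z k).2)
      fun _ => measurable_chordalSq.comp (measurable_pi_apply k)
    have h := integrable_of_lintegral_eq hmeas (by
      filter_upwards [hzf] with ω h using chordalSq_nonneg _ h.2.1) hD0
      ((heval measurable_chordalSq.ennreal_ofReal).trans hτ1)
    exact ⟨h.1.congr hae.symm, (integral_congr_ae hae).trans h.2⟩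
  have hpn : Integrable (fun ω => ‖(sys.pairs ω k).1‖ ^ 2) (μ[|sys.selected k]) ∧
      ∫ ω, ‖(sys.pairs ω k).1‖ ^ 2 ∂(μ[|sys.selected k]) = G :=
    integrable_of_lintegral_eq (sys.aemeasurable_selection (k := k)
      (Φ := fun _ z => ‖(z k).1‖ ^ 2) fun _ =>
        (measurable_fst.comp (measurable_pi_apply k)).norm.pow_const 2)
      (Eventually.of_forall fun ω => sq_nonneg _) hG0
      ((heval (measurable_fst.norm.pow_const 2).ennreal_ofReal).trans hτ2)
  have hgain : (fun ω => ‖sys.h k ω‖ ^ 2) =ᵐ[μ[|sys.selected k]]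
      fun ω => ‖(sys.pairs ω k).1‖ ^ 2 := by
    filter_upwards [hzf] with ω h
    rw [h.2.2.1]
  set a : Ω → ℝ := fun ω =>
    spanRate c k (sys.S ω) (fun j => (sys.pairs ω j).1) (sys.pairs ω k).1 with ha
  set b : Ω → ℝ := fun ω =>
    spanRate c k (sys.S ω) (fun j => (sys.pairs ω j).2) (sys.pairs ω k).1 with hb
  set I : Ω → ℝ := fun ω =>
    spanInterf c k (sys.S ω) (fun j => (sys.pairs ω j).2) (sys.pairs ω k).1 with hI
  have hamea : AEMeasurable a (μ[|sys.selected k]) := sys.aemeasurable_selection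
    (Φ := fun s z => spanRate c k s (fun j => (z j).1) (z k).1) fun s =>
      measurable_spanRate measurable_fst c k s
  have hbmea : AEMeasurable b (μ[|sys.selected k]) := sys.aemeasurable_selection
    (Φ := fun s z => spanRate c k s (fun j => (z j).2) (z k).1) fun s =>
      measurable_spanRate measurable_snd c k s
  have hImea : AEMeasurable I (μ[|sys.selected k]) := sys.aemeasurable_selection
    (Φ := fun s z => spanInterf c k s (fun j => (z j).2) (z k).1) fun s =>
      measurable_spanInterf measurable_snd c k s
  have ha0 : ∀ ω, 0 ≤ a ω := fun ω => spanRate_nonneg _ _ _ _ hc0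
  have hb0 : ∀ ω, 0 ≤ b ω := fun ω => spanRate_nonneg _ _ _ _ hc0
  have hI0 : ∀ ω, 0 ≤ I ω := fun ω => spanInterf_nonneg _ _ _ _ hc0
  have hbound := hpn.1.const_mul (c / Real.log 2)
  have haint : Integrable a (μ[|sys.selected k]) :=
    hbound.mono' hamea.aestronglyMeasurable (Eventually.of_forall fun ω => by
      rw [Real.norm_of_nonneg (ha0 ω)]
      exact spanRate_le _ _ _ _ hc0)
  have hbint : Integrable b (μ[|sys.selected k]) :=
    hbound.mono' hbmea.aestronglyMeasurable (Eventually.of_forall fun ω => by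
      rw [Real.norm_of_nonneg (hb0 ω)]
      exact spanRate_le _ _ _ _ hc0)
  -- Both means equal the mean rate along an arbitrary fixed unit vector `w`.
  have hab : ∫ ω, a ω ∂(μ[|sys.selected k]) = ∫ ω, b ω ∂(μ[|sys.selected k]) := by
    let φ : ℝ → ℝ≥0∞ := fun r => ENNReal.ofReal (Real.logb 2 (1 + c * r ^ 2))
    have hφ : Measurable φ := by
      have : Measurable fun r : ℝ => Real.logb 2 (1 + c * r ^ 2) :=
        (Real.measurable_log.comp (((measurable_id.pow_const 2).const_mul c).const_add 1)).div_const
          _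
      exact this.ennreal_ofReal
    let w : EuclideanSpace ℂ (Fin (M + m)) := EuclideanSpace.single ⟨0, by omega⟩ 1
    have hw : ‖w‖ = 1 := by simp [w]
    have ea : ∫⁻ ω, ENNReal.ofReal (a ω) ∂(μ[|sys.selected k]) =
        ∫⁻ p, φ ‖inner ℂ p.1 w‖ ∂sys.pairLaw k :=
      sys.lintegral_selection hN0 hk
        (Φ := fun s z => ENNReal.ofReal (spanRate c k s (fun j => (z j).1) (z k).1))
        (fun s => (measurable_spanRate measurable_fst c k s).ennreal_ofReal) fun s hks hs =>
          lintegral_spanDist (hτ k) measurable_fst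
            (by rw [Finset.card_erase_add_one hks, hs]) (Finset.notMem_erase k s)
            (ae_linearIndepOn_comp measurable_fst (fun l => (hτ l).fst_submodule hN0) _
              ((Finset.card_erase_le).trans hs.le)) hφ hw
    have eb : ∫⁻ ω, ENNReal.ofReal (b ω) ∂(μ[|sys.selected k]) =
        ∫⁻ p, φ ‖inner ℂ p.1 w‖ ∂sys.pairLaw k :=
      sys.lintegral_selection hN0 hk
        (Φ := fun s z => ENNReal.ofReal (spanRate c k s (fun j => (z j).2) (z k).1))
        (fun s => (measurable_spanRate measurable_snd c k s).ennreal_ofReal) fun s hks hs =>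
          lintegral_spanDist (hτ k) measurable_snd
            (by rw [Finset.card_erase_add_one hks, hs]) (Finset.notMem_erase k s)
            (ae_linearIndepOn_comp measurable_snd (fun l => (hτ l).snd_submodule hN0) _
              ((Finset.card_erase_le).trans hs.le)) hφ hw
    rw [integral_eq_lintegral_of_nonneg_ae (Eventually.of_forall ha0) haint.1,
      integral_eq_lintegral_of_nonneg_ae (Eventually.of_forall hb0) hbint.1, ea, eb]
  have hIint : Integrable I (μ[|sys.selected k]) ∧ ∫ ω, I ω ∂(μ[|sys.selected k]) = c * D * G := by
    refine integrable_of_lintegral_eq hImea (Eventually.of_forall hI0) (by positivity) ?_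
    refine sys.lintegral_selection hN0 hk
      (Φ := fun s z => ENNReal.ofReal (spanInterf c k s (fun j => (z j).2) (z k).1))
      (fun s => (measurable_spanInterf measurable_snd c k s).ennreal_ofReal) fun s hks hs => ?_
    rw [lintegral_spanInterf (by omega) hτ hc0 hks hs, hτ3, mul_assoc, ENNReal.ofReal_mul hc0,
      ENNReal.ofReal_mul hD0]
  have hrate : sys.rate P k =ᵐ[μ[|sys.selected k]] a := by
    filter_upwards [hzf] with ω ⟨_, _, _, _, h, _⟩
    simp only [rate, ha, spanRate, h, hc]
  have hrateQ : sys.rateQ P k =ᵐ[μ[|sys.selected k]] fun ω => Real.logb 2 (1 +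
      c * spanDist ((sys.S ω).erase k) (fun j => (sys.pairs ω j).2) (sys.pairs ω k).1 ^ 2 /
        (1 + I ω)) := by
    filter_upwards [hzf] with ω ⟨hkS, _, _, _, _, h⟩
    have hsum : ∑ l ∈ (sys.S ω).erase k, P / (M + m : ℕ) *
        ‖inner ℂ (sys.h k ω) (sys.wbar ω l)‖ ^ 2 = I ω := by
      simp only [hI, spanInterf, hc]
      exact Finset.sum_congr rfl fun l hl => by rw [h l (Finset.mem_of_mem_erase hl)]
    simp only [rateQ, hsum, h k hkS, hc]
  have hQmea : AEMeasurable (sys.rateQ P k) (μ[|sys.selected k]) := by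
    refine AEMeasurable.congr ?_ hrateQ.symm
    refine sys.aemeasurable_selection (Φ := fun s z => Real.logb 2 (1 +
      c * spanDist (s.erase k) (fun j => (z j).2) (z k).1 ^ 2 /
        (1 + spanInterf c k s (fun j => (z j).2) (z k).1))) fun s => ?_
    exact (Real.measurable_log.comp
      (((((measurable_spanDist_comp measurable_snd _ k).pow_const 2).const_mul c).div
        ((measurable_spanInterf measurable_snd c k s).const_add 1)).const_add 1)).div_const _
  have hQb : ∀ᵐ ω ∂(μ[|sys.selected k]), 0 ≤ sys.rateQ P k ω ∧ sys.rateQ P k ω ≤ b ω ∧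
      b ω - Real.logb 2 (1 + I ω) ≤ sys.rateQ P k ω := by
    filter_upwards [hrateQ] with ω h
    rw [h]
    exact logb_sinr_bounds (mul_nonneg hc0 (sq_nonneg _)) (hI0 ω)
  have hQint : Integrable (sys.rateQ P k) (μ[|sys.selected k]) := by
    refine hbint.mono' hQmea.aestronglyMeasurable ?_
    filter_upwards [hQb] with ω h
    rw [Real.norm_of_nonneg h.1]
    exact h.2.1
  have hrint : Integrable (sys.rate P k) (μ[|sys.selected k]) := haint.congr hrate.symm
  obtain ⟨hLint, hL⟩ := integral_logb_le hIint.1 hI0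
  refine ⟨hdist.1, hdist.2, hpn.1.congr hgain.symm, (integral_congr_ae hgain).trans hpn.2, hrint,
    hQint, ?_⟩
  have hdiff : Integrable (fun ω => a ω - b ω) (μ[|sys.selected k]) := haint.sub hbint
  calc ∫ ω, (sys.rate P k ω - sys.rateQ P k ω) ∂(μ[|sys.selected k])
      ≤ ∫ ω, ((a ω - b ω) + Real.logb 2 (1 + I ω)) ∂(μ[|sys.selected k]) := by
        refine integral_mono_ae (hrint.sub hQint) (hdiff.add hLint) ?_
        filter_upwards [hrate, hQb] with ω h1 h2
        rw [h1]
        linarith [h2.2.2]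
    _ = ∫ ω, Real.logb 2 (1 + I ω) ∂(μ[|sys.selected k]) := by
        rw [integral_add hdiff hLint, integral_sub haint hbint, hab, sub_self, zero_add]
    _ ≤ Real.logb 2 (1 + c * D * G) := by rw [← hIint.2]; exact hL

end System

/-- High-resolution behaviour of the average distortion. -/
theorem tendsto_minBetaMean_div_approxDistortion {M m : ℕ} (hM : M ≠ 0) (hm : m ≠ 0) :
    Tendsto (fun B : ℕ => minBetaMean M m (2 ^ B) / approxDistortion (M + m) M B) atTop
      (𝓝 (Real.Gamma (1 + 1 / (((M + m : ℕ) : ℝ) - M)))) := by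
  have hm' : ((M + m : ℕ) : ℝ) - M = m := by push_cast; ring
  have h2 : Tendsto (fun B : ℕ => 2 ^ B) atTop (atTop : Filter ℕ) :=
    tendsto_pow_atTop_atTop_of_one_lt one_lt_two
  have h := (tendsto_minBetaMean hM hm).comp h2
  have hchoose : 0 < ((M + m - 1).choose (M - 1) : ℝ) := by
    exact_mod_cast Nat.choose_pos (by omega)
  set C : ℝ := ((M + m - 1).choose (M - 1) : ℝ) ^ (-1 / (m : ℝ)) with hC
  have hC0 : C ≠ 0 := (Real.rpow_pos_of_pos hchoose _).ne'
  have h3 := h.div_const C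
  rw [mul_div_cancel_left₀ _ hC0] at h3
  rw [hm', add_comm (1 : ℝ)]
  refine h3.congr fun B => ?_
  simp only [Function.comp_apply, approxDistortion, hm', ← hC]
  have e : (2 : ℝ) ^ (-(B : ℝ) / (m : ℝ)) = (((2 ^ B : ℕ) : ℝ) ^ (1 / (m : ℝ)))⁻¹ := by
    push_cast
    rw [← Real.rpow_natCast, ← Real.rpow_mul (by norm_num), ← Real.rpow_neg (by norm_num)]
    congr 1; ring
  rw [e]
  field_simp

end ZFC
end

theorem theorem4 (N M : ℕ) (hM : 2 ≤ M) (hMN : M < N) :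
    ∃ D : ℕ → ℝ,
      (∀ (B K : ℕ) (P : ℝ) (Ω : Type*) [MeasurableSpace Ω] (μ : Measure Ω)
          [IsProbabilityMeasure μ] (sys : ZFC.System N M B K μ) (k : Fin K) (lam : ℕ → ℝ),
        0 ≤ P →
        μ (sys.selected k) ≠ 0 →
        StrictMonoOn lam (Set.Icc 1 M) →
        (∀ m ∈ Set.Icc 1 M,
          Module.End.HasEigenvalue (Matrix.toLin' (sys.R k)) (lam m : ℂ)) →
        Integrable (sys.distortion k) (μ[|sys.selected k]) ∧
        ∫ ω, sys.distortion k ω ∂(μ[|sys.selected k]) = D B ∧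
        Integrable (fun ω => ‖sys.h k ω‖ ^ 2) (μ[|sys.selected k]) ∧
        ∫ ω, ‖sys.h k ω‖ ^ 2 ∂(μ[|sys.selected k]) = ZFC.gain N M (fun n => 1 / lam n) ∧
        Integrable (sys.rate P k) (μ[|sys.selected k]) ∧
        Integrable (sys.rateQ P k) (μ[|sys.selected k]) ∧
        ∫ ω, (sys.rate P k ω - sys.rateQ P k ω) ∂(μ[|sys.selected k]) ≤
          Real.logb 2 (1 + P / N * D B * ZFC.gain N M (fun n => 1 / lam n))) ∧
      Tendsto (fun B : ℕ => D B / ZFC.approxDistortion N M B) atTop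
        (𝓝 (Real.Gamma (1 + 1 / ((N : ℝ) - M)))) := by
  -- The codimension `N - M` is written `m + 1`: the Beta law and its lack of atoms require a
  -- positive number of remaining coordinates.
  obtain ⟨m, rfl⟩ := Nat.exists_eq_add_of_lt hMN
  rw [add_assoc] at *
  refine ⟨fun B => ZFC.minBetaMean M (m + 1) (2 ^ B), ?_,
    ZFC.tendsto_minBetaMean_div_approxDistortion (by omega) (Nat.succ_ne_zero m)⟩
  intro B K P Ω _ μ _ sys k lam hP hk hlam hev
  exact sys.performance hM (Nat.succ_ne_zero m) hP hk hlam hev
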